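/- Consider binary fork-join algorithms on a shared memory with concurrent reads and exclusive writes, whose machine words hold either an opaque input element or an $O(\log n)$-bit number. The work is the number of executed instructions, the span is the number of instructions on a longest path of the fork-join graph, and the cache complexity, for a cache of $M$ words organized in blocks of $B$ words, is the number of cache misses of the one-processor execution under an optimal replacement policy. An algorithm is cache-agnostic if it does not depend on $M$ and $B$. It obliviously realizes a functionality $F$ if on every input $I$ its output is $F(I)$ and its access pattern (the fork-join graph together with the addresses read and written by every instruction) depends only on the length of $I$. **Theorem.** There is a (deterministic) cache-agnostic binary fork-join algorithm, one program for all $n$, that obliviously sorts $n$ elements of an arbitrary linear order and that is an implementation of bitonic sort: its outputs are those of the bitonic sorting network on $2^k$ wires, $k=\lceil\log_2 n\rceil$ (the input being padded with $2^k-n$ fillers, larger than all elements, when $n$ is not a power of $2$, and the first $n$ outputs being kept), for every interpretation of the two-output comparator gate. For all $n\ge 3$ it has work $O(n\log^2 n)$ and span $O(\log^2 n\cdot\log\log n)$, and its cache complexity is $$O\Big(\frac nB\cdot\log_M n\cdot\max\{1,\log (n/M)\}\Big)\qquad\text{whenever } n>M\ge B^2,\ B\ge 1,\ M\ge 2,\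 n\ge 3;$$ in particular it is $O((n/B)\log_M n\cdot\log(n/M))$ when $n\ge 2M$. Logarithms without a base are to base $2$, and the constants in the $O(\cdot)$ are absolute. -/

import Mathlib

universe u

namespace ForkJoin

/-! ### Words and comparators -/

/-- The operations a machine can perform on the elements (keys) of `α`: the test `lt`, and a
two-input two-output comparator gate with outputs `lo` and `hi`. -/
structure KeyOps (α : Type*) where
  lt : α → α → Prop
  lo : α → α → α
  hi : α → α → α

/-- The intended interpretation: the keys are linearly ordered, and a comparator puts the smaller
key on its first output and the larger one on its second output. -/
def KeyOps.ofLinearOrder (α : Type*) [LinearOrder α] : KeyOps α where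
  lt := fun a b => a < b
  lo := fun a b => min a b
  hi := fun a b => max a b

/-- A machine word: an opaque key, or a natural number (an index, an address, a counter). -/
inductive Word (α : Type*) where
  | key (a : α) : Word α
  | num (k : ℕ) : Word α

/-- Comparisons of words: keys with keys by the given operations, numbers with numbers as usual,
and every key lies below every number (so that a number can serve as a filler). -/
def KeyOps.word {α : Type*} (K : KeyOps α) : KeyOps (Word α) where
  lt := fun
    | .key a, .key b => K.lt a b
    | .key _, .num _ => True
    | .num _, .key _ => False
    | .num i, .num j => i < j
  lo := fun
    | .key a, .key b => .key (K.lo a b)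
    | .key a, .num _ => .key a
    | .num _, .key b => .key b
    | .num i, .num j => .num (min i j)
  hi := fun
    | .key a, .key b => .key (K.hi a b)
    | .key _, .num j => .num j
    | .num i, .key _ => .num i
    | .num i, .num j => .num (max i j)

/-! ### The bitonic sorting network

The networks are given for `2 ^ k` wires and for an arbitrary interpretation of the comparators. -/

/-- The first outputs (`up = true`: the `lo` outputs) of a row of comparators. -/
def firstOut {β : Type*} (K : KeyOps β) (up : Bool) (a b : β) : β :=
  if up then K.lo a b else K.hi a b

/-- The second outputs (`up = true`: the `hi` outputs) of a row of comparators. -/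
def secondOut {β : Type*} (K : KeyOps β) (up : Bool) (a b : β) : β :=
  if up then K.hi a b else K.lo a b

/-- Bitonic merge of `2 ^ k` elements, a butterfly network: in the first layer, every element of
the first half is compared with the element `2 ^ (k - 1)` away from it; then the two halves are
merged independently. -/
def bitonicMerge {β : Type*} (K : KeyOps β) (up : Bool) : ℕ → List β → List β
  | 0, l => l
  | k + 1, l =>
    bitonicMerge K up k
        (List.zipWith (firstOut K up) (l.take (2 ^ k)) (l.drop (2 ^ k))) ++
      bitonicMerge K up k
        (List.zipWith (secondOut K up) (l.take (2 ^ k)) (l.drop (2 ^ k)))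

/-- The bitonic sorting network on `2 ^ k` elements, sorting upwards if `up = true` and downwards
otherwise: sort the two halves in opposite directions, then merge. -/
def bitonicNetwork {β : Type*} (K : KeyOps β) : Bool → ℕ → List β → List β
  | _, 0, l => l
  | up, k + 1, l =>
    bitonicMerge K up (k + 1)
      (bitonicNetwork K up k (l.take (2 ^ k)) ++ bitonicNetwork K (!up) k (l.drop (2 ^ k)))

/-- Bitonic sort of a list of `n` keys: pad with fillers to the next power of two `2 ^ k` (no
filler is used if `n` is a power of two), apply the network, keep the first `n` outputs. -/
def bitonicSort {α : Type*} (K : KeyOps α) (x : List α) : List (Word α) :=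
  (bitonicNetwork K.word true (Nat.clog 2 x.length)
    (x.map Word.key ++
      List.replicate (2 ^ Nat.clog 2 x.length - x.length) (Word.num 0))).take x.length

/-! ### Programs for the binary fork-join machine -/

/-- Arithmetic instructions on numbers. -/
inductive Op where
  | add | sub | mul | div | mod | shl | shr

/-- The value of an arithmetic instruction. -/
def Op.eval : Op → ℕ → ℕ → ℕ
  | .add, a, b => a + b
  | .sub, a, b => a - b
  | .mul, a, b => a * b
  | .div, a, b => a / b
  | .mod, a, b => a % b
  | .shl, a, b => a * 2 ^ b
  | .shr, a, b => a / 2 ^ b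

/-- Commands. Every activation of a procedure has its own frame of `w` registers. Iteration is
expressed by recursive procedures; procedures pass results through the shared memory. -/
inductive Cmd (w : ℕ) where
  /-- do nothing -/
  | skip : Cmd w
  /-- sequential composition -/
  | seq (c₁ c₂ : Cmd w) : Cmd w
  /-- `r := k` -/
  | const (r : Fin w) (k : ℕ) : Cmd w
  /-- `r := s` -/
  | mov (r s : Fin w) : Cmd w
  /-- `r := s op t`, for numbers `s` and `t` -/
  | arith (o : Op) (r s t : Fin w) : Cmd w
  /-- `r := memory[s]` -/
  | load (r s : Fin w) : Cmd w
  /-- `memory[s] := r` -/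
  | store (s r : Fin w) : Cmd w
  /-- a comparator: `(r, s) := (lo r s, hi r s)` -/
  | compare (r s : Fin w) : Cmd w
  /-- `if r < s then c₁ else c₂`; keys may be tested as well as numbers -/
  | ite (r s : Fin w) (c₁ c₂ : Cmd w) : Cmd w
  /-- call procedure number `p`; its first registers are set to the listed registers -/
  | call (p : ℕ) (args : List (Fin w)) : Cmd w
  /-- fork two tasks, the calls of procedures `p` and `q`, and wait until both are done (join) -/
  | fork (p : ℕ) (args : List (Fin w)) (q : ℕ) (args₂ : List (Fin w)) : Cmd w

/-- A program: a number of registers per frame, a main command, and finitely many procedures. A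
program is one finite text for all input lengths and all cache parameters. -/
structure Program where
  width : ℕ
  main : Cmd width
  procs : List (Cmd width)

/-! ### Access patterns, and the work and the span of a computation -/

/-- A memory location: in the shared memory, or on the stack that holds the frames. The blocks of
either region are named in the same way. -/
inductive Loc where
  | heap (a : ℕ) : Loc
  | stack (a : ℕ) : Loc
deriving DecidableEq

/-- The block of `B` consecutive words in which a location lies. -/
def Loc.block (B : ℕ) : Loc → Loc
  | .heap a => .heap (a / B)
  | .stack a => .stack (a / B)

/-- A memory access: read or write, and the location. -/
structure Access where
  write : Bool
  loc : Loc

/-- The access pattern of a computation: its series-parallel graph of forks and joins, in which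
every executed instruction (`op`) is labelled with the accesses it makes, but not with any memory
contents. -/
inductive Trace where
  | nil : Trace
  | op (accs : List Access) : Trace
  | seq (S T : Trace) : Trace
  | par (S T : Trace) : Trace

namespace Trace

/-- The number of executed instructions. A join is one instruction. -/
def work : Trace → ℕ
  | nil => 0
  | op _ => 1
  | seq S T => S.work + T.work
  | par S T => S.work + T.work + 1

/-- The number of instructions on a longest path (parallel time). -/
def span : Trace → ℕ
  | nil => 0
  | op _ => 1
  | seq S T => S.span + T.span
  | par S T => max S.span T.span + 1

/-- All accesses, in the order of the execution on a single processor. -/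
def accesses : Trace → List Access
  | nil => []
  | op l => l
  | seq S T => S.accesses ++ T.accesses
  | par S T => S.accesses ++ T.accesses

/-- Two parallel tasks respect concurrent read, exclusive write: a shared memory cell that is
accessed by both is written by neither. (Parallel tasks have separate stacks.) -/
def NoRace (S T : Trace) : Prop :=
  ∀ x ∈ S.accesses, ∀ y ∈ T.accesses, ∀ a : ℕ,
    x.loc = Loc.heap a → y.loc = Loc.heap a → x.write = false ∧ y.write = false

end Trace

/-! ### Execution -/

/-- The registers of one activation. -/
abbrev Frame (w : ℕ) (α : Type*) := Fin w → Word α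

/-- The contents of the shared memory. -/
abbrev Heap (α : Type*) := ℕ → Word α

/-- Reading register `r` of the frame at depth `d` of the stack. -/
def rdReg {w : ℕ} (d : ℕ) (r : Fin w) : Access := ⟨false, Loc.stack (d * w + r)⟩

/-- Writing register `r` of the frame at depth `d` of the stack. -/
def wrReg {w : ℕ} (d : ℕ) (r : Fin w) : Access := ⟨true, Loc.stack (d * w + r)⟩

/-- The frame of a new activation. -/
def newFrame {w : ℕ} {α : Type*} (f : Frame w α) (args : List (Fin w)) : Frame w α :=
  fun r => match args[(r : ℕ)]? with
    | some s => f s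
    | none => Word.num 0

/-- The accesses that set up the frame of a new activation at depth `d + 1`: the arguments are
read from the frame at depth `d`, all registers of the new frame are written. -/
def enter {w : ℕ} (d : ℕ) (args : List (Fin w)) : Trace :=
  Trace.op (args.map (rdReg d) ++ (List.finRange w).map (wrReg (d + 1)))

/-- `Exec P K W d c f h f₂ h₂ T`: command `c` of program `P`, started with registers `f` in the
frame at depth `d` and with shared memory `h`, terminates with registers `f₂` and shared memory
`h₂`, and its access pattern is `T`. All numbers stay below `W`: the machine is stuck on an
overflow, on a key where a number is needed, and on a race between parallel tasks.
As there are no races, the result of a fork is the same for every schedule of the two tasks; it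
is described here by running the first task and then the second one. -/
inductive Exec {α : Type*} (P : Program) (K : KeyOps α) (W : ℕ) :
    ℕ → Cmd P.width → Frame P.width α → Heap α → Frame P.width α → Heap α → Trace → Prop
  | skip {d f h} : Exec P K W d Cmd.skip f h f h Trace.nil
  | seq {d c₁ c₂ f h f₁ h₁ f₂ h₂ S T} :
      Exec P K W d c₁ f h f₁ h₁ S → Exec P K W d c₂ f₁ h₁ f₂ h₂ T →
      Exec P K W d (Cmd.seq c₁ c₂) f h f₂ h₂ (Trace.seq S T)
  | const {d r k f h} : k < W →
      Exec P K W d (Cmd.const r k) f h (Function.update f r (Word.num k)) h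
        (Trace.op [wrReg d r])
  | mov {d r s f h} :
      Exec P K W d (Cmd.mov r s) f h (Function.update f r (f s)) h
        (Trace.op [rdReg d s, wrReg d r])
  | arith {d o r s t f h a b} : f s = Word.num a → f t = Word.num b → o.eval a b < W →
      Exec P K W d (Cmd.arith o r s t) f h (Function.update f r (Word.num (o.eval a b))) h
        (Trace.op [rdReg d s, rdReg d t, wrReg d r])
  | load {d r s f h a} : f s = Word.num a →
      Exec P K W d (Cmd.load r s) f h (Function.update f r (h a)) h
        (Trace.op [rdReg d s, ⟨false, Loc.heap a⟩, wrReg d r])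
  | store {d s r f h a} : f s = Word.num a →
      Exec P K W d (Cmd.store s r) f h f (Function.update h a (f r))
        (Trace.op [rdReg d s, rdReg d r, ⟨true, Loc.heap a⟩])
  | compare {d r s f h} :
      Exec P K W d (Cmd.compare r s) f h
        (Function.update (Function.update f r (K.word.lo (f r) (f s))) s
          (K.word.hi (f r) (f s))) h
        (Trace.op [rdReg d r, rdReg d s, wrReg d r, wrReg d s])
  | ite_true {d r s c₁ c₂ f h f₂ h₂ T} : K.word.lt (f r) (f s) →
      Exec P K W d c₁ f h f₂ h₂ T →
      Exec P K W d (Cmd.ite r s c₁ c₂) f h f₂ h₂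
        (Trace.seq (Trace.op [rdReg d r, rdReg d s]) T)
  | ite_false {d r s c₁ c₂ f h f₂ h₂ T} : ¬ K.word.lt (f r) (f s) →
      Exec P K W d c₂ f h f₂ h₂ T →
      Exec P K W d (Cmd.ite r s c₁ c₂) f h f₂ h₂
        (Trace.seq (Trace.op [rdReg d r, rdReg d s]) T)
  | call {d p args c f h f₁ h₁ T} : P.procs[p]? = some c →
      Exec P K W (d + 1) c (newFrame f args) h f₁ h₁ T →
      Exec P K W d (Cmd.call p args) f h f h₁ (Trace.seq (enter d args) T)
  | fork {d p args q args₂ c₁ c₂ f h f₁ h₁ f₂ h₂ S T} :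
      P.procs[p]? = some c₁ → P.procs[q]? = some c₂ →
      Exec P K W (d + 1) c₁ (newFrame f args) h f₁ h₁ S →
      Exec P K W (d + 1) c₂ (newFrame f args₂) h₁ f₂ h₂ T →
      Trace.NoRace S T →
      Exec P K W d (Cmd.fork p args q args₂) f h f h₂
        (Trace.par (Trace.seq (enter d args) S) (Trace.seq (enter d args₂) T))

/-- At the start, register `0` holds the input length `n`. -/
def initFrame (w : ℕ) (α : Type*) (n : ℕ) : Frame w α :=
  fun r => if (r : ℕ) = 0 then Word.num n else Word.num 0

/-- At the start, cells `0, …, n - 1` of the shared memory hold the input. -/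
def initHeap {α : Type*} (x : List α) : Heap α :=
  fun i => match x[i]? with
    | some a => Word.key a
    | none => Word.num 0

/-- On input `x` of length `n`, with numbers below `W`, the program terminates with `y` in the
cells `0, …, n - 1` of the shared memory, and `T` is the access pattern of the execution. -/
def Program.Runs {α : Type*} (P : Program) (K : KeyOps α) (W : ℕ) (x : List α)
    (y : List (Word α)) (T : Trace) : Prop :=
  x.length < W ∧
  ∃ (f : Frame P.width α) (h : Heap α),
    Exec P K W 0 P.main (initFrame P.width α x.length) (initHeap x) f h T ∧
    (List.range x.length).map h = y

/-- The program obliviously realizes the deterministic functionality `F`, with simulator `Sim`: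
on every input `x` of length `n`, its output is `F x` and its access pattern is `Sim n`. (The
program is deterministic, and the statistical distance to the simulated view is zero.) The machine
words are large enough for numbers below `W n`. -/
def Program.ObliviouslyRealizes {α : Type*} (P : Program) (K : KeyOps α) (W : ℕ → ℕ)
    (F : List α → List (Word α)) (Sim : ℕ → Trace) : Prop :=
  ∀ x : List α, P.Runs K (W x.length) x (F x) (Sim x.length)

/-! ### The cache -/

/-- `CacheRun L S l q`: a cache of `L` lines with contents `S` can serve the sequence `l` of block
requests with `q` misses. Upon a miss the block is loaded, and arbitrary blocks may be evicted. -/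
inductive CacheRun (L : ℕ) : Finset Loc → List Loc → ℕ → Prop
  | nil {S} : CacheRun L S [] 0
  | hit {S b l q} : b ∈ S → CacheRun L S l q → CacheRun L S (b :: l) q
  | miss {S S₂ b l q} : b ∉ S → b ∈ S₂ → S₂ ⊆ insert b S → S₂.card ≤ L →
      CacheRun L S₂ l q → CacheRun L S (b :: l) (q + 1)

/-- The (sequential) cache complexity is at most `bound`: on one processor, whose cache of `M`
words consists of `M / B` lines of `B` words, is initially empty and uses an optimal replacement
policy, the computation incurs at most `bound` cache misses. -/
def Trace.CacheMissesLE (T : Trace) (M B : ℕ) (bound : ℝ) : Prop :=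
  ∃ q : ℕ, CacheRun (M / B) ∅ (T.accesses.map fun x => x.loc.block B) q ∧ (q : ℝ) ≤ bound

end ForkJoin

namespace ForkJoin

/-! ### Addresses and regions -/

/-! A bitonic merge is a butterfly: its layer with stride `2 ^ j` joins exactly the addresses that
differ in bit `j`. Layers whose strides use the bits of a set `F` therefore act separately on each
class of addresses that agree outside `F`, and comparators may be executed in any order compatible
with this. The theorem is about a good order.

A merge of size `2 ^ k` is cut in the middle: first the layers of large stride, then independent
merges of size `2 ^ (k / 2)`. The large strides are processed, in place, on tiles with `2 ^ k` rows
of `2 ^ m` consecutive cells. A tile is split by columns until `k = m + 1`; then its layers are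
halved, and the row bits that a half does not use become parallel rows, which are forked off. The
invariant `k ≤ m + 1` keeps rows long: by `B ^ 2 ≤ M`, the first tiles that fit into the cache have
rows of length at least a constant fraction of `B`, so loading a tile of `N` cells costs `O(N / B)`,
and they still have a number of layers proportional to `log M`.

Hence `k` layers on `N` cells have work `O(k * N)`, span `O(p + m + k * log k)`, and `O(k * N / (B *
log M))` misses (`weight_tileTrace`, `span_tileTrace`, `TallCache.misses_tileTrace`). Merges obey
analogous bounds. Sorting sums them over all merge sizes; for the cache, only the `log (n / M) +
O(1)` sizes that do not fit matter. The work and miss bounds carry a negative constant, which pays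
for the overhead of the inner nodes of the recursion.

Correctness is proved by following the memory as a function (`exec_tileCode`, `exec_mergeCode`,
`exec_sortCode`). The access patterns are explicit functions of numerical arguments, never of keys,
which gives obliviousness; parallel tasks touch disjoint regions, so there are no races. That the
network sorts is the zero-one principle (`map_bitonicNetwork`) together with the halving of bitonic
sequences (`IsBitonic.halve`). -/

theorem testBit_add_two_pow {x b : ℕ} (hx : x.testBit b = false) (j : ℕ) :
    (x + 2 ^ b).testBit j = if j = b then true else x.testBit j := by
  have hc : x % 2 ^ (b + 1) < 2 ^ b := by
    have : x / 2 ^ b % 2 = 0 := by simpa [Nat.testBit_eq_decide_div_mod_eq] using hx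
    rw [Nat.mod_pow_succ, this]
    simpa using Nat.mod_lt _ (Nat.two_pow_pos b)
  have h1 : x = 2 ^ (b + 1) * (x / 2 ^ (b + 1)) + x % 2 ^ (b + 1) := (Nat.div_add_mod _ _).symm
  have h2 : x + 2 ^ b = 2 ^ (b + 1) * (x / 2 ^ (b + 1)) + (2 ^ b + x % 2 ^ (b + 1)) := by omega
  have h3 : x % 2 ^ (b + 1) < 2 ^ (b + 1) := Nat.mod_lt _ (Nat.two_pow_pos _)
  have h4 : 2 ^ b + x % 2 ^ (b + 1) < 2 ^ (b + 1) := by rw [pow_succ] at *; omega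
  rcases lt_trichotomy j b with h | rfl | h
  · rw [if_neg h.ne, add_comm, Nat.testBit_two_pow_add_gt h]
  · rw [if_pos rfl, add_comm, Nat.testBit_two_pow_add_eq, hx]; rfl
  · rw [if_neg h.ne', h2, Nat.testBit_two_pow_mul_add _ h4, if_neg (by omega)]
    conv_rhs => rw [h1, Nat.testBit_two_pow_mul_add _ h3, if_neg (by omega)]

theorem xor_two_pow_of_testBit_false {x b : ℕ} (hx : x.testBit b = false) :
    x ^^^ 2 ^ b = x + 2 ^ b := by
  refine Nat.eq_of_testBit_eq fun j => ?_
  rw [testBit_add_two_pow hx, Nat.testBit_xor, Nat.testBit_two_pow]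
  split_ifs with h
  · subst h; simp [hx]
  · simp [Ne.symm h]

theorem lt_two_pow_of_add {x b E : ℕ} (hx : x < 2 ^ E) (hb : b < E)
    (hxb : x.testBit b = false) : x + 2 ^ b < 2 ^ E := by
  rw [← xor_two_pow_of_testBit_false hxb]
  exact Nat.xor_lt_two_pow hx (Nat.pow_lt_pow_right (by norm_num) hb)

/-- The addresses that agree with `base` on all bits outside of `F`. -/
def region (base : ℕ) (F : Finset ℕ) : Set ℕ :=
  {x | ∀ j, j ∉ F → x.testBit j = base.testBit j}

theorem mem_region_self (base : ℕ) (F : Finset ℕ) : base ∈ region base F := fun _ _ => rfl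

theorem region_mono {base : ℕ} {F G : Finset ℕ} (h : F ⊆ G) : region base F ⊆ region base G :=
  fun _ hx j hj => hx j fun h' => hj (h h')

theorem region_add_subset {base b : ℕ} {F G : Finset ℕ} (hb : base.testBit b = false)
    (hG : insert b F ⊆ G) : region (base + 2 ^ b) F ⊆ region base G := by
  intro x hx j hj
  have h1 : j ∉ F := fun h => hj (hG (Finset.mem_insert_of_mem h))
  have h2 : j ≠ b := fun h => hj (hG (h ▸ Finset.mem_insert_self _ _))
  rw [hx j h1, testBit_add_two_pow hb, if_neg h2]

theorem region_insert {base b : ℕ} {F : Finset ℕ} (hb : base.testBit b = false) (hF : b ∉ F) :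
    region base (insert b F) = region base F ∪ region (base + 2 ^ b) F := by
  ext x
  constructor
  · intro hx
    by_cases h : x.testBit b = true
    · right
      intro j hj
      rw [testBit_add_two_pow hb]
      split_ifs with h'
      · rw [h', h]
      · exact hx j (by simp [h', hj])
    · left
      intro j hj
      by_cases h' : j = b
      · subst h'; rw [hb]; simpa using h
      · exact hx j (by simp [h', hj])
  · rintro (hx | hx)
    · exact region_mono (Finset.subset_insert _ _) hx
    · exact region_add_subset hb subset_rfl hx

theorem region_disjoint {base b : ℕ} {F : Finset ℕ} (hb : base.testBit b = false) (hF : b ∉ F) :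
    Disjoint (region base F) (region (base + 2 ^ b) F) := by
  rw [Set.disjoint_left]
  intro x h1 h2
  have := (h1 b hF).symm.trans (h2 b hF)
  rw [testBit_add_two_pow hb, hb] at this
  simp at this

theorem xor_mem_region {base x b : ℕ} {F : Finset ℕ} (hb : b ∈ F) (hx : x ∈ region base F) :
    x ^^^ 2 ^ b ∈ region base F := by
  intro j hj
  have : b ≠ j := fun h => hj (h ▸ hb)
  rw [Nat.testBit_xor, Nat.testBit_two_pow]
  simp [this, hx j hj]

theorem mem_region_range {base k x : ℕ} :
    x ∈ region base (Finset.range k) ↔ x / 2 ^ k = base / 2 ^ k := by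
  constructor
  · intro hx
    refine Nat.eq_of_testBit_eq fun j => ?_
    rw [← Nat.testBit_add, ← Nat.testBit_add]
    exact hx _ (by simp)
  · intro hx j hj
    have hj' : k ≤ j := by simpa using hj
    obtain ⟨i, rfl⟩ := Nat.exists_eq_add_of_le' hj'
    rw [Nat.testBit_add, Nat.testBit_add, hx]

theorem mem_region_range_of_dvd {base k x : ℕ} (h : 2 ^ k ∣ base) :
    x ∈ region base (Finset.range k) ↔ base ≤ x ∧ x < base + 2 ^ k := by
  rw [mem_region_range]
  obtain ⟨c, rfl⟩ := h
  have hp := Nat.two_pow_pos k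
  rw [Nat.mul_div_cancel_left _ hp, Nat.div_eq_iff hp, mul_comm c]
  omega

/-! ### Layers of the butterfly network, acting on memories -/

section Layers

variable {β : Type*}

/-- The layer with stride `2 ^ j`. -/
def layer (K : KeyOps β) (up : Bool) (j : ℕ) (h : ℕ → β) : ℕ → β := fun x =>
  if x.testBit j then secondOut K up (h (x ^^^ 2 ^ j)) (h x)
  else firstOut K up (h x) (h (x ^^^ 2 ^ j))

/-- The layers with strides `2 ^ (s + k - 1), …, 2 ^ s`, in this order. -/
def layers (K : KeyOps β) (up : Bool) (s : ℕ) : ℕ → (ℕ → β) → ℕ → β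
  | 0, h => h
  | k + 1, h => layers K up s k (layer K up (s + k) h)

theorem layers_add (K : KeyOps β) (up : Bool) (s k₂ k₁ : ℕ) (h : ℕ → β) :
    layers K up s (k₂ + k₁) h = layers K up s k₂ (layers K up (s + k₂) k₁ h) := by
  induction k₁ generalizing h with
  | zero => rfl
  | succ k ih => rw [← add_assoc, layers, ih, layers, add_assoc]

/-- Locality: a region with `j` among its free bits is closed under flipping bit `j`, so no
comparator of the layer crosses its boundary. -/
theorem layer_eqOn {K : KeyOps β} {up : Bool} {j base : ℕ} {F : Finset ℕ} {h h' : ℕ → β}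
    (hj : j ∈ F) (hh : Set.EqOn h h' (region base F)) :
    Set.EqOn (layer K up j h) (layer K up j h') (region base F) := by
  intro x hx
  simp only [layer, hh hx, hh (xor_mem_region hj hx)]

theorem layers_eqOn {K : KeyOps β} {up : Bool} {s k base : ℕ} {F : Finset ℕ} {h h' : ℕ → β}
    (hF : Finset.Ico s (s + k) ⊆ F) (hh : Set.EqOn h h' (region base F)) :
    Set.EqOn (layers K up s k h) (layers K up s k h') (region base F) := by
  induction k generalizing h h' with
  | zero => exact hh
  | succ k ih =>
    refine ih ((Finset.Ico_subset_Ico_right (by omega)).trans hF) (layer_eqOn (hF ?_) hh)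
    simp

open Classical in
/-- The memory `h`, with the contents of `R` replaced by those of `h'`. -/
noncomputable def patch (R : Set ℕ) (h' h : ℕ → β) : ℕ → β := fun x =>
  if x ∈ R then h' x else h x

theorem patch_eqOn (R : Set ℕ) (h' h : ℕ → β) : Set.EqOn (patch R h' h) h' R :=
  fun _ hx => if_pos hx

theorem patch_eqOn_compl (R : Set ℕ) (h' h : ℕ → β) : Set.EqOn (patch R h' h) h Rᶜ :=
  fun _ hx => if_neg hx

/-- For two calls in sequence: the second reads only inside the region, where the first has left the
true intermediate values. -/
theorem patch_layers_comp {K : KeyOps β} {up : Bool} {s k₂ k₁ base : ℕ} {F : Finset ℕ}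
    {h : ℕ → β} (hF : Finset.Ico s (s + k₂) ⊆ F) :
    patch (region base F) (layers K up s k₂ (patch (region base F)
      (layers K up (s + k₂) k₁ h) h)) (patch (region base F) (layers K up (s + k₂) k₁ h) h) =
    patch (region base F) (layers K up s (k₂ + k₁) h) h := by
  funext x
  by_cases hx : x ∈ region base F
  · rw [patch_eqOn _ _ _ hx, patch_eqOn _ _ _ hx, layers_add]
    exact layers_eqOn hF (patch_eqOn _ _ _) hx
  · rw [patch_eqOn_compl _ _ _ hx, patch_eqOn_compl _ _ _ hx, patch_eqOn_compl _ _ _ hx]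

/-- For forks: the first task changes only the half with bit `b` unset, so the second one still
finds the original contents in its own half. -/
theorem patch_layers_union {K : KeyOps β} {up : Bool} {s k base b : ℕ} {F : Finset ℕ}
    {h : ℕ → β} (hF : Finset.Ico s (s + k) ⊆ F) (hb : base.testBit b = false) (hbF : b ∉ F) :
    patch (region (base + 2 ^ b) F) (layers K up s k (patch (region base F)
      (layers K up s k h) h)) (patch (region base F) (layers K up s k h) h) =
    patch (region base (insert b F)) (layers K up s k h) h := by
  have hd := region_disjoint hb hbF
  have hu := region_insert hb hbF
  funext x
  by_cases h2 : x ∈ region (base + 2 ^ b) F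
  · have h1 : x ∈ region base (insert b F) := hu ▸ Or.inr h2
    rw [patch_eqOn _ _ _ h2, patch_eqOn _ _ _ h1]
    refine layers_eqOn hF (fun y hy => patch_eqOn_compl _ _ _ ?_) h2
    exact fun hy' => Set.disjoint_left.1 hd hy' hy
  · rw [patch_eqOn_compl _ _ _ h2]
    by_cases h1 : x ∈ region base F
    · have h3 : x ∈ region base (insert b F) := hu ▸ Or.inl h1
      rw [patch_eqOn _ _ _ h1, patch_eqOn _ _ _ h3]
    · have h3 : x ∉ region base (insert b F) := by rw [hu]; simp [h1, h2]
      rw [patch_eqOn_compl _ _ _ h1, patch_eqOn_compl _ _ _ h3]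

/-! ### The butterfly network on lists -/

/-- The list of the first `n` values of `f`. -/
def tab (n : ℕ) (f : ℕ → β) : List β := (List.range n).map f

theorem tab_congr {n : ℕ} {f g : ℕ → β} (h : ∀ i < n, f i = g i) : tab n f = tab n g :=
  List.map_congr_left fun i hi => h i (List.mem_range.1 hi)

theorem length_tab (n : ℕ) (f : ℕ → β) : (tab n f).length = n := by simp [tab]

theorem tab_add (m n : ℕ) (f : ℕ → β) : tab (m + n) f = tab m f ++ tab n fun i => f (m + i) := by
  simp [tab, List.range_add, Function.comp_def]

theorem tab_two_pow_succ (k : ℕ) (f : ℕ → β) :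
    tab (2 ^ (k + 1)) f = tab (2 ^ k) f ++ tab (2 ^ k) fun i => f (2 ^ k + i) := by
  rw [pow_succ, mul_two, tab_add]

theorem take_tab_two_pow_succ (k : ℕ) (f : ℕ → β) :
    (tab (2 ^ (k + 1)) f).take (2 ^ k) = tab (2 ^ k) f := by
  rw [tab_two_pow_succ, List.take_left' (length_tab _ _)]

theorem drop_tab_two_pow_succ (k : ℕ) (f : ℕ → β) :
    (tab (2 ^ (k + 1)) f).drop (2 ^ k) = tab (2 ^ k) fun i => f (2 ^ k + i) := by
  rw [tab_two_pow_succ, List.drop_left' (length_tab _ _)]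

theorem zipWith_tab {γ δ : Type*} (F : β → γ → δ) (n : ℕ) (f : ℕ → β) (g : ℕ → γ) :
    List.zipWith F (tab n f) (tab n g) = tab n fun i => F (f i) (g i) := by
  simp [tab, List.zipWith_map, List.zipWith_self]

theorem bitonicMerge_tab_succ (K : KeyOps β) (up : Bool) (k : ℕ) (f : ℕ → β) :
    bitonicMerge K up (k + 1) (tab (2 ^ (k + 1)) f) =
      bitonicMerge K up k (tab (2 ^ k) fun i => firstOut K up (f i) (f (2 ^ k + i))) ++
      bitonicMerge K up k (tab (2 ^ k) fun i => secondOut K up (f i) (f (2 ^ k + i))) := by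
  rw [bitonicMerge, take_tab_two_pow_succ, drop_tab_two_pow_succ, zipWith_tab, zipWith_tab]

/-- On an aligned block, flipping the top bit is adding half the length, so the top layer is the
`zipWith` of the two halves. Each half is again aligned, and the remaining layers stay inside it. -/
theorem tab_layers (K : KeyOps β) (up : Bool) (k : ℕ) {base : ℕ} (hb : 2 ^ k ∣ base)
    (h : ℕ → β) :
    tab (2 ^ k) (fun i => layers K up 0 k h (base + i)) =
      bitonicMerge K up k (tab (2 ^ k) fun i => h (base + i)) := by
  induction k generalizing base h with
  | zero => rfl
  | succ k ih =>
    have hk : 2 ^ k ∣ base := (pow_dvd_pow 2 (Nat.le_succ k)).trans hb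
    have bit : ∀ i < 2 ^ k, (base + i).testBit k = false := by
      intro i hi
      obtain ⟨c, rfl⟩ := hb
      rw [Nat.testBit_two_pow_mul_add _ (by rw [pow_succ]; omega), if_pos (by omega)]
      exact Nat.testBit_lt_two_pow hi
    rw [bitonicMerge_tab_succ, tab_two_pow_succ, layers, zero_add]
    congr 1
    · rw [ih hk]
      congr 1
      refine tab_congr fun i hi => ?_
      rw [layer, bit i hi, xor_two_pow_of_testBit_false (bit i hi)]
      simp only [Bool.false_eq_true, if_false]
      congr 2; omega
    · simp only [← add_assoc]
      rw [ih (dvd_add hk dvd_rfl)]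
      congr 1
      refine tab_congr fun i hi => ?_
      have e : base + 2 ^ k + i = (base + i) ^^^ 2 ^ k := by
        rw [xor_two_pow_of_testBit_false (bit i hi)]; omega
      rw [layer, e, Nat.xor_assoc, Nat.xor_self, Nat.xor_zero, Nat.testBit_xor, bit i hi]
      simp

end Layers

/-! ### The program -/

/-- Straight-line code that splits off the top bit of the parallel rows of a tile. -/
def rowSplit : Cmd 12 :=
  .seq (.const 7 1) <| .seq (.arith .sub 5 5 7) <| .seq (.arith .add 8 4 5) <|
  .seq (.arith .shl 8 7 8) (.arith .add 8 0 8)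

/-- Straight-line code that splits off the top bit of the columns of a tile. -/
def columnSplit : Cmd 12 :=
  .seq (.arith .sub 3 3 7) <| .seq (.arith .shl 8 7 3) (.arith .add 8 0 8)

/-- Straight-line code that halves the number of layers of a tile. -/
def layerSplit : Cmd 12 :=
  .seq (.const 8 2) <| .seq (.arith .div 7 2 8) <| .seq (.arith .sub 8 2 7) (.arith .add 9 1 8)

/-- A single comparator between the cells `base` and `base + 2 ^ s`. -/
def comparator : Cmd 12 :=
  .seq (.seq (.arith .shl 8 7 1) (.arith .add 8 0 8)) <|
  .seq (.load 9 0) <| .seq (.load 10 8) <| .seq (.compare 9 10) <|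
  -- The branch depends on the direction, not on keys; both branches write the same two cells in the
  -- same order.
  .ite 11 6 (.seq (.store 0 9) (.store 8 10)) (.seq (.store 0 10) (.store 8 9))

/-- Procedure `0`, with registers `base, s, k, m, t, p, up`: the layers with strides
`2 ^ (s + k - 1), …, 2 ^ s` on the tile of the addresses that agree with `base` except for the bits
in `[0, m)` (columns), `[s, s + k)` (rows) and `[t, t + p)` (parallel rows). -/
def tileCode : Cmd 12 :=
  -- Register `11` is never written and never receives an argument, so it is `0` in every
  -- activation: the test is `0 < p`.
  .ite 11 5
    (.seq rowSplit (.fork 0 [0, 1, 2, 3, 4, 5, 6] 0 [8, 1, 2, 3, 4, 5, 6]))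
    (.seq (.const 7 1) (.ite 3 2
      (.ite 7 2
        (.seq layerSplit
          -- The larger strides come first. The row bits not used by a call are its parallel rows,
          -- so both calls cover the same tile.
          (.seq (.call 0 [0, 9, 7, 3, 1, 8, 6]) (.call 0 [0, 1, 8, 3, 9, 7, 6])))
        comparator)
      (.seq columnSplit (.fork 0 [0, 1, 2, 3, 4, 5, 6] 0 [8, 1, 2, 3, 4, 5, 6]))))

/-- Straight-line code that splits off the top bit of the parallel rows of a merge. -/
def mergeRowSplit : Cmd 12 :=
  .seq (.const 7 1) <| .seq (.arith .sub 2 2 7) <| .seq (.arith .add 8 1 2) <|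
  .seq (.arith .shl 8 7 8) (.arith .add 8 0 8)

/-- Straight-line code that halves the number of layers of a merge. -/
def mergeLayerSplit : Cmd 12 :=
  .seq (.const 8 2) <| .seq (.arith .div 8 1 8) (.arith .sub 9 1 8)

/-- Procedure `1`, with registers `base, k, p, up`: `2 ^ p` consecutive bitonic merges of size
`2 ^ k`. -/
def mergeCode : Cmd 12 :=
  .ite 11 2
    (.seq mergeRowSplit (.fork 1 [0, 1, 2, 3] 1 [8, 1, 2, 3]))
    (.seq (.const 7 1) (.ite 7 1
      (.seq mergeLayerSplit
        -- A tile with `s = m = k / 2` and `k - k / 2` layers, followed by `2 ^ (k - k / 2)` merges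
        -- of size `2 ^ (k / 2)`.
        (.seq (.call 0 [0, 8, 9, 8, 11, 11, 3]) (.call 1 [0, 8, 9, 3])))
      (.call 0 [0, 11, 1, 11, 11, 11, 3])))

/-- Straight-line code that prepares the two recursive calls of the sorting procedure. -/
def sortSplit : Cmd 12 :=
  .seq (.const 7 1) <| .seq (.arith .sub 8 1 7) <| .seq (.arith .shl 9 7 8) <|
  -- `1 - up` is the opposite direction.
  .seq (.arith .add 9 0 9) (.arith .sub 10 7 2)

/-- Procedure `2`, with registers `base, k, up`: bitonic sort of `2 ^ k` cells. -/
def sortCode : Cmd 12 :=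
  .ite 11 1
    (.seq sortSplit (.seq (.fork 2 [0, 8, 2] 2 [9, 8, 10]) (.call 1 [0, 1, 11, 2])))
    .skip

/-- Straight-line code for the search for the next power of two. -/
def doubling : Cmd 12 :=
  .seq (.const 7 1) <| .seq (.arith .add 1 1 7) (.arith .add 2 2 2)

/-- Procedure `3`, with registers `n, k, 2 ^ k`: increases `k` until `n ≤ 2 ^ k`, and sorts. -/
def startCode : Cmd 12 :=
  .ite 2 0 (.seq doubling (.call 3 [0, 1, 2])) (.seq (.const 7 1) (.call 2 [11, 1, 7]))

/-- Cache-agnostic bitonic sort. -/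
abbrev sortProgram : Program :=
  -- Register `2` is initially `0`, so the search starts from `k = 0` and `2 ^ 0 = 1`.
  ⟨12, .seq (.const 1 1) (.call 3 [0, 2, 1]), [tileCode, mergeCode, sortCode, startCode]⟩

/-! ### Its access pattern -/

/-- The access pattern of straight-line code that does not use the shared memory. -/
def lineTrace (d : ℕ) : Cmd 12 → Trace
  | .seq a b => .seq (lineTrace d a) (lineTrace d b)
  | .const r _ => .op [wrReg d r]
  | .arith _ r s t => .op [rdReg d s, rdReg d t, wrReg d r]
  | _ => .nil

/-- The access pattern of a test. -/
def testTrace (d : ℕ) (r s : Fin 12) : Trace := .op [rdReg d r, rdReg d s]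

/-- The access pattern of a call. -/
def callTrace (d : ℕ) (args : List (Fin 12)) (T : Trace) : Trace := .seq (enter d args) T

/-- The access pattern of a fork. -/
def forkTrace (d : ℕ) (args args₂ : List (Fin 12)) (S T : Trace) : Trace :=
  .par (.seq (enter d args) S) (.seq (enter d args₂) T)

/-- The access pattern of a comparator. -/
def comparatorTrace (d x y : ℕ) (up : Bool) : Trace :=
  .seq (lineTrace d (.seq (.arith .shl 8 7 1) (.arith .add 8 0 8))) <|
  .seq (.op [rdReg (w := 12) d 0, ⟨false, .heap x⟩, wrReg (w := 12) d 9]) <|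
  .seq (.op [rdReg (w := 12) d 8, ⟨false, .heap y⟩, wrReg (w := 12) d 10]) <|
  .seq (.op [rdReg (w := 12) d 9, rdReg (w := 12) d 10, wrReg (w := 12) d 9,
    wrReg (w := 12) d 10]) <|
  .seq (testTrace d 11 6) <|
  .seq (.op [rdReg (w := 12) d 0, rdReg (w := 12) d (if up then 9 else 10), ⟨true, .heap x⟩])
    (.op [rdReg (w := 12) d 8, rdReg (w := 12) d (if up then 10 else 9), ⟨true, .heap y⟩])

/-- The access pattern of procedure `0`, as a function of its depth on the stack and of its
arguments. -/
def tileTrace (d base s k m t p : ℕ) (up : Bool) : Trace :=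
  if 0 < p then
    .seq (testTrace d 11 5) <| .seq (lineTrace d rowSplit) <|
      forkTrace d [0, 1, 2, 3, 4, 5, 6] [8, 1, 2, 3, 4, 5, 6]
        (tileTrace (d + 1) base s k m t (p - 1) up)
        (tileTrace (d + 1) (base + 2 ^ (t + (p - 1))) s k m t (p - 1) up)
  else .seq (testTrace d 11 5) <| .seq (lineTrace d (.const 7 1)) <| .seq (testTrace d 3 2) <|
    if m < k then .seq (testTrace d 7 2) <|
      if 1 < k then
        .seq (lineTrace d layerSplit) <|
        .seq
          (callTrace d [0, 9, 7, 3, 1, 8, 6]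
            (tileTrace (d + 1) base (s + (k - k / 2)) (k / 2) m s (k - k / 2) up))
          (callTrace d [0, 1, 8, 3, 9, 7, 6]
            (tileTrace (d + 1) base s (k - k / 2) m (s + (k - k / 2)) (k / 2) up))
      else comparatorTrace d base (base + 2 ^ s) up
    -- Never reached by the calls made, which have `0 < k`; without it, `k = m = 0` would recurse
    -- forever.
    else if k = 0 then .nil else
      .seq (lineTrace d columnSplit) <|
      forkTrace d [0, 1, 2, 3, 4, 5, 6] [8, 1, 2, 3, 4, 5, 6]
        (tileTrace (d + 1) base s k (m - 1) t p up)
        (tileTrace (d + 1) (base + 2 ^ (m - 1)) s k (m - 1) t p up)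
  -- Halving the layers turns the other row bits into parallel rows, so `k` has to outweigh `p`.
  termination_by 4 * k + m + p

/-- The access pattern of procedure `1`. -/
def mergeTrace (d base k p : ℕ) (up : Bool) : Trace :=
  if 0 < p then
    .seq (testTrace d 11 2) <| .seq (lineTrace d mergeRowSplit) <|
      forkTrace d [0, 1, 2, 3] [8, 1, 2, 3]
        (mergeTrace (d + 1) base k (p - 1) up)
        (mergeTrace (d + 1) (base + 2 ^ (k + (p - 1))) k (p - 1) up)
  else .seq (testTrace d 11 2) <| .seq (lineTrace d (.const 7 1)) <| .seq (testTrace d 7 1) <|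
    if 1 < k then
      .seq (lineTrace d mergeLayerSplit) <|
      .seq
        (callTrace d [0, 8, 9, 8, 11, 11, 3]
          (tileTrace (d + 1) base (k / 2) (k - k / 2) (k / 2) 0 0 up))
        (callTrace d [0, 8, 9, 3] (mergeTrace (d + 1) base (k / 2) (k - k / 2) up))
    else callTrace d [0, 11, 1, 11, 11, 11, 3] (tileTrace (d + 1) base 0 k 0 0 0 up)
  termination_by 2 * k + p

/-- The access pattern of procedure `2`. -/
def sortTrace (d base : ℕ) : ℕ → Bool → Trace
  | 0, _ => .seq (testTrace d 11 1) .nil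
  | k + 1, up =>
    .seq (testTrace d 11 1) <| .seq (lineTrace d sortSplit) <|
    .seq
      (forkTrace d [0, 8, 2] [9, 8, 10]
        (sortTrace (d + 1) base k up) (sortTrace (d + 1) (base + 2 ^ k) k (!up)))
      (callTrace d [0, 1, 11, 2] (mergeTrace (d + 1) base (k + 1) 0 up))

/-- The access pattern of procedure `3`, when `r` doublings remain. -/
def startTrace (d k : ℕ) : ℕ → Trace
  | 0 => .seq (testTrace d 2 0) <| .seq (lineTrace d (.const 7 1)) <|
      callTrace d [11, 1, 7] (sortTrace (d + 1) 0 k true)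
  | r + 1 => .seq (testTrace d 2 0) <| .seq (lineTrace d doubling) <|
      callTrace d [0, 1, 2] (startTrace (d + 1) (k + 1) r)

/-- The access pattern of `sortProgram` on inputs of length `n`. -/
def sortView (n : ℕ) : Trace :=
  .seq (lineTrace 0 (.const 1 1)) <| callTrace 0 [0, 2, 1] (startTrace 1 0 (Nat.clog 2 n))

theorem tileTrace_row (d base s k m t p : ℕ) (up : Bool) :
    tileTrace d base s k m t (p + 1) up =
      .seq (testTrace d 11 5) (.seq (lineTrace d rowSplit)
        (forkTrace d [0, 1, 2, 3, 4, 5, 6] [8, 1, 2, 3, 4, 5, 6]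
          (tileTrace (d + 1) base s k m t p up)
          (tileTrace (d + 1) (base + 2 ^ (t + p)) s k m t p up))) := by
  rw [tileTrace]; simp

theorem tileTrace_column (d base s k m t : ℕ) (up : Bool) (hk : 0 < k) (hm : k ≤ m + 1) :
    tileTrace d base s k (m + 1) t 0 up =
      .seq (testTrace d 11 5) (.seq (lineTrace d (.const 7 1)) (.seq (testTrace d 3 2)
        (.seq (lineTrace d columnSplit)
          (forkTrace d [0, 1, 2, 3, 4, 5, 6] [8, 1, 2, 3, 4, 5, 6]
            (tileTrace (d + 1) base s k m t 0 up)
            (tileTrace (d + 1) (base + 2 ^ m) s k m t 0 up))))) := by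
  rw [tileTrace]; simp [hk.ne', hm]

theorem tileTrace_layer (d base s k m t : ℕ) (up : Bool) (hk : 1 < k) (hm : m < k) :
    tileTrace d base s k m t 0 up =
      .seq (testTrace d 11 5) (.seq (lineTrace d (.const 7 1)) (.seq (testTrace d 3 2)
        (.seq (testTrace d 7 2) (.seq (lineTrace d layerSplit)
        (.seq
          (callTrace d [0, 9, 7, 3, 1, 8, 6]
            (tileTrace (d + 1) base (s + (k - k / 2)) (k / 2) m s (k - k / 2) up))
          (callTrace d [0, 1, 8, 3, 9, 7, 6]
            (tileTrace (d + 1) base s (k - k / 2) m (s + (k - k / 2)) (k / 2) up))))))) := by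
  rw [tileTrace]; simp [hk, hm]

theorem tileTrace_leaf (d base s t : ℕ) (up : Bool) :
    tileTrace d base s 1 0 t 0 up =
      .seq (testTrace d 11 5) (.seq (lineTrace d (.const 7 1)) (.seq (testTrace d 3 2)
        (.seq (testTrace d 7 2) (comparatorTrace d base (base + 2 ^ s) up)))) := by
  rw [tileTrace]; simp

theorem mergeTrace_row (d base k p : ℕ) (up : Bool) :
    mergeTrace d base k (p + 1) up =
      .seq (testTrace d 11 2) (.seq (lineTrace d mergeRowSplit)
        (forkTrace d [0, 1, 2, 3] [8, 1, 2, 3]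
          (mergeTrace (d + 1) base k p up)
          (mergeTrace (d + 1) (base + 2 ^ (k + p)) k p up))) := by
  rw [mergeTrace]; simp

theorem mergeTrace_layer (d base k : ℕ) (up : Bool) (hk : 1 < k) :
    mergeTrace d base k 0 up =
      .seq (testTrace d 11 2) (.seq (lineTrace d (.const 7 1)) (.seq (testTrace d 7 1)
        (.seq (lineTrace d mergeLayerSplit)
        (.seq
          (callTrace d [0, 8, 9, 8, 11, 11, 3]
            (tileTrace (d + 1) base (k / 2) (k - k / 2) (k / 2) 0 0 up))
          (callTrace d [0, 8, 9, 3] (mergeTrace (d + 1) base (k / 2) (k - k / 2) up)))))) := by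
  rw [mergeTrace]; simp [hk]

theorem mergeTrace_leaf (d base : ℕ) (up : Bool) :
    mergeTrace d base 1 0 up =
      .seq (testTrace d 11 2) (.seq (lineTrace d (.const 7 1)) (.seq (testTrace d 7 1)
        (callTrace d [0, 11, 1, 11, 11, 11, 3] (tileTrace (d + 1) base 0 1 0 0 0 up)))) := by
  rw [mergeTrace]; simp

/-- Induction along the recursion of procedure `0`. -/
theorem tile_induction {motive : ℕ → ℕ → ℕ → ℕ → ℕ → ℕ → ℕ → Prop}
    (row : ∀ d base s k m t p, 0 < k → k ≤ m + 1 → motive (d + 1) base s k m t p →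
      motive (d + 1) (base + 2 ^ (t + p)) s k m t p → motive d base s k m t (p + 1))
    (column : ∀ d base s k m t, 0 < k → k ≤ m + 1 → motive (d + 1) base s k m t 0 →
      motive (d + 1) (base + 2 ^ m) s k m t 0 → motive d base s k (m + 1) t 0)
    (layer : ∀ d base s k m t, 1 < k → k = m + 1 →
      motive (d + 1) base (s + (k - k / 2)) (k / 2) m s (k - k / 2) →
      motive (d + 1) base s (k - k / 2) m (s + (k - k / 2)) (k / 2) → motive d base s k m t 0)
    (leaf : ∀ d base s t, motive d base s 1 0 t 0)
    (d base s k m t p : ℕ) (hk : 0 < k) (hm : k ≤ m + 1) : motive d base s k m t p := by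
  induction h : 4 * k + m + p using Nat.strong_induction_on generalizing d base s k m t p with
  | _ N ih =>
    subst h
    rcases p with _ | p
    · rcases hm.eq_or_lt with h | h
      · by_cases h1 : 1 < k
        · exact layer _ _ _ _ _ _ h1 h
            (ih _ (by omega) _ _ _ _ _ _ _ (by omega) (by omega) rfl)
            (ih _ (by omega) _ _ _ _ _ _ _ (by omega) (by omega) rfl)
        · obtain rfl : k = 1 := by omega
          obtain rfl : m = 0 := by omega
          exact leaf _ _ _ _
      · obtain ⟨m, rfl⟩ : ∃ m', m = m' + 1 := ⟨m - 1, by omega⟩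
        exact column _ _ _ _ _ _ hk (by omega)
          (ih _ (by omega) _ _ _ _ _ _ _ (by omega) (by omega) rfl)
          (ih _ (by omega) _ _ _ _ _ _ _ (by omega) (by omega) rfl)
    · exact row _ _ _ _ _ _ _ hk hm
        (ih _ (by omega) _ _ _ _ _ _ _ (by omega) (by omega) rfl)
        (ih _ (by omega) _ _ _ _ _ _ _ (by omega) (by omega) rfl)

/-- Induction along the recursion of procedure `1`. -/
theorem merge_induction {motive : ℕ → ℕ → ℕ → ℕ → Prop}
    (row : ∀ d base k p, 0 < k → motive (d + 1) base k p →
      motive (d + 1) (base + 2 ^ (k + p)) k p → motive d base k (p + 1))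
    (layer : ∀ d base k, 1 < k → motive (d + 1) base (k / 2) (k - k / 2) → motive d base k 0)
    (leaf : ∀ d base, motive d base 1 0)
    (d base k p : ℕ) (hk : 0 < k) : motive d base k p := by
  induction h : 2 * k + p using Nat.strong_induction_on generalizing d base k p with
  | _ N ih =>
    subst h
    rcases p with _ | p
    · by_cases h1 : 1 < k
      · exact layer _ _ _ h1 (ih _ (by omega) _ _ _ _ (by omega) rfl)
      · obtain rfl : k = 1 := by omega
        exact leaf _ _
    · exact row _ _ _ _ hk (ih _ (by omega) _ _ _ _ (by omega) rfl)
        (ih _ (by omega) _ _ _ _ (by omega) rfl)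

/-! ### The regions of the procedures -/

/-- The bits in which the addresses of a tile differ. -/
def tileBits (s k m t p : ℕ) : Finset ℕ :=
  Finset.range m ∪ Finset.Ico s (s + k) ∪ Finset.Ico t (t + p)

theorem mem_tileBits {s k m t p j : ℕ} :
    j ∈ tileBits s k m t p ↔ j < m ∨ (s ≤ j ∧ j < s + k) ∨ (t ≤ j ∧ j < t + p) := by
  simp [tileBits]

theorem Ico_subset_tileBits (s k m t p : ℕ) : Finset.Ico s (s + k) ⊆ tileBits s k m t p := by
  intro j; rw [mem_tileBits, Finset.mem_Ico]; omega

theorem tileBits_row (s k m t p : ℕ) :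
    tileBits s k m t (p + 1) = insert (t + p) (tileBits s k m t p) := by
  ext j; rw [Finset.mem_insert, mem_tileBits, mem_tileBits]; omega

theorem tileBits_column (s k m t : ℕ) :
    tileBits s k (m + 1) t 0 = insert m (tileBits s k m t 0) := by
  ext j; rw [Finset.mem_insert, mem_tileBits, mem_tileBits]; omega

/-- Halving the layers only regroups the row bits; the region stays the same. -/
theorem tileBits_layer_top (s k m t : ℕ) :
    tileBits (s + (k - k / 2)) (k / 2) m s (k - k / 2) = tileBits s k m t 0 := by
  ext j; rw [mem_tileBits, mem_tileBits]; omega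

theorem tileBits_layer_bottom (s k m t : ℕ) :
    tileBits s (k - k / 2) m (s + (k - k / 2)) (k / 2) = tileBits s k m t 0 := by
  ext j; rw [mem_tileBits, mem_tileBits]; omega

/-- The three groups of bits of a tile are disjoint, lie below `E`, and vanish in `base`. -/
structure IsTile (E base s k m t p : ℕ) : Prop where
  le_s : m ≤ s
  -- After a halving the parallel rows lie below the rows (larger strides) or above them (smaller
  -- strides). For `p = 0` the value of `t` is irrelevant.
  disj : p = 0 ∨ (m ≤ t ∧ (t + p ≤ s ∨ s + k ≤ t))
  zero : ∀ j ∈ tileBits s k m t p, base.testBit j = false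
  lt : ∀ j ∈ tileBits s k m t p, j < E
  base_lt : base < 2 ^ E

namespace IsTile

variable {E base s k m t p : ℕ}

theorem row_notMem (h : IsTile E base s k m t (p + 1)) : t + p ∉ tileBits s k m t p := by
  have := h.disj; rw [mem_tileBits]; omega

theorem row_mem : t + p ∈ tileBits s k m t (p + 1) := by
  rw [mem_tileBits]; omega

theorem column_notMem (h : IsTile E base s k (m + 1) t 0) : m ∉ tileBits s k m t 0 := by
  have := h.le_s; rw [mem_tileBits]; omega

theorem column_mem : m ∈ tileBits s k (m + 1) t p := by
  rw [mem_tileBits]; omega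

theorem row_left (h : IsTile E base s k m t (p + 1)) : IsTile E base s k m t p where
  le_s := h.le_s
  disj := by have := h.disj; omega
  zero j hj := h.zero j (by rw [tileBits_row]; exact Finset.mem_insert_of_mem hj)
  lt j hj := h.lt j (by rw [tileBits_row]; exact Finset.mem_insert_of_mem hj)
  base_lt := h.base_lt

theorem row_right (h : IsTile E base s k m t (p + 1)) :
    IsTile E (base + 2 ^ (t + p)) s k m t p where
  le_s := h.le_s
  disj := h.row_left.disj
  zero j hj := by
    rw [testBit_add_two_pow (h.zero _ row_mem), if_neg, h.row_left.zero j hj]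
    rintro rfl; exact h.row_notMem hj
  lt := h.row_left.lt
  base_lt := lt_two_pow_of_add h.base_lt (h.lt _ row_mem) (h.zero _ row_mem)

theorem column_left (h : IsTile E base s k (m + 1) t 0) : IsTile E base s k m t 0 where
  le_s := by have := h.le_s; omega
  disj := Or.inl rfl
  zero j hj := h.zero j (by rw [tileBits_column]; exact Finset.mem_insert_of_mem hj)
  lt j hj := h.lt j (by rw [tileBits_column]; exact Finset.mem_insert_of_mem hj)
  base_lt := h.base_lt

theorem column_right (h : IsTile E base s k (m + 1) t 0) : IsTile E (base + 2 ^ m) s k m t 0 where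
  le_s := h.column_left.le_s
  disj := Or.inl rfl
  zero j hj := by
    rw [testBit_add_two_pow (h.zero _ column_mem), if_neg, h.column_left.zero j hj]
    rintro rfl; exact h.column_notMem hj
  lt := h.column_left.lt
  base_lt := lt_two_pow_of_add h.base_lt (h.lt _ column_mem) (h.zero _ column_mem)

theorem layer_top (h : IsTile E base s k m t 0) :
    IsTile E base (s + (k - k / 2)) (k / 2) m s (k - k / 2) where
  le_s := by have := h.le_s; omega
  disj := by have := h.le_s; omega
  zero := by rw [tileBits_layer_top s k m t]; exact h.zero
  lt := by rw [tileBits_layer_top s k m t]; exact h.lt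
  base_lt := h.base_lt

theorem layer_bottom (h : IsTile E base s k m t 0) :
    IsTile E base s (k - k / 2) m (s + (k - k / 2)) (k / 2) where
  le_s := h.le_s
  disj := by have := h.le_s; omega
  zero := by rw [tileBits_layer_bottom s k m t]; exact h.zero
  lt := by rw [tileBits_layer_bottom s k m t]; exact h.lt
  base_lt := h.base_lt

end IsTile

/-- The bits below `k` vanish in `base`, and `base` and `k` fit to memories of size `2 ^ E`. -/
structure IsBlock (E base k : ℕ) : Prop where
  zero : ∀ j < k, base.testBit j = false
  le : k ≤ E
  base_lt : base < 2 ^ E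

namespace IsBlock

variable {E base k p : ℕ}

theorem mono {l : ℕ} (h : IsBlock E base k) (hl : l ≤ k) : IsBlock E base l where
  zero j hj := h.zero j (hj.trans_le hl)
  le := hl.trans h.le
  base_lt := h.base_lt

theorem right (h : IsBlock E base (k + 1)) : IsBlock E (base + 2 ^ k) k where
  zero j hj := by
    rw [testBit_add_two_pow (h.zero _ k.lt_succ_self), if_neg hj.ne, h.zero j (by omega)]
  le := (h.mono k.le_succ).le
  base_lt := lt_two_pow_of_add h.base_lt h.le (h.zero _ k.lt_succ_self)

theorem tile (h : IsBlock E base k) :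
    IsTile E base (k / 2) (k - k / 2) (k / 2) 0 0 where
  le_s := le_rfl
  disj := Or.inl rfl
  zero j hj := by rw [mem_tileBits] at hj; exact h.zero j (by omega)
  lt j hj := by rw [mem_tileBits] at hj; have := h.le; omega
  base_lt := h.base_lt

theorem leaf (h : IsBlock E base 1) : IsTile E base 0 1 0 0 0 where
  le_s := le_rfl
  disj := Or.inl rfl
  zero j hj := by rw [mem_tileBits] at hj; exact h.zero j (by omega)
  lt j hj := by rw [mem_tileBits] at hj; have := h.le; omega
  base_lt := h.base_lt

theorem dvd (h : IsBlock E base k) : 2 ^ k ∣ base := by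
  refine Nat.dvd_of_mod_eq_zero (Nat.eq_of_testBit_eq fun j => ?_)
  rw [Nat.testBit_mod_two_pow, Nat.zero_testBit]
  by_cases hj : j < k <;> simp [hj, h.zero]

end IsBlock

theorem tileBits_block (k : ℕ) :
    tileBits (k / 2) (k - k / 2) (k / 2) 0 0 = Finset.range k := by
  ext j; rw [mem_tileBits, Finset.mem_range]; omega

theorem tileBits_leaf : tileBits 0 1 0 0 0 = Finset.range 1 := by
  ext j; rw [mem_tileBits, Finset.mem_range]; omega

/-! ### Which locations are accessed -/

/-- All accesses to the shared memory are in `R`, all accesses to the stack are in the frames at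
depths in `[lo, hi)`. -/
def Trace.Within (T : Trace) (R : Set ℕ) (lo hi : ℕ) : Prop :=
  ∀ x ∈ T.accesses, (∃ a ∈ R, x.loc = Loc.heap a) ∨
    ∃ a, lo * 12 ≤ a ∧ a < hi * 12 ∧ x.loc = Loc.stack a

namespace Trace.Within

variable {S T : Trace} {R R' : Set ℕ} {lo hi lo' hi' : ℕ}

theorem mono (h : T.Within R lo hi) (hR : R ⊆ R') (hlo : lo' ≤ lo) (hhi : hi ≤ hi') :
    T.Within R' lo' hi' := by
  intro x hx
  rcases h x hx with ⟨a, ha, e⟩ | ⟨a, h1, h2, e⟩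
  · exact Or.inl ⟨a, hR ha, e⟩
  · exact Or.inr ⟨a, by omega, by omega, e⟩

theorem nil : Trace.nil.Within R lo hi := fun x hx => by simp [Trace.accesses] at hx

theorem seq (hS : S.Within R lo hi) (hT : T.Within R lo hi) : (Trace.seq S T).Within R lo hi := by
  intro x hx
  rw [Trace.accesses, List.mem_append] at hx
  exact hx.elim (hS x) (hT x)

theorem par (hS : S.Within R lo hi) (hT : T.Within R lo hi) : (Trace.par S T).Within R lo hi := by
  intro x hx
  rw [Trace.accesses, List.mem_append] at hx
  exact hx.elim (hS x) (hT x)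

theorem op {l : List Access} (h : ∀ x ∈ l, (∃ a ∈ R, x.loc = Loc.heap a) ∨
    ∃ a, lo * 12 ≤ a ∧ a < hi * 12 ∧ x.loc = Loc.stack a) : (Trace.op l).Within R lo hi := h

/-- Races concern the shared memory only, so overlapping stack depths do no harm. -/
theorem noRace (hS : S.Within R lo hi) (hT : T.Within R' lo' hi') (hd : Disjoint R R') :
    Trace.NoRace S T := by
  intro x hx y hy a hxa hya
  rcases hS x hx with ⟨b, hb, e⟩ | ⟨b, -, -, e⟩
  · rcases hT y hy with ⟨c, hc, e'⟩ | ⟨c, -, -, e'⟩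
    · rw [e] at hxa; rw [e'] at hya
      cases hxa; cases hya
      exact (Set.disjoint_left.1 hd hb hc).elim
    · rw [e'] at hya; cases hya
  · rw [e] at hxa; cases hxa

end Trace.Within

theorem within_testTrace (R : Set ℕ) (d e : ℕ) (he : d < e) (r s : Fin 12) :
    (testTrace d r s).Within R d e := by
  refine Trace.Within.op fun x hx => Or.inr ?_
  simp only [List.mem_cons, List.not_mem_nil, or_false] at hx
  rcases hx with rfl | rfl <;> exact ⟨_, by omega, by omega, rfl⟩

theorem within_lineTrace (R : Set ℕ) (d e : ℕ) (he : d < e) (c : Cmd 12) :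
    (lineTrace d c).Within R d e := by
  induction c with
  | seq a b ha hb => exact ha.seq hb
  | const r k =>
    refine Trace.Within.op fun x hx => Or.inr ?_
    simp only [List.mem_cons, List.not_mem_nil, or_false] at hx
    rcases hx with rfl; exact ⟨_, by omega, by omega, rfl⟩
  | arith o r s t =>
    refine Trace.Within.op fun x hx => Or.inr ?_
    simp only [List.mem_cons, List.not_mem_nil, or_false] at hx
    rcases hx with rfl | rfl | rfl <;> exact ⟨_, by omega, by omega, rfl⟩
  | _ => exact Trace.Within.nil

theorem within_enter (R : Set ℕ) (d e : ℕ) (he : d + 1 < e) (args : List (Fin 12)) :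
    (enter d args).Within R d e := by
  refine Trace.Within.op fun x hx => Or.inr ?_
  rw [List.mem_append, List.mem_map, List.mem_map] at hx
  rcases hx with ⟨r, -, rfl⟩ | ⟨r, -, rfl⟩
  · exact ⟨_, by omega, by omega, rfl⟩
  · exact ⟨_, by omega, by omega, rfl⟩

theorem Trace.Within.call {R : Set ℕ} {d e : ℕ} {T : Trace} {args : List (Fin 12)}
    (h : T.Within R (d + 1) e) (he : d + 1 < e) : (callTrace d args T).Within R d e :=
  (within_enter R d e he args).seq (h.mono subset_rfl (by omega) le_rfl)

theorem Trace.Within.fork {R : Set ℕ} {d e : ℕ} {S T : Trace} {args args₂ : List (Fin 12)}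
    (hS : S.Within R (d + 1) e) (hT : T.Within R (d + 1) e) (he : d + 1 < e) :
    (forkTrace d args args₂ S T).Within R d e :=
  (Trace.Within.call hS he).par (Trace.Within.call hT he)

theorem within_comparatorTrace {R : Set ℕ} {d e x y : ℕ} (he : d < e) (hx : x ∈ R) (hy : y ∈ R)
    (up : Bool) : (comparatorTrace d x y up).Within R d e := by
  refine (within_lineTrace R d e he _).seq (.seq (.op ?_) (.seq (.op ?_) (.seq (.op ?_)
    ((within_testTrace R d e he _ _).seq (.seq (.op ?_) (.op ?_))))))
  all_goals
    simp only [List.forall_mem_cons, List.not_mem_nil, false_imp_iff, implies_true, and_true]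
    refine ⟨?_, ?_, ?_⟩ <;>
    first
      | exact Or.inr ⟨_, by omega, by omega, rfl⟩
      | exact Or.inl ⟨_, hx, rfl⟩
      | exact Or.inl ⟨_, hy, rfl⟩
      | exact ⟨Or.inr ⟨_, by omega, by omega, rfl⟩, Or.inr ⟨_, by omega, by omega, rfl⟩⟩

/-- Every call lowers `4 * k + m + p`, which therefore bounds the depth of the stack. The regions
give race freedom; regions and depth together give the number of blocks touched by a tile that fits
into the cache. -/
theorem within_tileTrace {E d base s k m t p : ℕ} (up : Bool) (hk : 0 < k) (hm : k ≤ m + 1)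
    (h : IsTile E base s k m t p) :
    (tileTrace d base s k m t p up).Within (region base (tileBits s k m t p)) d
      (d + (4 * k + m + p) + 1) := by
  refine tile_induction (motive := fun d base s k m t p => IsTile E base s k m t p →
    (tileTrace d base s k m t p up).Within (region base (tileBits s k m t p)) d
      (d + (4 * k + m + p) + 1)) ?_ ?_ ?_ ?_ d base s k m t p hk hm h
  · intro d base s k m t p hk hm ih₁ ih₂ h
    rw [tileTrace_row]
    refine (within_testTrace _ _ _ (by omega) _ _).seq
      ((within_lineTrace _ _ _ (by omega) _).seq (.fork
        ((ih₁ h.row_left).mono ?_ le_rfl (by omega))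
        ((ih₂ h.row_right).mono ?_ le_rfl (by omega)) (by omega)))
    · rw [tileBits_row]; exact region_mono (Finset.subset_insert _ _)
    · rw [tileBits_row]; exact region_add_subset (h.zero _ IsTile.row_mem) subset_rfl
  · intro d base s k m t hk hm ih₁ ih₂ h
    rw [tileTrace_column _ _ _ _ _ _ _ hk hm]
    refine (within_testTrace _ _ _ (by omega) _ _).seq
      ((within_lineTrace _ _ _ (by omega) _).seq ((within_testTrace _ _ _ (by omega) _ _).seq
      ((within_lineTrace _ _ _ (by omega) _).seq (.fork
        ((ih₁ h.column_left).mono ?_ le_rfl (by omega))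
        ((ih₂ h.column_right).mono ?_ le_rfl (by omega)) (by omega)))))
    · rw [tileBits_column]; exact region_mono (Finset.subset_insert _ _)
    · rw [tileBits_column]; exact region_add_subset (h.zero _ IsTile.column_mem) subset_rfl
  · intro d base s k m t hk hm ih₁ ih₂ h
    rw [tileTrace_layer _ _ _ _ _ _ _ hk (by omega)]
    have e₁ := ih₁ h.layer_top
    have e₂ := ih₂ h.layer_bottom
    rw [tileBits_layer_top s k m t] at e₁
    rw [tileBits_layer_bottom s k m t] at e₂
    exact (within_testTrace _ _ _ (by omega) _ _).seq
      ((within_lineTrace _ _ _ (by omega) _).seq ((within_testTrace _ _ _ (by omega) _ _).seq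
      ((within_testTrace _ _ _ (by omega) _ _).seq ((within_lineTrace _ _ _ (by omega) _).seq
        (.seq (.call (e₁.mono subset_rfl le_rfl (by omega)) (by omega))
          (.call (e₂.mono subset_rfl le_rfl (by omega)) (by omega)))))))
  · intro d base s t h
    rw [tileTrace_leaf]
    have hs : s ∈ tileBits s 1 0 t 0 := by rw [mem_tileBits]; omega
    refine (within_testTrace _ _ _ (by omega) _ _).seq
      ((within_lineTrace _ _ _ (by omega) _).seq ((within_testTrace _ _ _ (by omega) _ _).seq
      ((within_testTrace _ _ _ (by omega) _ _).seq
        (within_comparatorTrace (by omega) (mem_region_self _ _) ?_ up))))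
    rw [← xor_two_pow_of_testBit_false (h.zero s hs)]
    exact xor_mem_region hs (mem_region_self _ _)

theorem within_mergeTrace {E d base k p : ℕ} (up : Bool) (hk : 0 < k)
    (h : IsBlock E base (k + p)) :
    (mergeTrace d base k p up).Within (region base (Finset.range (k + p))) d
      (d + (6 * k + p) + 1) := by
  refine merge_induction (motive := fun d base k p => IsBlock E base (k + p) →
    (mergeTrace d base k p up).Within (region base (Finset.range (k + p))) d
      (d + (6 * k + p) + 1)) ?_ ?_ ?_ d base k p hk h
  · intro d base k p hk ih₁ ih₂ h
    rw [mergeTrace_row]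
    refine (within_testTrace _ _ _ (by omega) _ _).seq
      ((within_lineTrace _ _ _ (by omega) _).seq (.fork
        ((ih₁ (h.mono (by omega))).mono ?_ le_rfl (by omega))
        ((ih₂ (IsBlock.right h)).mono ?_ le_rfl (by omega)) (by omega)))
    · exact region_mono (by simp)
    · refine region_add_subset (h.zero _ (by omega)) ?_
      rw [← add_assoc, Finset.range_add_one]
  · intro d base k hk ih h
    rw [mergeTrace_layer _ _ _ _ hk]
    have e₁ := within_tileTrace (d := d + 1) up (by omega) (by omega) h.tile
    have e₂ := ih (h.mono (by omega))
    rw [tileBits_block] at e₁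
    rw [show k / 2 + (k - k / 2) = k by omega] at e₂
    exact (within_testTrace _ _ _ (by omega) _ _).seq
      ((within_lineTrace _ _ _ (by omega) _).seq ((within_testTrace _ _ _ (by omega) _ _).seq
      ((within_lineTrace _ _ _ (by omega) _).seq
        (.seq (.call (e₁.mono subset_rfl le_rfl (by omega)) (by omega))
          (.call (e₂.mono subset_rfl le_rfl (by omega)) (by omega))))))
  · intro d base h
    rw [mergeTrace_leaf]
    have e := within_tileTrace (d := d + 1) up (by omega) (by omega) h.leaf
    rw [tileBits_leaf] at e
    exact (within_testTrace _ _ _ (by omega) _ _).seq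
      ((within_lineTrace _ _ _ (by omega) _).seq ((within_testTrace _ _ _ (by omega) _ _).seq
        (.call (e.mono subset_rfl le_rfl (by omega)) (by omega))))

theorem within_sortTrace {E d base k : ℕ} (up : Bool) (h : IsBlock E base k) :
    (sortTrace d base k up).Within (region base (Finset.range k)) d (d + 7 * k + 1) := by
  induction k generalizing d base up with
  | zero => exact (within_testTrace _ _ _ (by omega) _ _).seq .nil
  | succ k ih =>
    refine (within_testTrace _ _ _ (by omega) _ _).seq
      ((within_lineTrace _ _ _ (by omega) _).seq (.seq (.fork
        ((ih up (h.mono k.le_succ)).mono ?_ le_rfl (by omega))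
        ((ih _ h.right).mono ?_ le_rfl (by omega)) (by omega)) (.call ?_ (by omega))))
    · exact region_mono (by simp)
    · refine region_add_subset (h.zero _ (by omega)) ?_
      rw [Finset.range_add_one]
    · exact (within_mergeTrace up k.succ_pos h).mono subset_rfl le_rfl (by omega)

section Execution

variable {α : Type*} {K : KeyOps α} {W : ℕ}

/-! ### Execution of the procedures -/

/-- The number that represents a direction. -/
def dirNum (up : Bool) : ℕ := if up then 1 else 0

/-- The arguments of procedure `0`. -/
structure TileFrame (f : Frame 12 α) (base s k m t p : ℕ) (up : Bool) : Prop where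
  r0 : f 0 = .num base
  r1 : f 1 = .num s
  r2 : f 2 = .num k
  r3 : f 3 = .num m
  r4 : f 4 = .num t
  r5 : f 5 = .num p
  r6 : f 6 = .num (dirNum up)
  r11 : f 11 = .num 0

/-- The arguments of procedure `1`. -/
structure MergeFrame (f : Frame 12 α) (base k p : ℕ) (up : Bool) : Prop where
  r0 : f 0 = .num base
  r1 : f 1 = .num k
  r2 : f 2 = .num p
  r3 : f 3 = .num (dirNum up)
  r11 : f 11 = .num 0

/-- The arguments of procedure `2`. -/
structure SortFrame (f : Frame 12 α) (base k : ℕ) (up : Bool) : Prop where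
  r0 : f 0 = .num base
  r1 : f 1 = .num k
  r2 : f 2 = .num (dirNum up)
  r11 : f 11 = .num 0

theorem exec_const_one {d : ℕ} {f : Frame 12 α} {h : Heap α} (hW : 2 < W) :
    Exec sortProgram K W d (.const 7 1) f h (Function.update f 7 (.num 1)) h
      (lineTrace d (.const 7 1)) :=
  .const (by omega)

theorem lt_of_num {a b : ℕ} {x y : Word α} (hx : x = .num a) (hy : y = .num b) :
    K.word.lt x y ↔ a < b := by
  subst hx hy; rfl

theorem exec_store {d a : ℕ} {s r : Fin 12} {f : Frame 12 α} {h : Heap α} {v : Word α}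
    (hs : f s = .num a) (hr : f r = v) :
    Exec sortProgram K W d (.store s r) f h f (Function.update h a v)
      (.op [rdReg d s, rdReg d r, ⟨true, .heap a⟩]) := by
  subst hr; exact .store hs

theorem exec_rowSplit {d base s k m t p : ℕ} {up : Bool} {f : Frame 12 α} {h : Heap α}
    (hf : TileFrame f base s k m t (p + 1) up) (hW : 2 < W) (hp : p < W) (ht : t + p < W)
    (h2 : 2 ^ (t + p) < W) (hb : base + 2 ^ (t + p) < W) :
    ∃ g, Exec sortProgram K W d rowSplit f h g h (lineTrace d rowSplit) ∧
      TileFrame g base s k m t p up ∧ g 8 = .num (base + 2 ^ (t + p)) := by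
  obtain ⟨r0, r1, r2, r3, r4, r5, r6, r11⟩ := hf
  refine ⟨_, .seq (.const (by omega)) (.seq (.arith (a := p + 1) (b := 1) ?_ ?_ ?_)
    (.seq (.arith (a := t) (b := p) ?_ ?_ ?_) (.seq (.arith (a := 1) (b := t + p) ?_ ?_ ?_)
    (.arith (a := base) (b := 2 ^ (t + p)) ?_ ?_ ?_)))), ⟨?_, ?_, ?_, ?_, ?_, ?_, ?_, ?_⟩, ?_⟩
  all_goals simp [Function.update, Op.eval, *]

theorem exec_columnSplit {d base s k m t p : ℕ} {up : Bool} {f : Frame 12 α} {h : Heap α}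
    (hf : TileFrame f base s k (m + 1) t p up) (h7 : f 7 = .num 1) (hm : m < W)
    (h2 : 2 ^ m < W) (hb : base + 2 ^ m < W) :
    ∃ g, Exec sortProgram K W d columnSplit f h g h (lineTrace d columnSplit) ∧
      TileFrame g base s k m t p up ∧ g 8 = .num (base + 2 ^ m) := by
  obtain ⟨r0, r1, r2, r3, r4, r5, r6, r11⟩ := hf
  refine ⟨_, .seq (.arith (a := m + 1) (b := 1) ?_ ?_ ?_)
    (.seq (.arith (a := 1) (b := m) ?_ ?_ ?_)
    (.arith (a := base) (b := 2 ^ m) ?_ ?_ ?_)), ⟨?_, ?_, ?_, ?_, ?_, ?_, ?_, ?_⟩, ?_⟩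
  all_goals simp [Function.update, Op.eval, *]

theorem exec_layerSplit {d base s k m t p : ℕ} {up : Bool} {f : Frame 12 α} {h : Heap α}
    (hf : TileFrame f base s k m t p up) (hW : 2 < W) (hk : k < W) (hs : s + (k - k / 2) < W) :
    ∃ g, Exec sortProgram K W d layerSplit f h g h (lineTrace d layerSplit) ∧
      TileFrame g base s k m t p up ∧ g 7 = .num (k / 2) ∧ g 8 = .num (k - k / 2) ∧
      g 9 = .num (s + (k - k / 2)) := by
  obtain ⟨r0, r1, r2, r3, r4, r5, r6, r11⟩ := hf
  have h1 : k / 2 < W := by omega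
  have h2 : k - k / 2 < W := by omega
  refine ⟨_, .seq (.const (by omega)) (.seq (.arith (a := k) (b := 2) ?_ ?_ ?_)
    (.seq (.arith (a := k) (b := k / 2) ?_ ?_ ?_)
    (.arith (a := s) (b := k - k / 2) ?_ ?_ ?_))), ⟨?_, ?_, ?_, ?_, ?_, ?_, ?_, ?_⟩, ?_, ?_, ?_⟩
  all_goals simp [Function.update, Op.eval, *]

theorem exec_comparator {d base s k m t p : ℕ} {up : Bool} {f : Frame 12 α} {h : Heap α}
    (hf : TileFrame f base s k m t p up) (h7 : f 7 = .num 1)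
    (h2 : 2 ^ s < W) (hb : base + 2 ^ s < W) :
    ∃ g, Exec sortProgram K W d comparator f h g
      (Function.update (Function.update h base
        (firstOut K.word up (h base) (h (base + 2 ^ s)))) (base + 2 ^ s)
        (secondOut K.word up (h base) (h (base + 2 ^ s))))
      (comparatorTrace d base (base + 2 ^ s) up) := by
  obtain ⟨r0, r1, r2, r3, r4, r5, r6, r11⟩ := hf
  cases up with
  | true =>
    refine ⟨_, .seq (.seq (.arith (a := 1) (b := s) ?_ ?_ ?_)
      (.arith (a := base) (b := 2 ^ s) ?_ ?_ ?_)) (.seq (.load (a := base) ?_)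
      (.seq (.load (a := base + 2 ^ s) ?_) (.seq .compare (.ite_true ?_
        (.seq (exec_store (a := base) ?_ ?_) (exec_store (a := base + 2 ^ s) ?_ ?_))))))⟩
    case refine_9 =>
      rw [lt_of_num (a := 0) (b := 1)] <;> simp [Function.update, dirNum, *]
    all_goals simp [Function.update, Op.eval, firstOut, secondOut, *]
  | false =>
    refine ⟨_, .seq (.seq (.arith (a := 1) (b := s) ?_ ?_ ?_)
      (.arith (a := base) (b := 2 ^ s) ?_ ?_ ?_)) (.seq (.load (a := base) ?_)
      (.seq (.load (a := base + 2 ^ s) ?_) (.seq .compare (.ite_false ?_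
        (.seq (exec_store (a := base) ?_ ?_) (exec_store (a := base + 2 ^ s) ?_ ?_))))))⟩
    case refine_9 =>
      rw [lt_of_num (a := 0) (b := 0)] <;> simp [Function.update, dirNum, *]
    all_goals simp [Function.update, Op.eval, firstOut, secondOut, *]

/-- The trace does not mention `mem`: this is obliviousness. Describing the final memory as a patch
reduces forks to `patch_layers_union` and consecutive calls to `patch_layers_comp`. Addresses and
strides lie below `2 ^ E`, so their sums cannot overflow. -/
theorem exec_tileCode {E : ℕ} (hW : 2 ^ (E + 1) ≤ W) (up : Bool) {d base s k m t p : ℕ}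
    (hk : 0 < k) (hm : k ≤ m + 1) (h : IsTile E base s k m t p) (f : Frame 12 α) (mem : Heap α)
    (hf : TileFrame f base s k m t p up) :
    ∃ g, Exec sortProgram K W d tileCode f mem g
      (patch (region base (tileBits s k m t p)) (layers K.word up s k mem) mem)
      (tileTrace d base s k m t p up) := by
  have hEW : E < W := by
    have := (E + 1).lt_two_pow_self; omega
  have hE2 : 2 ^ E + 2 ^ E ≤ W := by rw [pow_succ] at hW; omega
  have pw : ∀ j < E, 2 ^ j < 2 ^ E := fun j hj => Nat.pow_lt_pow_right (by norm_num) hj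
  refine tile_induction (motive := fun d base s k m t p => IsTile E base s k m t p →
    ∀ (f : Frame 12 α) (mem : Heap α), TileFrame f base s k m t p up →
    ∃ g, Exec sortProgram K W d tileCode f mem g
      (patch (region base (tileBits s k m t p)) (layers K.word up s k mem) mem)
      (tileTrace d base s k m t p up)) ?_ ?_ ?_ ?_ d base s k m t p hk hm h f mem hf
  all_goals clear hf mem f h hm hk p t m k s base d
  · intro d base s k m t p hk hm ih₁ ih₂ h f mem hf
    have hb := h.lt _ IsTile.row_mem
    have hp := pw _ hb
    have hbase := h.base_lt
    obtain ⟨g, eg, hg, g8⟩ := exec_rowSplit (K := K) (W := W) (d := d) (h := mem) hf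
      (by have := Nat.two_pow_pos (t + p); omega) (by omega) (by omega) (by omega) (by omega)
    obtain ⟨g₁, e₁⟩ := ih₁ h.row_left (newFrame g [0, 1, 2, 3, 4, 5, 6]) mem
      ⟨hg.r0, hg.r1, hg.r2, hg.r3, hg.r4, hg.r5, hg.r6, rfl⟩
    obtain ⟨g₂, e₂⟩ := ih₂ h.row_right (newFrame g [8, 1, 2, 3, 4, 5, 6])
      (patch (region base (tileBits s k m t p)) (layers K.word up s k mem) mem)
      ⟨g8, hg.r1, hg.r2, hg.r3, hg.r4, hg.r5, hg.r6, rfl⟩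
    rw [patch_layers_union (Ico_subset_tileBits _ _ _ _ _) (h.zero _ IsTile.row_mem)
      h.row_notMem, ← tileBits_row] at e₂
    rw [tileTrace_row]
    exact ⟨g, .ite_true ((lt_of_num hf.r11 hf.r5).2 p.succ_pos) (.seq eg (.fork rfl rfl e₁ e₂
      ((within_tileTrace up hk hm h.row_left).noRace (within_tileTrace up hk hm h.row_right)
        (region_disjoint (h.zero _ IsTile.row_mem) h.row_notMem))))⟩
  · intro d base s k m t hk hm ih₁ ih₂ h f mem hf
    have hb := h.lt _ IsTile.column_mem
    have hp := pw _ hb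
    have hbase := h.base_lt
    obtain ⟨g, eg, hg, g8⟩ := exec_columnSplit (K := K) (W := W) (d := d) (h := mem)
      (f := Function.update f 7 (.num 1))
      ⟨hf.r0, hf.r1, hf.r2, hf.r3, hf.r4, hf.r5, hf.r6, hf.r11⟩ rfl
      (by omega) (by omega) (by omega)
    obtain ⟨g₁, e₁⟩ := ih₁ h.column_left (newFrame g [0, 1, 2, 3, 4, 5, 6]) mem
      ⟨hg.r0, hg.r1, hg.r2, hg.r3, hg.r4, hg.r5, hg.r6, rfl⟩
    obtain ⟨g₂, e₂⟩ := ih₂ h.column_right (newFrame g [8, 1, 2, 3, 4, 5, 6])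
      (patch (region base (tileBits s k m t 0)) (layers K.word up s k mem) mem)
      ⟨g8, hg.r1, hg.r2, hg.r3, hg.r4, hg.r5, hg.r6, rfl⟩
    rw [patch_layers_union (Ico_subset_tileBits _ _ _ _ _) (h.zero _ IsTile.column_mem)
      h.column_notMem, ← tileBits_column] at e₂
    rw [tileTrace_column _ _ _ _ _ _ _ hk hm]
    exact ⟨g, .ite_false ((lt_of_num hf.r11 hf.r5).not.2 (by omega))
      (.seq (exec_const_one (by have := Nat.two_pow_pos m; omega))
      (.ite_false ((lt_of_num (a := m + 1) (b := k) hf.r3 hf.r2).not.2 (by omega))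
      (.seq eg (.fork rfl rfl e₁ e₂
      ((within_tileTrace up hk hm h.column_left).noRace (within_tileTrace up hk hm h.column_right)
        (region_disjoint (h.zero _ IsTile.column_mem) h.column_notMem))))))⟩
  · intro d base s k m t hk hm ih₁ ih₂ h f mem hf
    have hb := h.lt (s + (k - 1)) (by rw [mem_tileBits]; omega)
    have hp := pw _ hb
    have hE : 2 < W := by
      have := Nat.pow_le_pow_right (n := 2) (by norm_num) (show 1 ≤ E by omega)
      omega
    obtain ⟨g, eg, hg, g7, g8, g9⟩ := exec_layerSplit (K := K) (W := W) (d := d) (h := mem)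
      (f := Function.update f 7 (.num 1))
      ⟨hf.r0, hf.r1, hf.r2, hf.r3, hf.r4, hf.r5, hf.r6, hf.r11⟩ hE (by omega) (by omega)
    obtain ⟨g₁, e₁⟩ := ih₁ h.layer_top (newFrame g [0, 9, 7, 3, 1, 8, 6]) mem
      ⟨hg.r0, g9, g7, hg.r3, hg.r1, g8, hg.r6, rfl⟩
    rw [tileBits_layer_top s k m t] at e₁
    obtain ⟨g₂, e₂⟩ := ih₂ h.layer_bottom (newFrame g [0, 1, 8, 3, 9, 7, 6])
      (patch (region base (tileBits s k m t 0))
        (layers K.word up (s + (k - k / 2)) (k / 2) mem) mem)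
      ⟨hg.r0, hg.r1, g8, hg.r3, g9, g7, hg.r6, rfl⟩
    rw [tileBits_layer_bottom s k m t, patch_layers_comp, show k - k / 2 + k / 2 = k by omega]
      at e₂
    · rw [tileTrace_layer _ _ _ _ _ _ _ hk (by omega)]
      exact ⟨g, .ite_false ((lt_of_num hf.r11 hf.r5).not.2 (by omega))
        (.seq (exec_const_one hE)
        (.ite_true ((lt_of_num (a := m) (b := k) hf.r3 hf.r2).2 (by omega))
        (.ite_true ((lt_of_num (a := 1) (b := k) rfl hf.r2).2 (by omega))
        (.seq eg (.seq (.call rfl e₁) (.call rfl e₂))))))⟩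
    · refine (Finset.Ico_subset_Ico_right ?_).trans (Ico_subset_tileBits s k m t 0)
      omega
  · intro d base s t h f mem hf
    have hs : s ∈ tileBits s 1 0 t 0 := by rw [mem_tileBits]; omega
    have hb := h.lt _ hs
    have hp := pw _ hb
    have hbase := h.base_lt
    have h1 := Nat.two_pow_pos s
    have hz := h.zero _ hs
    obtain ⟨g, eg⟩ := exec_comparator (K := K) (W := W) (d := d) (h := mem)
      (f := Function.update f 7 (.num 1))
      ⟨hf.r0, hf.r1, hf.r2, hf.r3, hf.r4, hf.r5, hf.r6, hf.r11⟩ rfl (by omega) (by omega)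
    rw [tileTrace_leaf]
    refine ⟨g, .ite_false ((lt_of_num hf.r11 hf.r5).not.2 (by omega))
        (.seq (exec_const_one (by omega))
        (.ite_true ((lt_of_num (a := 0) (b := 1) hf.r3 hf.r2).2 (by omega))
        (.ite_false ((lt_of_num (a := 1) (b := 1) rfl hf.r2).not.2 (by omega)) ?_)))⟩
    -- The tile consists of the two cells `base` and `base + 2 ^ s`; it remains to compare the two
    -- stores with the layer there, and to see that nothing else changes.
    convert eg using 1
    have hF : tileBits s 1 0 t 0 = insert s ∅ := by
      ext j; rw [mem_tileBits]; simp; omega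
    have hx : ∀ x y : ℕ, x ∈ region y ∅ ↔ x = y := fun x y =>
      ⟨fun hx => Nat.eq_of_testBit_eq fun j => hx j (by simp), fun hx => hx ▸ mem_region_self _ _⟩
    funext x
    rw [hF, region_insert hz (by simp)]
    by_cases h3 : x = base + 2 ^ s
    · have hm : x ∈ region base ∅ ∪ region (base + 2 ^ s) ∅ := Or.inr ((hx _ _).2 h3)
      rw [patch_eqOn _ _ _ hm, h3, Function.update_self, layers, layers, layer,
        testBit_add_two_pow (by simpa using hz), add_zero, if_pos rfl, if_pos rfl,
        ← xor_two_pow_of_testBit_false hz, Nat.xor_assoc, Nat.xor_self, Nat.xor_zero]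
    · rw [Function.update_of_ne h3]
      by_cases h4 : x = base
      · have hm : x ∈ region base ∅ ∪ region (base + 2 ^ s) ∅ := Or.inl ((hx _ _).2 h4)
        rw [patch_eqOn _ _ _ hm, h4, Function.update_self, layers, layers, layer,
          add_zero, hz, xor_two_pow_of_testBit_false hz]
        rfl
      · have hm : x ∉ region base ∅ ∪ region (base + 2 ^ s) ∅ := by
          rintro (h | h)
          · exact h4 ((hx _ _).1 h)
          · exact h3 ((hx _ _).1 h)
        rw [patch_eqOn_compl _ _ _ hm, Function.update_of_ne h4]

theorem exec_mergeRowSplit {d base k p : ℕ} {up : Bool} {f : Frame 12 α} {h : Heap α}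
    (hf : MergeFrame f base k (p + 1) up) (hW : 2 < W) (hp : k + p < W)
    (h2 : 2 ^ (k + p) < W) (hb : base + 2 ^ (k + p) < W) :
    ∃ g, Exec sortProgram K W d mergeRowSplit f h g h (lineTrace d mergeRowSplit) ∧
      MergeFrame g base k p up ∧ g 8 = .num (base + 2 ^ (k + p)) := by
  obtain ⟨r0, r1, r2, r3, r11⟩ := hf
  have hp' : p < W := by omega
  refine ⟨_, .seq (.const (by omega)) (.seq (.arith (a := p + 1) (b := 1) ?_ ?_ ?_)
    (.seq (.arith (a := k) (b := p) ?_ ?_ ?_) (.seq (.arith (a := 1) (b := k + p) ?_ ?_ ?_)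
    (.arith (a := base) (b := 2 ^ (k + p)) ?_ ?_ ?_)))), ⟨?_, ?_, ?_, ?_, ?_⟩, ?_⟩
  all_goals simp [Function.update, Op.eval, *]

theorem exec_mergeLayerSplit {d base k p : ℕ} {up : Bool} {f : Frame 12 α} {h : Heap α}
    (hf : MergeFrame f base k p up) (hW : 2 < W) (hk : k < W) :
    ∃ g, Exec sortProgram K W d mergeLayerSplit f h g h (lineTrace d mergeLayerSplit) ∧
      MergeFrame g base k p up ∧ g 8 = .num (k / 2) ∧ g 9 = .num (k - k / 2) := by
  obtain ⟨r0, r1, r2, r3, r11⟩ := hf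
  have h1 : k / 2 < W := by omega
  have h2 : k - k / 2 < W := by omega
  refine ⟨_, .seq (.const (by omega)) (.seq (.arith (a := k) (b := 2) ?_ ?_ ?_)
    (.arith (a := k) (b := k / 2) ?_ ?_ ?_)), ⟨?_, ?_, ?_, ?_, ?_⟩, ?_, ?_⟩
  all_goals simp [Function.update, Op.eval, *]

theorem exec_mergeCode {E : ℕ} (hW : 2 ^ (E + 1) ≤ W) (up : Bool) {d base k p : ℕ}
    (hk : 0 < k) (h : IsBlock E base (k + p)) (f : Frame 12 α) (mem : Heap α)
    (hf : MergeFrame f base k p up) :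
    ∃ g, Exec sortProgram K W d mergeCode f mem g
      (patch (region base (Finset.range (k + p))) (layers K.word up 0 k mem) mem)
      (mergeTrace d base k p up) := by
  have hEW : E < W := by
    have := (E + 1).lt_two_pow_self; omega
  have hE2 : 2 ^ E + 2 ^ E ≤ W := by rw [pow_succ] at hW; omega
  have hle := h.le
  have hW2 : 2 < W := by
    have := Nat.pow_le_pow_right (n := 2) (by norm_num) (show 1 ≤ E by omega)
    omega
  clear hle
  refine merge_induction (motive := fun d base k p => IsBlock E base (k + p) →
    ∀ (f : Frame 12 α) (mem : Heap α), MergeFrame f base k p up →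
    ∃ g, Exec sortProgram K W d mergeCode f mem g
      (patch (region base (Finset.range (k + p))) (layers K.word up 0 k mem) mem)
      (mergeTrace d base k p up)) ?_ ?_ ?_ d base k p hk h f mem hf
  all_goals clear hf mem f h hk p k base d
  · intro d base k p hk ih₁ ih₂ h f mem hf
    have hle := h.le
    have hp : 2 ^ (k + p) < 2 ^ E := Nat.pow_lt_pow_right (by norm_num) (by omega)
    have hbase := h.base_lt
    have hsub : Finset.Ico 0 (0 + k) ⊆ Finset.range (k + p) := by
      intro j; simp; omega
    have hz := h.zero (k + p) (by omega)
    have hl : IsBlock E base (k + p) := h.mono (by omega)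
    have hr : IsBlock E (base + 2 ^ (k + p)) (k + p) := IsBlock.right h
    obtain ⟨g, eg, hg, g8⟩ := exec_mergeRowSplit (K := K) (W := W) (d := d) (h := mem) hf
      (by omega) (by omega) (by omega) (by omega)
    obtain ⟨g₁, e₁⟩ := ih₁ hl (newFrame g [0, 1, 2, 3]) mem
      ⟨hg.r0, hg.r1, hg.r2, hg.r3, rfl⟩
    obtain ⟨g₂, e₂⟩ := ih₂ hr (newFrame g [8, 1, 2, 3])
      (patch (region base (Finset.range (k + p))) (layers K.word up 0 k mem) mem)
      ⟨g8, hg.r1, hg.r2, hg.r3, rfl⟩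
    rw [patch_layers_union hsub hz (by simp), ← Finset.range_add_one] at e₂
    rw [mergeTrace_row]
    exact ⟨g, .ite_true ((lt_of_num hf.r11 hf.r2).2 p.succ_pos) (.seq eg (.fork rfl rfl e₁ e₂
      ((within_mergeTrace up hk hl).noRace (within_mergeTrace up hk hr)
        (region_disjoint hz (by simp)))))⟩
  · intro d base k hk ih h f mem hf
    have hle := h.le
    obtain ⟨g, eg, hg, g8, g9⟩ := exec_mergeLayerSplit (K := K) (W := W) (d := d) (h := mem)
      (f := Function.update f 7 (.num 1)) ⟨hf.r0, hf.r1, hf.r2, hf.r3, hf.r11⟩ hW2 (by omega)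
    obtain ⟨g₁, e₁⟩ := exec_tileCode (K := K) (d := d + 1) hW up (by omega) (by omega) h.tile
      (newFrame g [0, 8, 9, 8, 11, 11, 3]) mem
      ⟨hg.r0, g8, g9, g8, hg.r11, hg.r11, hg.r3, rfl⟩
    have hh : k / 2 + (k - k / 2) = k := by omega
    obtain ⟨g₂, e₂⟩ := ih (h.mono (by omega)) (newFrame g [0, 8, 9, 3])
      (patch (region base (tileBits (k / 2) (k - k / 2) (k / 2) 0 0))
        (layers K.word up (k / 2) (k - k / 2) mem) mem)
      ⟨hg.r0, g8, g9, hg.r3, rfl⟩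
    have hc := patch_layers_comp (K := K.word) (up := up) (s := 0) (k₂ := k / 2)
      (k₁ := k - k / 2) (base := base) (F := Finset.range k) (h := mem)
      (by intro j; simp; omega)
    rw [hh, zero_add] at hc
    rw [hh, tileBits_block, hc] at e₂
    rw [tileBits_block] at e₁
    rw [mergeTrace_layer _ _ _ _ hk]
    exact ⟨g, .ite_false ((lt_of_num hf.r11 hf.r2).not.2 (by omega))
      (.seq (exec_const_one hW2) (.ite_true ((lt_of_num (a := 1) (b := k) rfl hf.r1).2 hk)
      (.seq eg (.seq (.call rfl e₁) (.call rfl e₂)))))⟩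
  · intro d base h f mem hf
    obtain ⟨g, e⟩ := exec_tileCode (K := K) (d := d + 1) hW up (by omega) (by omega) h.leaf
      (newFrame (Function.update f 7 (.num 1)) [0, 11, 1, 11, 11, 11, 3]) mem
      ⟨hf.r0, hf.r11, hf.r1, hf.r11, hf.r11, hf.r11, hf.r3, rfl⟩
    rw [tileBits_leaf] at e
    rw [mergeTrace_leaf]
    exact ⟨_, .ite_false ((lt_of_num hf.r11 hf.r2).not.2 (by omega))
      (.seq (exec_const_one hW2)
      (.ite_false ((lt_of_num (a := 1) (b := 1) rfl hf.r1).not.2 (by omega)) (.call rfl e)))⟩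

theorem exec_sortSplit {d base k : ℕ} {up : Bool} {f : Frame 12 α} {h : Heap α}
    (hf : SortFrame f base (k + 1) up) (hW : 2 < W) (hk : k < W)
    (h2 : 2 ^ k < W) (hb : base + 2 ^ k < W) :
    ∃ g, Exec sortProgram K W d sortSplit f h g h (lineTrace d sortSplit) ∧
      SortFrame g base (k + 1) up ∧ g 8 = .num k ∧ g 9 = .num (base + 2 ^ k) ∧
      g 10 = .num (dirNum !up) := by
  obtain ⟨r0, r1, r2, r11⟩ := hf
  have h1 : 1 - dirNum up = dirNum !up := by cases up <;> rfl
  have h3 : dirNum (!up) < W := by cases up <;> simp [dirNum] <;> omega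
  refine ⟨_, .seq (.const (by omega)) (.seq (.arith (a := k + 1) (b := 1) ?_ ?_ ?_)
    (.seq (.arith (a := 1) (b := k) ?_ ?_ ?_) (.seq (.arith (a := base) (b := 2 ^ k) ?_ ?_ ?_)
    (.arith (a := 1) (b := dirNum up) ?_ ?_ ?_)))), ⟨?_, ?_, ?_, ?_⟩, ?_, ?_, ?_⟩
  all_goals simp [Function.update, Op.eval, *]

/-- The halves are sorted in opposite directions, so the outcome is no longer given by `layers`; it
is stated for the list of cells instead. The clause on the cells outside makes the two halves
compatible. -/
theorem exec_sortCode {E : ℕ} (hW : 2 ^ (E + 1) ≤ W) (up : Bool) {d base k : ℕ}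
    (h : IsBlock E base k) (f : Frame 12 α) (mem : Heap α) (hf : SortFrame f base k up) :
    ∃ g mem', Exec sortProgram K W d sortCode f mem g mem' (sortTrace d base k up) ∧
      (∀ x ∉ region base (Finset.range k), mem' x = mem x) ∧
      tab (2 ^ k) (fun i => mem' (base + i)) =
        bitonicNetwork K.word up k (tab (2 ^ k) fun i => mem (base + i)) := by
  induction k generalizing up d base f mem with
  | zero =>
    exact ⟨f, mem, .ite_false ((lt_of_num hf.r11 hf.r1).not.2 (by omega)) .skip,
      fun _ _ => rfl, rfl⟩
  | succ k ih =>
    have hE2 : 2 ^ E + 2 ^ E ≤ W := by rw [pow_succ] at hW; omega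
    have hEW : E < 2 ^ E := E.lt_two_pow_self
    have hle := h.le
    have hp : 2 ^ k < 2 ^ E := Nat.pow_lt_pow_right (by norm_num) (by omega)
    have hbase := h.base_lt
    have hz := h.zero k k.lt_succ_self
    have hl : IsBlock E base k := h.mono k.le_succ
    have hr := h.right
    obtain ⟨g, eg, hg, g8, g9, g10⟩ := exec_sortSplit (K := K) (W := W) (d := d) (h := mem) hf
      (by have := Nat.two_pow_pos k; omega) (by omega) (by omega) (by omega)
    obtain ⟨g₁, mem₁, e₁, o₁, t₁⟩ := ih (d := d + 1) up hl (newFrame g [0, 8, 2]) mem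
      ⟨hg.r0, g8, hg.r2, rfl⟩
    obtain ⟨g₂, mem₂, e₂, o₂, t₂⟩ := ih (d := d + 1) (!up) hr (newFrame g [9, 8, 10]) mem₁
      ⟨g9, g8, g10, rfl⟩
    obtain ⟨g₃, e₃⟩ := exec_mergeCode (K := K) (d := d + 1) (p := 0) hW up k.succ_pos h
      (newFrame g [0, 1, 11, 2]) mem₂ ⟨hg.r0, hg.r1, hg.r11, hg.r2, rfl⟩
    have hd := region_disjoint (F := Finset.range k) hz (by simp)
    have hu := region_insert (F := Finset.range k) hz (by simp)
    rw [← Finset.range_add_one] at hu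
    refine ⟨g, _, .ite_true ((lt_of_num hf.r11 hf.r1).2 k.succ_pos) (.seq eg (.seq
      (.fork rfl rfl e₁ e₂ ((within_sortTrace up hl).noRace (within_sortTrace _ hr) hd))
      (.call rfl e₃))), ?_, ?_⟩
    · intro x hx
      rw [patch_eqOn_compl _ _ _ hx]
      rw [hu] at hx
      rw [o₂ x fun h => hx (Or.inr h), o₁ x fun h => hx (Or.inl h)]
    · have e : tab (2 ^ (k + 1)) (fun i => patch (region base (Finset.range (k + 1 + 0)))
          (layers K.word up 0 (k + 1) mem₂) mem₂ (base + i)) =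
          tab (2 ^ (k + 1)) fun i => layers K.word up 0 (k + 1) mem₂ (base + i) := by
        refine tab_congr fun i hi => patch_eqOn _ _ _ ?_
        rw [add_zero, mem_region_range_of_dvd h.dvd]
        omega
      rw [e, tab_layers _ _ _ h.dvd, bitonicNetwork, take_tab_two_pow_succ,
        drop_tab_two_pow_succ, ← t₁, tab_two_pow_succ]
      congr 2
      · refine tab_congr fun i hi => o₂ _ fun h' => Set.disjoint_left.1 hd ?_ h'
        rw [mem_region_range_of_dvd hl.dvd]
        omega
      · simp only [← add_assoc]
        rw [t₂]
        congr 1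
        refine tab_congr fun i hi => o₁ _ fun h' => Set.disjoint_left.1 hd h' ?_
        rw [mem_region_range_of_dvd hr.dvd]
        omega

/-- The search compares `2 ^ k` with `n` and never looks at keys, so the number of rounds depends on
`n` alone. -/
theorem exec_startCode {n E : ℕ} (hE : E = Nat.clog 2 n) (hW : 2 ^ (E + 1) ≤ W) {d k r : ℕ}
    (hk : k + r = E) (f : Frame 12 α) (mem : Heap α) (r0 : f 0 = .num n) (r1 : f 1 = .num k)
    (r2 : f 2 = .num (2 ^ k)) (r11 : f 11 = .num 0) :
    ∃ g mem', Exec sortProgram K W d startCode f mem g mem' (startTrace d k r) ∧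
      tab (2 ^ E) mem' = bitonicNetwork K.word true E (tab (2 ^ E) mem) := by
  induction r generalizing d k f with
  | zero =>
    obtain rfl : k = E := hk
    obtain ⟨g, mem', e, -, t⟩ := exec_sortCode (K := K) (W := W) (E := k) hW true
      (d := d + 1) (base := 0) ⟨fun _ _ => Nat.zero_testBit _, le_rfl, Nat.two_pow_pos k⟩
      (newFrame (Function.update f 7 (.num 1)) [11, 1, 7]) mem
      ⟨r11, r1, rfl, rfl⟩
    have hn : n ≤ 2 ^ k := hE ▸ Nat.le_pow_clog (by norm_num) n
    simp only [zero_add] at t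
    have h1 : 1 < W := by
      have := Nat.two_pow_pos k
      rw [pow_succ] at hW; omega
    exact ⟨_, mem', .ite_false ((lt_of_num r2 r0).not.2 (by omega))
      (.seq (.const h1) (.call rfl e)), t⟩
  | succ r ih =>
    have hn : 2 ^ k < n := (Nat.lt_clog_iff_pow_lt (by norm_num)).1 (by omega)
    have h2 : 2 ^ k + 2 ^ k < W := by
      have h3 := Nat.pow_le_pow_right (n := 2) (by norm_num) (show k + 1 ≤ E by omega)
      have h4 := Nat.two_pow_pos E
      rw [pow_succ] at hW h3
      omega
    have h1 := Nat.two_pow_pos k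
    have h3 := k.lt_two_pow_self
    have h5 : k + 1 < W := by omega
    have hl : ∃ g, Exec sortProgram K W d doubling f mem g mem (lineTrace d doubling) ∧
        g 0 = .num n ∧ g 1 = .num (k + 1) ∧ g 2 = .num (2 ^ (k + 1)) := by
      refine ⟨_, .seq (.const (by omega)) (.seq (.arith (a := k) (b := 1) ?_ ?_ ?_)
        (.arith (a := 2 ^ k) (b := 2 ^ k) ?_ ?_ ?_)), ?_, ?_, ?_⟩
      all_goals simp [Function.update, Op.eval, pow_succ, mul_two, *]
    obtain ⟨g, eg, g0, g1, g2⟩ := hl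
    obtain ⟨g', mem', e, t⟩ := ih (d := d + 1) (k := k + 1) (by omega) (newFrame g [0, 1, 2])
      g0 g1 g2 rfl
    exact ⟨_, mem', .ite_true ((lt_of_num r2 r0).2 hn) (.seq eg (.call rfl e)), t⟩

/-- Cells after the input hold `num 0`, which lies above all keys, so the padding is present without
any instruction. -/
theorem tab_initHeap (x : List α) (r : ℕ) :
    tab (x.length + r) (initHeap x) = x.map Word.key ++ List.replicate r (Word.num 0) := by
  rw [tab_add]
  congr 1
  · refine List.ext_getElem (by simp [tab]) fun i h₁ h₂ => ?_
    have : i < x.length := by simpa [tab] using h₁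
    simp [tab, initHeap, this]
  · refine List.ext_getElem (by simp [tab]) fun i h₁ h₂ => ?_
    simp [tab, initHeap]

theorem take_tab {β : Type*} {m n : ℕ} (h : m ≤ n) (f : ℕ → β) :
    (tab n f).take m = tab m f := by
  rw [tab, ← List.map_take, List.take_range, min_eq_left h, tab]

/-- The program implements bitonic sort. -/
theorem obliviouslyRealizes_bitonicSort (K : KeyOps α) :
    sortProgram.ObliviouslyRealizes K (fun n => (n + 2) ^ 2) (bitonicSort K) sortView := by
  intro x
  -- For `n ≥ 2`, the left side is less than `4 * n`; hence the exponent `2` in the word size.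
  have hpow : 2 ^ (Nat.clog 2 x.length + 1) ≤ (x.length + 2) ^ 2 := by
    rcases Nat.lt_or_ge x.length 2 with h | h
    · rw [Nat.clog_of_right_le_one (by omega), zero_add, pow_one]
      nlinarith
    · have h1 := Nat.pow_pred_clog_lt_self (b := 2) (by norm_num) h
      have h2 : Nat.clog 2 x.length ≠ 0 := (Nat.clog_pos (by norm_num) h).ne'
      obtain ⟨c, hc⟩ := Nat.exists_eq_succ_of_ne_zero h2
      rw [hc] at h1 ⊢
      rw [Nat.pred_succ] at h1
      rw [pow_succ, pow_succ]
      nlinarith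
  have hle : x.length ≤ 2 ^ Nat.clog 2 x.length := Nat.le_pow_clog (by norm_num) _
  obtain ⟨g, mem, e, t⟩ := exec_startCode (K := K) (n := x.length) rfl hpow (d := 1) (k := 0)
    (zero_add _) (newFrame (Function.update (initFrame 12 α x.length) 1 (.num 1)) [0, 2, 1])
    (initHeap x) rfl rfl rfl rfl
  refine ⟨by nlinarith, _, mem, .seq (.const (by nlinarith)) (.call rfl e), ?_⟩
  rw [bitonicSort, ← tab_initHeap, Nat.add_sub_cancel' hle, ← t, take_tab hle, tab]

end Execution

/-! ### The bitonic network sorts -/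

theorem length_bitonicMerge {β : Type*} (K : KeyOps β) (up : Bool) (k : ℕ) {l : List β}
    (hl : l.length = 2 ^ k) : (bitonicMerge K up k l).length = 2 ^ k := by
  induction k generalizing l with
  | zero => exact hl
  | succ k ih =>
    rw [pow_succ] at hl ⊢
    rw [bitonicMerge, List.length_append, ih, ih]
    · omega
    all_goals simp; omega

theorem length_bitonicNetwork {β : Type*} (K : KeyOps β) (up : Bool) (k : ℕ) {l : List β}
    (hl : l.length = 2 ^ k) : (bitonicNetwork K up k l).length = 2 ^ k := by
  induction k generalizing up l with
  | zero => exact hl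
  | succ k ih =>
    have h := hl
    rw [pow_succ] at h
    refine length_bitonicMerge _ _ _ ?_
    rw [List.length_append, ih _ (by simp; omega), ih _ (by simp; omega), pow_succ]
    omega

section Naturality

variable {β γ : Type*} {K : KeyOps β} {L : KeyOps γ} {φ : β → γ}

theorem map_bitonicMerge (hlo : ∀ a b, φ (K.lo a b) = L.lo (φ a) (φ b))
    (hhi : ∀ a b, φ (K.hi a b) = L.hi (φ a) (φ b)) (up : Bool) (k : ℕ) (l : List β) :
    (bitonicMerge K up k l).map φ = bitonicMerge L up k (l.map φ) := by
  induction k generalizing l with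
  | zero => rfl
  | succ k ih =>
    have h1 : ∀ a b, φ (firstOut K up a b) = firstOut L up (φ a) (φ b) := by
      intro a b; cases up <;> simp [firstOut, hlo, hhi]
    have h2 : ∀ a b, φ (secondOut K up a b) = secondOut L up (φ a) (φ b) := by
      intro a b; cases up <;> simp [secondOut, hlo, hhi]
    simp only [bitonicMerge, List.map_append, ih, List.map_zipWith, h1, h2, ← List.map_take,
      ← List.map_drop, List.zipWith_map]

/-- Used twice: with threshold maps, for the zero-one principle, and with the identity, to replace
the operations on words by `min` and `max`. -/
theorem map_bitonicNetwork (hlo : ∀ a b, φ (K.lo a b) = L.lo (φ a) (φ b))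
    (hhi : ∀ a b, φ (K.hi a b) = L.hi (φ a) (φ b)) (up : Bool) (k : ℕ) (l : List β) :
    (bitonicNetwork K up k l).map φ = bitonicNetwork L up k (l.map φ) := by
  induction k generalizing up l with
  | zero => rfl
  | succ k ih =>
    simp only [bitonicNetwork, map_bitonicMerge hlo hhi, List.map_append, ih, List.map_take,
      List.map_drop]

end Naturality

/-! ### Zero-one sequences -/

/-- Sequences of truth values that are constant, except for the opposite value on an interval. -/
def IsBitonic (n : ℕ) (f : ℕ → Bool) : Prop :=
  ∃ (v : Bool) (a b : ℕ), ∀ i < n, f i = (v ^^ decide (a ≤ i ∧ i < b))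

/-- `&&` and `||` are the outputs of the first layer of a merge. If the exceptional interval lies in
one half, the other half is constant. Otherwise it is a suffix of the first half and a prefix of the
second; moved onto each other, these are disjoint or cover everything, so one output is constant and
the other bitonic. -/
theorem IsBitonic.halve {n : ℕ} {f : ℕ → Bool} (hf : IsBitonic (n + n) f) :
    ((∀ i < n, (f i && f (n + i)) = false) ∧ IsBitonic n fun i => f i || f (n + i)) ∨
    ((∀ i < n, (f i || f (n + i)) = true) ∧ IsBitonic n fun i => f i && f (n + i)) := by
  obtain ⟨v, a, b, h⟩ := hf
  have h1 : ∀ i < n, f i = (v ^^ decide (a ≤ i ∧ i < b)) := fun i hi => h i (by omega)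
  have h2 : ∀ i < n, f (n + i) = (v ^^ decide (a ≤ n + i ∧ n + i < b)) :=
    fun i hi => h (n + i) (by omega)
  by_cases c1 : b ≤ n
  · have h3 : ∀ i < n, f (n + i) = v := fun i hi => by
      rw [h2 i hi, decide_eq_false (by omega), Bool.xor_false]
    cases v with
    | false =>
      exact Or.inl ⟨fun i hi => by simp [h3 i hi], false, a, b,
        fun i hi => by simp only [h3 i hi, h1 i hi, Bool.or_false]⟩
    | true =>
      exact Or.inr ⟨fun i hi => by simp [h3 i hi], true, a, b,
        fun i hi => by simp only [h3 i hi, h1 i hi, Bool.and_true]⟩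
  by_cases c2 : n ≤ a
  · have h3 : ∀ i < n, f i = v := fun i hi => by
      rw [h1 i hi, decide_eq_false (by omega), Bool.xor_false]
    have h4 : ∀ i < n, f (n + i) = (v ^^ decide (a - n ≤ i ∧ i < b - n)) := fun i hi => by
      rw [h2 i hi]; congr 2; simp only [eq_iff_iff]; omega
    cases v with
    | false =>
      exact Or.inl ⟨fun i hi => by simp [h3 i hi], false, a - n, b - n,
        fun i hi => by simp only [h3 i hi, h4 i hi, Bool.false_or]⟩
    | true =>
      exact Or.inr ⟨fun i hi => by simp [h3 i hi], true, a - n, b - n,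
        fun i hi => by simp only [h3 i hi, h4 i hi, Bool.true_and]⟩
  have h3 : ∀ i < n, f i = (v ^^ decide (a ≤ i)) := fun i hi => by
    rw [h1 i hi]; congr 2; simp only [eq_iff_iff]; omega
  have h4 : ∀ i < n, f (n + i) = (v ^^ decide (i < b - n)) := fun i hi => by
    rw [h2 i hi]; congr 2; simp only [eq_iff_iff]; omega
  by_cases c3 : b - n ≤ a
  · cases v with
    | false =>
      refine Or.inl ⟨fun i hi => ?_, true, b - n, a, fun i hi => ?_⟩
      · rw [h3 i hi, h4 i hi]; simp; omega
      · simp only [h3 i hi, h4 i hi, Bool.false_xor, Bool.true_xor, ← Bool.decide_or,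
          ← decide_not]
        congr 1; simp only [eq_iff_iff]; omega
    | true =>
      refine Or.inr ⟨fun i hi => ?_, false, b - n, a, fun i hi => ?_⟩
      · rw [h3 i hi, h4 i hi]; simp; omega
      · simp only [h3 i hi, h4 i hi, Bool.false_xor, Bool.true_xor, ← Bool.decide_and,
          ← decide_not]
        congr 1; simp only [eq_iff_iff]; omega
  · cases v with
    | false =>
      refine Or.inr ⟨fun i hi => ?_, false, a, b - n, fun i hi => ?_⟩
      · rw [h3 i hi, h4 i hi]; simp; omega
      · simp only [h3 i hi, h4 i hi, Bool.false_xor, ← Bool.decide_and]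
    | true =>
      refine Or.inl ⟨fun i hi => ?_, true, a, b - n, fun i hi => ?_⟩
      · rw [h3 i hi, h4 i hi]; simp; omega
      · simp only [h3 i hi, h4 i hi, Bool.true_xor, ← Bool.decide_or, ← decide_not]
        congr 1; simp only [eq_iff_iff]; omega

/-- The order in which a network sorts. -/
def dirLE {β : Type*} [LE β] (up : Bool) (a b : β) : Prop := if up then a ≤ b else b ≤ a

theorem bitonicMerge_const (up : Bool) (k : ℕ) (c : Bool) :
    bitonicMerge (KeyOps.ofLinearOrder Bool) up k (tab (2 ^ k) fun _ => c) =
      tab (2 ^ k) fun _ => c := by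
  induction k with
  | zero => rfl
  | succ k ih =>
    have h1 : firstOut (KeyOps.ofLinearOrder Bool) up c c = c := by
      cases up <;> simp [firstOut, KeyOps.ofLinearOrder]
    have h2 : secondOut (KeyOps.ofLinearOrder Bool) up c c = c := by
      cases up <;> simp [secondOut, KeyOps.ofLinearOrder]
    rw [bitonicMerge_tab_succ]
    simp only [h1, h2]
    rw [ih, tab_two_pow_succ]

theorem eq_of_mem_tab_const {β : Type*} {n : ℕ} {c x : β} (h : x ∈ tab n fun _ => c) : x = c := by
  simp only [tab, List.mem_map] at h
  obtain ⟨_, _, rfl⟩ := h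
  rfl

/-- By `IsBitonic.halve` one output half is constant, and on the right side: `&&` can only be
constantly false there, `||` constantly true. The other half is bitonic and is sorted by induction.
-/
theorem pairwise_bitonicMerge_bool (up : Bool) (k : ℕ) {f : ℕ → Bool} (hf : IsBitonic (2 ^ k) f) :
    (bitonicMerge (KeyOps.ofLinearOrder Bool) up k (tab (2 ^ k) f)).Pairwise (dirLE up) := by
  induction k generalizing f with
  | zero => simp [bitonicMerge, tab]
  | succ k ih =>
    rw [pow_succ, mul_two] at hf
    rw [bitonicMerge_tab_succ, List.pairwise_append]
    rcases hf.halve with ⟨h1, h2⟩ | ⟨h1, h2⟩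
    · have e : (tab (2 ^ k) fun i => f i && f (2 ^ k + i)) = tab (2 ^ k) fun _ => false :=
        tab_congr h1
      cases up with
      | true =>
        change List.Pairwise _ (bitonicMerge _ true k (tab (2 ^ k) fun i => f i && f (2 ^ k + i)))
          ∧ List.Pairwise _ (bitonicMerge _ true k (tab (2 ^ k) fun i => f i || f (2 ^ k + i))) ∧
          ∀ a ∈ bitonicMerge _ true k (tab (2 ^ k) fun i => f i && f (2 ^ k + i)), _
        refine ⟨?_, ih h2, fun a ha b hb => ?_⟩
        · rw [e]; exact ih ⟨false, 0, 0, fun i _ => by simp⟩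
        · rw [e, bitonicMerge_const] at ha
          rw [eq_of_mem_tab_const ha]
          exact Bool.false_le b
      | false =>
        change List.Pairwise _ (bitonicMerge _ false k (tab (2 ^ k) fun i => f i || f (2 ^ k + i)))
          ∧ List.Pairwise _ (bitonicMerge _ false k (tab (2 ^ k) fun i => f i && f (2 ^ k + i))) ∧
          ∀ a ∈ bitonicMerge _ false k (tab (2 ^ k) fun i => f i || f (2 ^ k + i)),
          ∀ b ∈ bitonicMerge _ false k (tab (2 ^ k) fun i => f i && f (2 ^ k + i)), _
        refine ⟨ih h2, ?_, fun a ha b hb => ?_⟩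
        · rw [e]; exact ih ⟨false, 0, 0, fun i _ => by simp⟩
        · rw [e, bitonicMerge_const] at hb
          rw [eq_of_mem_tab_const hb]
          exact Bool.false_le a
    · have e : (tab (2 ^ k) fun i => f i || f (2 ^ k + i)) = tab (2 ^ k) fun _ => true :=
        tab_congr h1
      cases up with
      | true =>
        change List.Pairwise _ (bitonicMerge _ true k (tab (2 ^ k) fun i => f i && f (2 ^ k + i)))
          ∧ List.Pairwise _ (bitonicMerge _ true k (tab (2 ^ k) fun i => f i || f (2 ^ k + i))) ∧
          ∀ a ∈ bitonicMerge _ true k (tab (2 ^ k) fun i => f i && f (2 ^ k + i)),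
          ∀ b ∈ bitonicMerge _ true k (tab (2 ^ k) fun i => f i || f (2 ^ k + i)), _
        refine ⟨ih h2, ?_, fun a ha b hb => ?_⟩
        · rw [e]; exact ih ⟨true, 0, 0, fun i _ => by simp⟩
        · rw [e, bitonicMerge_const] at hb
          rw [eq_of_mem_tab_const hb]
          exact Bool.le_true a
      | false =>
        change List.Pairwise _ (bitonicMerge _ false k (tab (2 ^ k) fun i => f i || f (2 ^ k + i)))
          ∧ List.Pairwise _ (bitonicMerge _ false k (tab (2 ^ k) fun i => f i && f (2 ^ k + i))) ∧
          ∀ a ∈ bitonicMerge _ false k (tab (2 ^ k) fun i => f i || f (2 ^ k + i)), _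
        refine ⟨?_, ih h2, fun a ha b hb => ?_⟩
        · rw [e]; exact ih ⟨true, 0, 0, fun i _ => by simp⟩
        · rw [e, bitonicMerge_const] at ha
          rw [eq_of_mem_tab_const ha]
          exact Bool.le_true b

theorem exists_threshold {l : List Bool} (hl : l.Pairwise (· ≤ ·)) :
    ∃ a, ∀ i (h : i < l.length), l[i] = decide (a ≤ i) := by
  induction l with
  | nil => exact ⟨0, fun i h => by simp at h⟩
  | cons x l ih =>
    rw [List.pairwise_cons] at hl
    cases x with
    | false =>
      obtain ⟨a, ha⟩ := ih hl.2
      refine ⟨a + 1, fun i h => ?_⟩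
      cases i with
      | zero => simp
      | succ i => simp [ha i (by simpa using h)]
    | true =>
      refine ⟨0, fun i h => ?_⟩
      cases i with
      | zero => simp
      | succ i =>
        have h' : i < l.length := by simpa using h
        have := hl.1 _ (List.getElem_mem h') rfl
        simpa using this

theorem exists_threshold_down {l : List Bool} (hl : l.Pairwise (· ≥ ·)) :
    ∃ a, ∀ i (h : i < l.length), l[i] = decide (i < a) := by
  induction l with
  | nil => exact ⟨0, fun i h => by simp at h⟩
  | cons x l ih =>
    rw [List.pairwise_cons] at hl
    cases x with
    | true =>
      obtain ⟨a, ha⟩ := ih hl.2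
      refine ⟨a + 1, fun i h => ?_⟩
      cases i with
      | zero => simp
      | succ i => simp [ha i (by simpa using h)]
    | false =>
      refine ⟨0, fun i h => ?_⟩
      cases i with
      | zero => simp
      | succ i =>
        have h' : i < l.length := by simpa using h
        have : l[i] = false := Bool.eq_false_iff.2 fun e =>
          Bool.noConfusion (hl.1 _ (List.getElem_mem h') e)
        simpa using this

theorem eq_tab_getD {β : Type*} (l : List β) (b : β) : l = tab l.length fun i => l.getD i b := by
  refine List.ext_getElem (by simp [tab]) fun i h₁ h₂ => ?_
  simp [tab, h₁]

theorem isBitonic_append {l₁ l₂ : List Bool} {up : Bool} {n : ℕ} (h₁ : l₁.Pairwise (dirLE up))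
    (h₂ : l₂.Pairwise (dirLE !up)) (hn : l₁.length = n) (hn₂ : l₂.length = n) :
    IsBitonic (n + n) fun i => (l₁ ++ l₂).getD i false := by
  have key : ∀ i < n + n, (l₁ ++ l₂).getD i false =
      if h : i < l₁.length then l₁[i] else l₂.getD (i - n) false := by
    intro i hi
    split_ifs with h
    · rw [List.getD_append _ _ _ _ h, List.getD_eq_getElem _ _ h]
    · rw [List.getD_append_right _ _ _ _ (by omega), hn]
  cases up with
  | true =>
    obtain ⟨a, ha⟩ := exists_threshold h₁
    obtain ⟨b, hb⟩ := exists_threshold_down h₂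
    -- The threshold of a constantly false list may lie beyond its end; `min` then starts the
    -- interval at the boundary.
    refine ⟨false, min a n, n + b, fun i hi => ?_⟩
    simp only [key i hi]
    split_ifs with h
    · rw [ha i h, Bool.false_xor]; congr 1; simp only [eq_iff_iff]; omega
    · rw [List.getD_eq_getElem _ _ (by omega), hb _ (by omega), Bool.false_xor]
      congr 1; simp only [eq_iff_iff]; omega
  | false =>
    obtain ⟨b, hb⟩ := exists_threshold_down h₁
    obtain ⟨a, ha⟩ := exists_threshold h₂
    refine ⟨true, min b n, n + a, fun i hi => ?_⟩
    simp only [key i hi]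
    split_ifs with h
    · rw [hb i h, Bool.true_xor, ← decide_not]; congr 1; simp only [eq_iff_iff]; omega
    · rw [List.getD_eq_getElem _ _ (by omega), ha _ (by omega), Bool.true_xor, ← decide_not]
      congr 1; simp only [eq_iff_iff]; omega

theorem pairwise_bitonicNetwork_bool (up : Bool) (k : ℕ) {l : List Bool} (hl : l.length = 2 ^ k) :
    (bitonicNetwork (KeyOps.ofLinearOrder Bool) up k l).Pairwise (dirLE up) := by
  induction k generalizing up l with
  | zero =>
    obtain ⟨x, rfl⟩ := List.length_eq_one_iff.1 hl
    simp [bitonicNetwork]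
  | succ k ih =>
    rw [pow_succ] at hl
    have h1 : (l.take (2 ^ k)).length = 2 ^ k := by simp; omega
    have h2 : (l.drop (2 ^ k)).length = 2 ^ k := by simp; omega
    have e₁ := length_bitonicNetwork (KeyOps.ofLinearOrder Bool) up k h1
    have e₂ := length_bitonicNetwork (KeyOps.ofLinearOrder Bool) (!up) k h2
    have hb := isBitonic_append (ih up h1) (ih (!up) h2) e₁ e₂
    have e : 2 ^ k + 2 ^ k = 2 ^ (k + 1) := by rw [pow_succ, mul_two]
    rw [bitonicNetwork, eq_tab_getD (_ ++ _) false, List.length_append, e₁, e₂, e]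
    rw [e] at hb
    exact pairwise_bitonicMerge_bool up (k + 1) hb

/-! ### The zero-one principle and linear orders -/

section LinearOrder

variable {β : Type*} [LinearOrder β]

/-- The map `t ≤ ·` turns `min` and `max` into `&&` and `||`, so every threshold pattern of the
output is sorted. Taking the earlier of two outputs as the threshold `t` compares them. -/
theorem pairwise_bitonicNetwork (k : ℕ) {l : List β} (hl : l.length = 2 ^ k) :
    (bitonicNetwork (KeyOps.ofLinearOrder β) true k l).Pairwise (· ≤ ·) := by
  have h : ∀ t : β, (bitonicNetwork (KeyOps.ofLinearOrder β) true k l).Pairwise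
      fun a b => t ≤ a → t ≤ b := by
    intro t
    have h1 := pairwise_bitonicNetwork_bool true k (l := l.map fun x => decide (t ≤ x))
      (by simpa using hl)
    rw [← map_bitonicNetwork (K := KeyOps.ofLinearOrder β), List.pairwise_map] at h1
    · refine h1.imp fun {a b} hab ha => ?_
      have hab' : decide (t ≤ a) ≤ decide (t ≤ b) := hab
      exact of_decide_eq_true (hab' (decide_eq_true ha))
    · intro a b
      change decide (t ≤ min a b) = (decide (t ≤ a) && decide (t ≤ b))
      simp only [le_min_iff, Bool.decide_and]
    · intro a b
      change decide (t ≤ max a b) = (decide (t ≤ a) || decide (t ≤ b))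
      simp only [le_max_iff, Bool.decide_or]
  rw [List.pairwise_iff_getElem]
  intro i j hi hj hij
  exact List.pairwise_iff_getElem.1 (h _) i j hi hj hij le_rfl

theorem perm_zipWith_comparators (up : Bool) {l r : List β} (h : l.length = r.length) :
    (List.zipWith (firstOut (KeyOps.ofLinearOrder β) up) l r ++
      List.zipWith (secondOut (KeyOps.ofLinearOrder β) up) l r).Perm (l ++ r) := by
  induction l generalizing r with
  | nil =>
    cases r with
    | nil => exact .refl _
    | cons => simp at h
  | cons a l ih =>
    cases r with
    | nil => simp at h
    | cons b r =>
      have h1 : [firstOut (KeyOps.ofLinearOrder β) up a b,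
          secondOut (KeyOps.ofLinearOrder β) up a b].Perm [a, b] := by
        rcases le_total a b with hab | hab <;> cases up <;>
          simp [firstOut, secondOut, KeyOps.ofLinearOrder, hab, List.Perm.swap]
      simp only [List.zipWith_cons_cons, List.cons_append]
      refine (List.perm_middle.cons _).trans (.trans ?_ (List.perm_middle.symm.cons _))
      exact h1.append (ih (by simpa using h))

theorem perm_bitonicMerge (up : Bool) (k : ℕ) {l : List β} (hl : l.length = 2 ^ k) :
    (bitonicMerge (KeyOps.ofLinearOrder β) up k l).Perm l := by
  induction k generalizing l with
  | zero => exact .refl _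
  | succ k ih =>
    rw [pow_succ] at hl
    have h1 : (l.take (2 ^ k)).length = 2 ^ k := by simp; omega
    have h2 : (l.drop (2 ^ k)).length = 2 ^ k := by simp; omega
    rw [bitonicMerge]
    refine ((ih (by simp; omega)).append (ih (by simp; omega))).trans
      ((perm_zipWith_comparators up (h1.trans h2.symm)).trans ?_)
    rw [List.take_append_drop]

theorem perm_bitonicNetwork (up : Bool) (k : ℕ) {l : List β} (hl : l.length = 2 ^ k) :
    (bitonicNetwork (KeyOps.ofLinearOrder β) up k l).Perm l := by
  induction k generalizing up l with
  | zero => exact .refl _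
  | succ k ih =>
    have h := hl
    rw [pow_succ] at h
    have h1 : (l.take (2 ^ k)).length = 2 ^ k := by simp; omega
    have h2 : (l.drop (2 ^ k)).length = 2 ^ k := by simp; omega
    rw [bitonicNetwork]
    refine (perm_bitonicMerge up (k + 1) ?_).trans (((ih up h1).append (ih _ h2)).trans ?_)
    · rw [List.length_append, length_bitonicNetwork _ _ _ h1, length_bitonicNetwork _ _ _ h2,
        pow_succ, mul_two]
    · rw [List.take_append_drop]

end LinearOrder

/-! ### Sorting keys -/

/-- Words as elements of the lexicographic sum of keys and numbers. -/
def wordLex {α : Type*} : Word α → α ⊕ₗ ℕ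
  | .key a => toLex (.inl a)
  | .num k => toLex (.inr k)

theorem wordLex_injective {α : Type*} : Function.Injective (wordLex (α := α)) := by
  intro a b h
  cases a <;> cases b <;> simp_all [wordLex]

/-- The linear order of the words: all keys lie below all numbers. -/
@[reducible] noncomputable def wordLinearOrder (α : Type*) [LinearOrder α] :
    LinearOrder (Word α) :=
  LinearOrder.lift' wordLex wordLex_injective

section

variable {α : Type*} [LinearOrder α]

attribute [local instance] wordLinearOrder

theorem word_le_iff {a b : Word α} : a ≤ b ↔ wordLex a ≤ wordLex b := Iff.rfl

theorem word_ofLinearOrder_lo (a b : Word α) : (KeyOps.ofLinearOrder α).word.lo a b = min a b := by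
  rw [min_def]
  cases a <;> cases b <;>
    simp [KeyOps.word, KeyOps.ofLinearOrder, word_le_iff, wordLex, min_def, apply_ite Word.key,
      apply_ite Word.num]

theorem word_ofLinearOrder_hi (a b : Word α) : (KeyOps.ofLinearOrder α).word.hi a b = max a b := by
  rw [max_def]
  cases a <;> cases b <;>
    simp [KeyOps.word, KeyOps.ofLinearOrder, word_le_iff, wordLex, max_def, apply_ite Word.key,
      apply_ite Word.num]

/-- Sorted permutations are unique. The output of the network and the sorted keys followed by the
fillers are both sorted permutations of the padded input, and the truncation removes exactly the
fillers. -/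
theorem bitonicSort_ofLinearOrder (x : List α) :
    bitonicSort (KeyOps.ofLinearOrder α) x = (x.insertionSort (· ≤ ·)).map Word.key := by
  have hle : x.length ≤ 2 ^ Nat.clog 2 x.length := Nat.le_pow_clog (by norm_num) _
  have e := map_bitonicNetwork (K := (KeyOps.ofLinearOrder α).word)
    (L := KeyOps.ofLinearOrder (Word α)) (φ := id) word_ofLinearOrder_lo word_ofLinearOrder_hi
    true (Nat.clog 2 x.length)
    (x.map Word.key ++ List.replicate (2 ^ Nat.clog 2 x.length - x.length) (Word.num 0))
  rw [List.map_id, List.map_id] at e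
  have hlen : (x.map Word.key ++ List.replicate (2 ^ Nat.clog 2 x.length - x.length)
      (Word.num 0 : Word α)).length = 2 ^ Nat.clog 2 x.length := by simp; omega
  rw [bitonicSort, e, List.Perm.eq_of_pairwise' (r := (· ≤ ·)) (pairwise_bitonicNetwork _ hlen)
    (l₂ := (x.insertionSort (· ≤ ·)).map Word.key ++
      List.replicate (2 ^ Nat.clog 2 x.length - x.length) (Word.num 0))]
  · rw [List.take_left' (by simp)]
  · rw [List.pairwise_append]
    refine ⟨?_, List.pairwise_replicate.2 (Or.inr le_rfl), ?_⟩
    · rw [List.pairwise_map]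
      refine (List.pairwise_insertionSort (· ≤ ·) x).imp fun {a b} hab => ?_
      exact Sum.Lex.inl_le_inl_iff.2 hab
    · intro a ha b hb
      rw [List.eq_of_mem_replicate hb]
      obtain ⟨a, -, rfl⟩ := List.mem_map.1 ha
      exact Sum.Lex.inl_le_inr _ _
  · refine (perm_bitonicNetwork true _ hlen).trans (List.Perm.append_right _ ?_)
    exact (List.perm_insertionSort _ _).symm.map _

end

/-! ### Work and span -/

/-- The number of instructions plus the number of accesses. -/
def Trace.weight : Trace → ℕ
  | .nil => 0
  | .op l => l.length + 1
  | .seq S T => S.weight + T.weight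
  | .par S T => S.weight + T.weight + 1

theorem Trace.work_le_weight (T : Trace) : T.work ≤ T.weight := by
  induction T <;> simp only [Trace.work, Trace.weight] <;> omega

/-- Lets the weight bound misses trivially: for the overhead of single nodes, and for all accesses
when the cache has bounded size. -/
theorem Trace.length_accesses_le_weight (T : Trace) : T.accesses.length ≤ T.weight := by
  induction T <;> simp only [Trace.accesses, Trace.weight, List.length_append,
    List.length_nil] <;> omega

theorem weight_enter (d : ℕ) (args : List (Fin 12)) : (enter d args).weight = args.length + 13 := by
  simp [enter, Trace.weight]

theorem span_enter (d : ℕ) (args : List (Fin 12)) : (enter d args).span = 1 := rfl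

/-- An inner node has two children and overhead below `70`, so one of the two credits of `70` pays
for it. The factor `60` comes from the leaf, of weight `43`: `43 + 70 ≤ 60 * 2`. -/
theorem weight_tileTrace (up : Bool) {d base s k m t p : ℕ} (hk : 0 < k) (hm : k ≤ m + 1) :
    (tileTrace d base s k m t p up).weight + 70 ≤ 60 * (2 ^ (k + m + p) * k) := by
  refine tile_induction (motive := fun d base s k m t p =>
    (tileTrace d base s k m t p up).weight + 70 ≤ 60 * (2 ^ (k + m + p) * k))
    ?_ ?_ ?_ ?_ d base s k m t p hk hm
  · intro d base s k m t p hk hm ih₁ ih₂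
    have e : 2 ^ (k + m + (p + 1)) = 2 * 2 ^ (k + m + p) := by ring
    rw [tileTrace_row, e, mul_assoc]
    simp only [Trace.weight, forkTrace, testTrace, lineTrace, rowSplit, weight_enter,
      List.length_cons, List.length_nil]
    omega
  · intro d base s k m t hk hm ih₁ ih₂
    have e : 2 ^ (k + (m + 1) + 0) = 2 * 2 ^ (k + m + 0) := by ring
    rw [tileTrace_column _ _ _ _ _ _ _ hk hm, e, mul_assoc]
    simp only [Trace.weight, forkTrace, testTrace, lineTrace, columnSplit, weight_enter,
      List.length_cons, List.length_nil]
    omega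
  · intro d base s k m t hk hm ih₁ ih₂
    have e₁ : k / 2 + m + (k - k / 2) = k + m := by omega
    have e₂ : k - k / 2 + m + k / 2 = k + m := by omega
    rw [e₁] at ih₁
    rw [e₂] at ih₂
    have e : 2 ^ (k + m) * k = 2 ^ (k + m) * (k / 2) + 2 ^ (k + m) * (k - k / 2) := by
      rw [← mul_add]; congr 1; omega
    rw [tileTrace_layer _ _ _ _ _ _ _ hk (by omega), add_zero, e]
    simp only [Trace.weight, callTrace, testTrace, lineTrace, layerSplit, weight_enter,
      List.length_cons, List.length_nil]
    omega
  · intro d base s t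
    rw [tileTrace_leaf]
    simp [Trace.weight, comparatorTrace, testTrace, lineTrace]

/-- The factor `80` instead of `60` leaves room for the extra call at `k = 1`. -/
theorem weight_mergeTrace (up : Bool) {d base k p : ℕ} (hk : 0 < k) :
    (mergeTrace d base k p up).weight + 70 ≤ 80 * (2 ^ (k + p) * k) := by
  refine merge_induction (motive := fun d base k p =>
    (mergeTrace d base k p up).weight + 70 ≤ 80 * (2 ^ (k + p) * k)) ?_ ?_ ?_ d base k p hk
  · intro d base k p hk ih₁ ih₂
    have e : 2 ^ (k + (p + 1)) = 2 * 2 ^ (k + p) := by ring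
    rw [mergeTrace_row, e, mul_assoc]
    simp only [Trace.weight, forkTrace, testTrace, lineTrace, mergeRowSplit, weight_enter,
      List.length_cons, List.length_nil]
    omega
  · intro d base k hk ih
    have h := weight_tileTrace up (d := d + 1) (base := base) (s := k / 2) (k := k - k / 2)
      (m := k / 2) (t := 0) (p := 0) (by omega) (by omega)
    have e₁ : k / 2 + (k - k / 2) = k := by omega
    have e₂ : k - k / 2 + k / 2 + 0 = k := by omega
    rw [e₁] at ih
    rw [e₂] at h
    have e : 2 ^ k * k = 2 ^ k * (k / 2) + 2 ^ k * (k - k / 2) := by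
      rw [← mul_add]; congr 1; omega
    rw [mergeTrace_layer _ _ _ _ hk, add_zero, e]
    simp only [Trace.weight, callTrace, testTrace, lineTrace, mergeLayerSplit, weight_enter,
      List.length_cons, List.length_nil]
    omega
  · intro d base
    have h := weight_tileTrace up (d := d + 1) (base := base) (s := 0) (k := 1)
      (m := 0) (t := 0) (p := 0) (by omega) (by omega)
    rw [mergeTrace_leaf]
    simp only [Trace.weight, callTrace, testTrace, lineTrace, weight_enter,
      List.length_cons, List.length_nil]
    omega

theorem weight_sortTrace (up : Bool) (d base k : ℕ) :
    (sortTrace d base k up).weight + 70 ≤ 80 * (2 ^ k * (k ^ 2 + 1)) := by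
  induction k generalizing d base up with
  | zero => simp [sortTrace, Trace.weight, testTrace]
  | succ k ih =>
    have h := weight_mergeTrace up (d := d + 1) (base := base) (p := 0) k.succ_pos
    have h₁ := ih up (d + 1) base
    have h₂ := ih (!up) (d + 1) (base + 2 ^ k)
    rw [Nat.succ_eq_add_one, add_zero] at h
    simp only [sortTrace, Trace.weight, callTrace, forkTrace, testTrace, lineTrace, sortSplit,
      weight_enter, List.length_cons, List.length_nil]
    have e : 2 * (2 ^ k * (k ^ 2 + 1)) + 2 ^ (k + 1) * (k + 1) ≤
        2 ^ (k + 1) * ((k + 1) ^ 2 + 1) := by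
      calc _ = 2 ^ (k + 1) * (k ^ 2 + k + 2) := by ring
        _ ≤ _ := Nat.mul_le_mul_left _ (by nlinarith)
    omega

theorem weight_startTrace (d k r : ℕ) :
    (startTrace d k r).weight ≤ 80 * (2 ^ (k + r) * ((k + r) ^ 2 + 1)) + 29 * r := by
  induction r generalizing d k with
  | zero =>
    have h := weight_sortTrace true (d + 1) 0 k
    simp only [startTrace, Trace.weight, callTrace, testTrace, lineTrace, weight_enter,
      List.length_cons, List.length_nil, add_zero]
    omega
  | succ r ih =>
    have h := ih (d + 1) (k + 1)
    rw [show k + 1 + r = k + (r + 1) by omega] at h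
    simp only [startTrace, Trace.weight, callTrace, testTrace, lineTrace, doubling, weight_enter,
      List.length_cons, List.length_nil]
    omega

theorem weight_sortView (n : ℕ) :
    (sortView n).weight ≤ 80 * (2 ^ Nat.clog 2 n * (Nat.clog 2 n ^ 2 + 1)) +
      29 * Nat.clog 2 n + 18 := by
  have h := weight_startTrace 1 0 (Nat.clog 2 n)
  rw [zero_add] at h
  simp only [sortView, Trace.weight, callTrace, lineTrace, weight_enter, List.length_cons,
    List.length_nil]
  omega

theorem clog_half_add_one_le {k : ℕ} (hk : 1 < k) :
    Nat.clog 2 (k / 2) + 1 ≤ Nat.clog 2 k ∧ Nat.clog 2 (k - k / 2) + 1 ≤ Nat.clog 2 k := by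
  have h := Nat.clog_of_two_le (b := 2) (by norm_num) (show 2 ≤ k by omega)
  have h1 : (k + 2 - 1) / 2 = k - k / 2 := by omega
  rw [h1] at h
  have h2 := Nat.clog_mono_right 2 (show k / 2 ≤ k - k / 2 by omega)
  omega

/-- There are `p` row forks and, as columns are split only until `m + 1 = k`, `m + 1 - k` column
forks; this is the `10 * k` on the left. At a halving, the two consecutive calls have `k` row forks
and `k` column forks in total, hence a cost of at most `3 * k` units on each of `Nat.clog 2 k`
levels. -/
theorem span_tileTrace (up : Bool) {d base s k m t p : ℕ} (hk : 0 < k) (hm : k ≤ m + 1) :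
    (tileTrace d base s k m t p up).span + 10 * k ≤
      10 * (p + m + 1 + k * (3 * Nat.clog 2 k + 2)) := by
  refine tile_induction (motive := fun d base s k m t p =>
    (tileTrace d base s k m t p up).span + 10 * k ≤
      10 * (p + m + 1 + k * (3 * Nat.clog 2 k + 2)))
    ?_ ?_ ?_ ?_ d base s k m t p hk hm
  · intro d base s k m t p hk hm ih₁ ih₂
    rw [tileTrace_row]
    simp only [Trace.span, forkTrace, testTrace, lineTrace, rowSplit, span_enter]
    omega
  · intro d base s k m t hk hm ih₁ ih₂
    rw [tileTrace_column _ _ _ _ _ _ _ hk hm]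
    simp only [Trace.span, forkTrace, testTrace, lineTrace, columnSplit, span_enter]
    omega
  · intro d base s k m t hk hm ih₁ ih₂
    obtain ⟨h₁, h₂⟩ := clog_half_add_one_le hk
    have e : k / 2 * (3 * Nat.clog 2 (k / 2) + 2) +
        (k - k / 2) * (3 * Nat.clog 2 (k - k / 2) + 2) + k ≤ k * (3 * Nat.clog 2 k) := by
      have e₁ := Nat.mul_le_mul_left (k / 2) (show 3 * Nat.clog 2 (k / 2) + 2 + 1 ≤
        3 * Nat.clog 2 k by omega)
      have e₂ := Nat.mul_le_mul_left (k - k / 2) (show 3 * Nat.clog 2 (k - k / 2) + 2 + 1 ≤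
        3 * Nat.clog 2 k by omega)
      have e₃ : k * (3 * Nat.clog 2 k) =
          k / 2 * (3 * Nat.clog 2 k) + (k - k / 2) * (3 * Nat.clog 2 k) := by
        rw [← add_mul]; congr 1; omega
      rw [mul_add _ _ 1] at e₁ e₂
      omega
    rw [tileTrace_layer _ _ _ _ _ _ _ hk (by omega), mul_add k]
    simp only [Trace.span, callTrace, testTrace, lineTrace, layerSplit, span_enter]
    omega
  · intro d base s t
    rw [tileTrace_leaf]
    simp [Trace.span, comparatorTrace, testTrace, lineTrace]

theorem span_mergeTrace (up : Bool) {d base k p : ℕ} (hk : 0 < k) :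
    (mergeTrace d base k p up).span ≤ 10 * (p + k * (3 * Nat.clog 2 k + 3)) := by
  refine merge_induction (motive := fun d base k p =>
    (mergeTrace d base k p up).span ≤ 10 * (p + k * (3 * Nat.clog 2 k + 3)))
    ?_ ?_ ?_ d base k p hk
  · intro d base k p hk ih₁ ih₂
    rw [mergeTrace_row]
    simp only [Trace.span, forkTrace, testTrace, lineTrace, mergeRowSplit, span_enter]
    omega
  · intro d base k hk ih
    have h := span_tileTrace up (d := d + 1) (base := base) (s := k / 2) (k := k - k / 2)
      (m := k / 2) (t := 0) (p := 0) (by omega) (by omega)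
    obtain ⟨h₁, h₂⟩ := clog_half_add_one_le hk
    have e : k / 2 * (3 * Nat.clog 2 (k / 2) + 3) +
        (k - k / 2) * (3 * Nat.clog 2 (k - k / 2) + 2) + (k - k / 2) ≤
        k * (3 * Nat.clog 2 k) := by
      have e₁ := Nat.mul_le_mul_left (k / 2) (show 3 * Nat.clog 2 (k / 2) + 3 ≤
        3 * Nat.clog 2 k by omega)
      have e₂ := Nat.mul_le_mul_left (k - k / 2) (show 3 * Nat.clog 2 (k - k / 2) + 2 + 1 ≤
        3 * Nat.clog 2 k by omega)
      have e₃ : k * (3 * Nat.clog 2 k) =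
          k / 2 * (3 * Nat.clog 2 k) + (k - k / 2) * (3 * Nat.clog 2 k) := by
        rw [← add_mul]; congr 1; omega
      rw [mul_add _ _ 1] at e₂
      omega
    rw [mergeTrace_layer _ _ _ _ hk, mul_add k]
    simp only [Trace.span, callTrace, testTrace, lineTrace, mergeLayerSplit, span_enter]
    omega
  · intro d base
    have h := span_tileTrace up (d := d + 1) (base := base) (s := 0) (k := 1)
      (m := 0) (t := 0) (p := 0) (by omega) (by omega)
    rw [mergeTrace_leaf]
    simp only [Trace.span, callTrace, testTrace, lineTrace, span_enter, Nat.clog_one_right] at h ⊢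
    omega

/-- The halves run in parallel, so only one merge per level counts; `E` bounds all merges uniformly.
-/
theorem span_sortTrace (up : Bool) {d base k E : ℕ} (hk : k ≤ E) :
    (sortTrace d base k up).span ≤ 1 + k * (9 + 10 * (E * (3 * Nat.clog 2 E + 3))) := by
  induction k generalizing d base up with
  | zero => simp [sortTrace, Trace.span, testTrace]
  | succ k ih =>
    have h := span_mergeTrace up (d := d + 1) (base := base) (p := 0) k.succ_pos
    have h₁ := ih up (d := d + 1) (base := base) (by omega)
    have h₂ := ih (!up) (d := d + 1) (base := base + 2 ^ k) (by omega)
    have h₃ : (k + 1) * (3 * Nat.clog 2 (k + 1) + 3) ≤ E * (3 * Nat.clog 2 E + 3) :=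
      Nat.mul_le_mul hk (by have := Nat.clog_mono_right 2 hk; omega)
    rw [Nat.succ_eq_add_one] at h
    simp only [sortTrace, Trace.span, callTrace, forkTrace, testTrace, lineTrace, sortSplit,
      span_enter]
    rw [add_mul k 1]
    omega

theorem span_startTrace (d k r : ℕ) :
    (startTrace d k r).span ≤ 5 * r + 4 +
      (k + r) * (9 + 10 * ((k + r) * (3 * Nat.clog 2 (k + r) + 3))) := by
  induction r generalizing d k with
  | zero =>
    have h := span_sortTrace true (d := d + 1) (base := 0) (le_refl k)
    simp only [startTrace, Trace.span, callTrace, testTrace, lineTrace, span_enter, add_zero]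
    omega
  | succ r ih =>
    have h := ih (d + 1) (k + 1)
    rw [show k + 1 + r = k + (r + 1) by omega] at h
    simp only [startTrace, Trace.span, callTrace, testTrace, lineTrace, doubling, span_enter]
    omega

theorem span_sortView (n : ℕ) :
    (sortView n).span ≤ 5 * Nat.clog 2 n + 6 + Nat.clog 2 n * (9 + 10 * (Nat.clog 2 n *
      (3 * Nat.clog 2 (Nat.clog 2 n) + 3))) := by
  have h := span_startTrace 1 0 (Nat.clog 2 n)
  rw [zero_add] at h
  simp only [sortView, Trace.span, callTrace, lineTrace, span_enter]
  omega

/-! ### Cache misses -/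

/-- Starting from any contents, a cache of `L` lines can serve the requests `l` with at most `b`
misses, in such a way that afterwards it can go on from any contents. -/
def Serves (L : ℕ) (l : List Loc) (b : ℕ) : Prop :=
  -- Quantifying over continuations makes costs additive without describing the contents of the
  -- cache in between.
  ∀ l' q', (∀ S, ∃ q ≤ q', CacheRun L S l' q) → ∀ S, ∃ q ≤ b + q', CacheRun L S (l ++ l') q

theorem Serves.append {L b b' : ℕ} {l l' : List Loc} (h : Serves L l b) (h' : Serves L l' b') :
    Serves L (l ++ l') (b + b') := by
  intro m q hm S
  rw [List.append_assoc, add_assoc]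
  exact h _ _ (h' m q hm) S

/-- Requests for few blocks cost one miss per block. -/
theorem serves_of_subset {L : ℕ} {l : List Loc} (F : Finset Loc) (hF : F.card ≤ L)
    (hl : ∀ b ∈ l, b ∈ F) : Serves L l F.card := by
  intro l' q' h'
  -- A miss evicts everything outside `F` and nothing inside, so each miss makes `F \ S` smaller by
  -- one block.
  have key : ∀ S : Finset Loc, ∃ q ≤ (F \ S).card + q', CacheRun L S (l ++ l') q := by
    induction l with
    | nil =>
      intro S
      obtain ⟨q, hq, e⟩ := h' S
      exact ⟨q, by omega, e⟩
    | cons b l ih =>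
      intro S
      have ih := ih fun c hc => hl c (List.mem_cons_of_mem _ hc)
      have hb : b ∈ F := hl b List.mem_cons_self
      by_cases hS : b ∈ S
      · obtain ⟨q, hq, e⟩ := ih S
        exact ⟨q, hq, .hit hS e⟩
      · obtain ⟨q, hq, e⟩ := ih (insert b (S ∩ F))
        have h1 : insert b (S ∩ F) ⊆ F := Finset.insert_subset hb Finset.inter_subset_right
        have h2 : F \ insert b (S ∩ F) = (F \ S).erase b := by
          ext x
          simp only [Finset.mem_sdiff, Finset.mem_insert, Finset.mem_inter, Finset.mem_erase]
          tauto
        have h3 : b ∈ F \ S := Finset.mem_sdiff.2 ⟨hb, hS⟩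
        have h4 := Finset.card_erase_add_one h3
        rw [h2] at hq
        exact ⟨q + 1, by omega, .miss hS (Finset.mem_insert_self _ _)
          (Finset.insert_subset_insert _ Finset.inter_subset_left)
          ((Finset.card_le_card h1).trans hF) e⟩
  intro S
  obtain ⟨q, hq, e⟩ := key S
  exact ⟨q, hq.trans (by have := Finset.card_le_card (Finset.sdiff_subset (s := F) (t := S)); omega),
    e⟩

theorem serves_length {L : ℕ} (hL : 1 ≤ L) (l : List Loc) : Serves L l l.length := by
  induction l with
  | nil => simpa using serves_of_subset (L := L) ∅ (by simp) (l := []) (by simp)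
  | cons b l ih =>
    have h := (serves_of_subset (L := L) {b} (by simpa using hL) (l := [b]) (by simp)).append ih
    rw [List.length_cons, add_comm]
    simpa using h

/-- The computation costs at most `x` cache misses, from any contents of the cache. -/
def Trace.Misses (L B : ℕ) (T : Trace) (x : ℝ) : Prop :=
  ∃ b : ℕ, Serves L (T.accesses.map fun y => y.loc.block B) b ∧ (b : ℝ) ≤ x

namespace Trace.Misses

variable {L B : ℕ} {S T : Trace} {x y : ℝ}

theorem mono (h : T.Misses L B x) (hxy : x ≤ y) : T.Misses L B y := by
  obtain ⟨b, hb, h⟩ := h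
  exact ⟨b, hb, h.trans hxy⟩

theorem seq (hS : S.Misses L B x) (hT : T.Misses L B y) : (Trace.seq S T).Misses L B (x + y) := by
  obtain ⟨b, hb, h⟩ := hS
  obtain ⟨c, hc, h'⟩ := hT
  refine ⟨b + c, ?_, by push_cast; linarith⟩
  rw [Trace.accesses, List.map_append]
  exact hb.append hc

theorem par (hS : S.Misses L B x) (hT : T.Misses L B y) : (Trace.par S T).Misses L B (x + y) :=
  hS.seq hT

theorem of_weight (hL : 1 ≤ L) (T : Trace) : T.Misses L B T.weight :=
  ⟨_, serves_length hL _, by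
    rw [List.length_map]; exact_mod_cast T.length_accesses_le_weight⟩

theorem call (hL : 1 ≤ L) {d : ℕ} {args : List (Fin 12)} (h : T.Misses L B x) :
    (callTrace d args T).Misses L B (args.length + 13 + x) :=
  ((of_weight hL (enter d args)).mono (by rw [weight_enter]; push_cast; rfl)).seq h

theorem fork (hL : 1 ≤ L) {d : ℕ} {args args₂ : List (Fin 12)} (hS : S.Misses L B x)
    (hT : T.Misses L B y) : (forkTrace d args args₂ S T).Misses L B
      ((args.length + 13 + x) + (args₂.length + 13 + y)) :=
  (call hL hS).par (call hL hT)

theorem cacheMissesLE {M : ℕ} (h : T.Misses (M / B) B x) : T.CacheMissesLE M B x := by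
  obtain ⟨b, hb, h⟩ := h
  obtain ⟨q, hq, e⟩ := hb [] 0 (fun S => ⟨0, le_rfl, .nil⟩) ∅
  rw [List.append_nil] at e
  exact ⟨q, e, le_trans (by exact_mod_cast hq) h⟩

/-- A computation that accesses few blocks. -/
theorem of_within {R : Set ℕ} {lo hi : ℕ} (hB : 1 ≤ B) (h : T.Within R lo hi) (G : Finset ℕ)
    (hG : ∀ a ∈ R, a / B ∈ G) {c : ℕ} (hc : G.card + ((hi - lo) * 12 / B + 2) ≤ c) (hcL : c ≤ L) :
    T.Misses L B c := by
  classical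
  -- The frames in use are contiguous: `z` consecutive words meet at most `z / B + 2` blocks.
  let G' := Finset.Icc (lo * 12 / B) (lo * 12 / B + (hi - lo) * 12 / B + 1)
  let F : Finset Loc := G.image Loc.heap ∪ G'.image Loc.stack
  have hF : F.card ≤ c := by
    refine (Finset.card_union_le _ _).trans (le_trans (add_le_add Finset.card_image_le
      Finset.card_image_le) ?_)
    rw [Nat.card_Icc]
    generalize (hi - lo) * 12 / B = z at hc ⊢
    omega
  refine ⟨F.card, serves_of_subset F (hF.trans hcL) fun b hb => ?_, by exact_mod_cast hF⟩
  obtain ⟨x, hx, rfl⟩ := List.mem_map.1 hb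
  rcases h x hx with ⟨a, ha, e⟩ | ⟨a, h1, h2, e⟩
  · rw [e]
    exact Finset.mem_union_left _ (Finset.mem_image_of_mem _ (hG a ha))
  · rw [e]
    refine Finset.mem_union_right _ (Finset.mem_image_of_mem _ (Finset.mem_Icc.2 ⟨?_, ?_⟩))
    · exact Nat.div_le_div_right h1
    · have h3 : a ≤ lo * 12 + (hi - lo) * 12 := by omega
      refine (Nat.div_le_div_right h3).trans ?_
      rw [Nat.add_div (by omega)]
      split_ifs <;> omega

end Trace.Misses

theorem exists_cover_range {B base m : ℕ} (hB : 1 ≤ B) (h : 2 ^ m ∣ base) :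
    ∃ G : Finset ℕ, G.card ≤ 2 ^ m / B + 2 ∧ ∀ x ∈ region base (Finset.range m), x / B ∈ G := by
  refine ⟨Finset.Icc (base / B) (base / B + 2 ^ m / B + 1), ?_, fun x hx => ?_⟩
  · rw [Nat.card_Icc]
    generalize 2 ^ m / B = z
    omega
  · rw [mem_region_range_of_dvd h] at hx
    refine Finset.mem_Icc.2 ⟨Nat.div_le_div_right hx.1, ?_⟩
    refine (Nat.div_le_div_right hx.2.le).trans ?_
    rw [Nat.add_div (by omega)]
    split_ifs <;> omega

/-- A tile is a union of `2 ^ k` runs of `2 ^ m` consecutive cells. The additive `2` per run is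
harmless only if runs are not much shorter than a block, see `TallCache.block_le`. -/
theorem exists_cover_tile {B E base s k m t : ℕ} (hB : 1 ≤ B) (h : IsTile E base s k m t 0) :
    ∃ G : Finset ℕ, G.card ≤ 2 ^ k * (2 ^ m / B + 2) ∧
      ∀ x ∈ region base (tileBits s k m t 0), x / B ∈ G := by
  induction k generalizing base with
  | zero =>
    have e : tileBits s 0 m t 0 = Finset.range m := by
      ext j; rw [mem_tileBits, Finset.mem_range]; omega
    have hd : 2 ^ m ∣ base := by
      refine IsBlock.dvd (E := E) ⟨fun j hj => h.zero j ?_, ?_, h.base_lt⟩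
      · rw [e]; simpa using hj
      · by_contra hc
        have := h.lt E (by rw [e, Finset.mem_range]; omega)
        omega
    rw [e, pow_zero, one_mul]
    exact exists_cover_range hB hd
  | succ k ih =>
    have e : tileBits s (k + 1) m t 0 = insert (s + k) (tileBits s k m t 0) := by
      ext j; rw [Finset.mem_insert, mem_tileBits, mem_tileBits]; omega
    have hn : s + k ∉ tileBits s k m t 0 := by
      have := h.le_s; rw [mem_tileBits]; omega
    have hm : s + k ∈ tileBits s (k + 1) m t 0 := by rw [e]; exact Finset.mem_insert_self _ _
    have hz := h.zero _ hm
    have h₁ : IsTile E base s k m t 0 :=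
      ⟨h.le_s, Or.inl rfl, fun j hj => h.zero j (e ▸ Finset.mem_insert_of_mem hj),
        fun j hj => h.lt j (e ▸ Finset.mem_insert_of_mem hj), h.base_lt⟩
    have h₂ : IsTile E (base + 2 ^ (s + k)) s k m t 0 := by
      refine ⟨h.le_s, Or.inl rfl, fun j hj => ?_, h₁.lt, lt_two_pow_of_add h.base_lt (h.lt _ hm) hz⟩
      rw [testBit_add_two_pow hz, if_neg, h₁.zero j hj]
      rintro rfl; exact hn hj
    obtain ⟨G₁, c₁, g₁⟩ := ih h₁
    obtain ⟨G₂, c₂, g₂⟩ := ih h₂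
    refine ⟨G₁ ∪ G₂, (Finset.card_union_le _ _).trans ?_, fun x hx => ?_⟩
    · rw [pow_succ]; linarith
    · rw [e, region_insert hz hn] at hx
      rcases hx with hx | hx
      · exact Finset.mem_union_left _ (g₁ x hx)
      · exact Finset.mem_union_right _ (g₂ x hx)

/-! ### Miss bounds for tall caches -/

/-- A cache with `2 ^ (μ + 12) ≤ M < 2 ^ (μ + 13)` that is tall, `B ^ 2 ≤ M`. -/
structure TallCache (M B μ : ℕ) : Prop where
  one_le : 1 ≤ B
  sq_le : B ^ 2 ≤ M
  -- The slack `2 ^ 12 ≥ 1200` is room for the partly used blocks and the stack of a subproblem on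
  -- `2 ^ μ` cells.
  le : 2 ^ (μ + 12) ≤ M
  lt : M < 2 ^ (μ + 13)
  -- Ensures that the recursion meets a subproblem that fits before it comes to single comparators.
  large : 12 ≤ μ

namespace TallCache

variable {M B μ : ℕ}

theorem lines (h : TallCache M B μ) : 1 ≤ M / B := by
  rw [Nat.le_div_iff_mul_le h.one_le]
  nlinarith [h.sq_le, h.one_le]

/-- The tall cache enters here: `B ^ 2 ≤ M < 2 ^ (2 * m + 16)`. -/
theorem block_le (h : TallCache M B μ) {m : ℕ} (hm : μ ≤ 2 * m + 2) : B ≤ 256 * 2 ^ m := by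
  have h1 : M < (256 * 2 ^ m) ^ 2 := by
    refine h.lt.trans_le ?_
    rw [mul_pow, ← pow_mul, show (256 : ℕ) ^ 2 = 2 ^ 16 by norm_num, ← pow_add]
    exact Nat.pow_le_pow_right (by norm_num) (by omega)
  have h2 : B ^ 2 < (256 * 2 ^ m) ^ 2 := h.sq_le.trans_lt h1
  exact (lt_of_pow_lt_pow_left₀ 2 (Nat.zero_le _) h2).le

theorem misses_of_within (h : TallCache M B μ) {T : Trace} {R : Set ℕ} {lo hi N c : ℕ}
    (hT : T.Within R lo hi) (G : Finset ℕ) (hG : ∀ a ∈ R, a / B ∈ G)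
    (hc : c * B + (hi - lo) * 12 + 2 * B ≤ 1200 * N) (hGc : G.card ≤ c) (hN : N ≤ 2 ^ μ) :
    T.Misses (M / B) B (1200 * (N / B)) := by
  have h1 : (G.card + ((hi - lo) * 12 / B + 2)) * B ≤ 1200 * N := by
    have e1 := Nat.mul_le_mul_right B hGc
    have e2 := Nat.div_mul_le_self ((hi - lo) * 12) B
    rw [add_mul, add_mul]
    omega
  have h2 : 1200 * N ≤ M := by
    have := h.le
    rw [pow_add] at this
    omega
  refine (Trace.Misses.of_within h.one_le hT G hG le_rfl ?_).mono ?_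
  · rw [Nat.le_div_iff_mul_le h.one_le]
    exact h1.trans h2
  · have hB : (0 : ℝ) < B := by exact_mod_cast h.one_le
    rw [← mul_div_assoc, le_div_iff₀ hB]
    exact_mod_cast h1

/-- Computations that fit into the cache are cheap. -/
theorem phase_le (h : TallCache M B μ) {k m N : ℕ} (hm : μ ≤ 2 * m + 2) (hk : μ ≤ 4 * k)
    (hN : 2 ^ m ≤ N) :
    1200 * ((N : ℝ) / B) ≤ 80000 * (k * N / (B * μ)) - 70 := by
  have hB : (0 : ℝ) < B := by exact_mod_cast h.one_le
  have hμ : (0 : ℝ) < μ := by have := h.large; exact_mod_cast (by omega : 0 < μ)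
  -- Pays for the `- 70`: `1200 + 70 * 256 ≤ 20000`, and the remaining factor `4` of `80000` is that
  -- of `μ ≤ 4 * k`.
  have h1 : (1 : ℝ) ≤ 256 * (N / B) := by
    rw [← mul_div_assoc, le_div_iff₀ hB, one_mul]
    exact_mod_cast (h.block_le hm).trans (Nat.mul_le_mul_left _ hN)
  have h2 : (N : ℝ) / B ≤ 4 * (k * N / (B * μ)) := by
    rw [← mul_div_assoc, div_le_div_iff₀ hB (by positivity)]
    have h3 : (μ : ℝ) ≤ 4 * k := by exact_mod_cast hk
    have h4 : (0 : ℝ) ≤ N * B := by positivity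
    nlinarith [mul_le_mul_of_nonneg_left h3 h4]
  linarith

/-- The potential `k * N / (B * μ)`, with `N` the number of cells, is additive both when cells are
divided and when layers are halved; the `- 70` absorbs the overhead. The two bounds on `μ` survive
every split of a tile that does not fit, so the first one that fits has rows of length at least `B /
256` and at least `μ / 4` layers to share its misses. -/
theorem misses_tileTrace (h : TallCache M B μ) {E : ℕ} (up : Bool) {d base s k m t p : ℕ}
    (hk : 0 < k) (hm : k ≤ m + 1) (ht : IsTile E base s k m t p) (hμm : μ ≤ 2 * m + 2)
    (hμk : μ ≤ 4 * k) :
    (tileTrace d base s k m t p up).Misses (M / B) B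
      (80000 * (k * (2 ^ (k + m + p) : ℕ) / (B * μ)) - 70) := by
  have fits : ∀ {d base s k m t}, 0 < k → k ≤ m + 1 → IsTile E base s k m t 0 →
      μ ≤ 2 * m + 2 → μ ≤ 4 * k → k + m ≤ μ → (tileTrace d base s k m t 0 up).Misses (M / B) B
        (80000 * (k * (2 ^ (k + m + 0) : ℕ) / (B * μ)) - 70) := by
    intro d base s k m t hk hm ht hμm hμk hf
    obtain ⟨G, hc, hG⟩ := exists_cover_tile h.one_le ht
    have hN : 2 ^ (k + m) = 2 ^ k * 2 ^ m := pow_add _ _ _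
    refine (h.misses_of_within (N := 2 ^ (k + m)) (within_tileTrace up hk hm ht) G hG ?_ hc
      (Nat.pow_le_pow_right (by norm_num) hf)).mono
      (h.phase_le hμm hμk (Nat.pow_le_pow_right (by norm_num) (by omega)))
    have e1 := h.block_le hμm
    have e2 : 2 ^ k * (2 ^ m / B) * B ≤ 2 ^ (k + m) := by
      rw [mul_assoc, hN]; exact Nat.mul_le_mul_left _ (Nat.div_mul_le_self _ _)
    have e3 : 2 ^ k * B ≤ 256 * 2 ^ (k + m) := by
      rw [hN]; nlinarith [Nat.mul_le_mul_left (2 ^ k) e1]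
    have e4 : 2 ^ m ≤ 2 ^ (k + m) := Nat.pow_le_pow_right (by norm_num) (by omega)
    have e5 := (k + m).lt_two_pow_self
    have e6 : 2 ^ k * (2 ^ m / B + 2) * B = 2 ^ k * (2 ^ m / B) * B + 2 * (2 ^ k * B) := by ring
    rw [e6]
    omega
  have hL := h.lines
  have hlarge := h.large
  refine tile_induction (motive := fun d base s k m t p => IsTile E base s k m t p →
    μ ≤ 2 * m + 2 → μ ≤ 4 * k → (tileTrace d base s k m t p up).Misses (M / B) B
      (80000 * (k * (2 ^ (k + m + p) : ℕ) / (B * μ)) - 70))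
    ?_ ?_ ?_ ?_ d base s k m t p hk hm ht hμm hμk
  · intro d base s k m t p hk hm ih₁ ih₂ ht hμm hμk
    rw [tileTrace_row]
    refine ((Trace.Misses.of_weight hL _).seq ((Trace.Misses.of_weight hL _).seq
      (.fork hL (ih₁ ht.row_left hμm hμk) (ih₂ ht.row_right hμm hμk)))).mono ?_
    have e : (80000 : ℝ) * (k * (2 ^ (k + m + (p + 1)) : ℕ) / (B * μ)) =
        2 * (80000 * (k * (2 ^ (k + m + p) : ℕ) / (B * μ))) := by push_cast; ring
    rw [e]
    simp only [Trace.weight, testTrace, lineTrace, rowSplit, List.length_cons, List.length_nil]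
    push_cast
    linarith
  · intro d base s k m t hk hm ih₁ ih₂ ht hμm hμk
    -- Otherwise `μ ≤ k + m ≤ 2 * m + 1`, so the narrower tile still has long rows.
    by_cases hf : k + (m + 1) ≤ μ
    · exact fits hk (by omega) ht hμm hμk hf
    rw [tileTrace_column _ _ _ _ _ _ _ hk hm]
    refine ((Trace.Misses.of_weight hL _).seq ((Trace.Misses.of_weight hL _).seq
      ((Trace.Misses.of_weight hL _).seq ((Trace.Misses.of_weight hL _).seq
      (.fork hL (ih₁ ht.column_left (by omega) hμk)
        (ih₂ ht.column_right (by omega) hμk)))))).mono ?_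
    have e : (80000 : ℝ) * (k * (2 ^ (k + (m + 1) + 0) : ℕ) / (B * μ)) =
        2 * (80000 * (k * (2 ^ (k + m + 0) : ℕ) / (B * μ))) := by push_cast; ring
    rw [e]
    simp only [Trace.weight, testTrace, lineTrace, columnSplit, List.length_cons, List.length_nil]
    push_cast
    linarith
  · intro d base s k m t hk hm ih₁ ih₂ ht hμm hμk
    -- Otherwise `μ ≤ 2 * k - 2`, so both halves keep at least `μ / 4` layers.
    by_cases hf : k + m ≤ μ
    · exact fits (by omega) (by omega) ht hμm hμk hf
    rw [tileTrace_layer _ _ _ _ _ _ _ hk (by omega)]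
    refine ((Trace.Misses.of_weight hL _).seq ((Trace.Misses.of_weight hL _).seq
      ((Trace.Misses.of_weight hL _).seq ((Trace.Misses.of_weight hL _).seq
      ((Trace.Misses.of_weight hL _).seq
      (.seq (.call hL (ih₁ ht.layer_top (by omega) (by omega)))
        (.call hL (ih₂ ht.layer_bottom (by omega) (by omega))))))))).mono ?_
    have e : (80000 : ℝ) * (k * (2 ^ (k + m + 0) : ℕ) / (B * μ)) =
        80000 * ((k / 2 : ℕ) * (2 ^ (k / 2 + m + (k - k / 2)) : ℕ) / (B * μ)) +
        80000 * ((k - k / 2 : ℕ) * (2 ^ (k - k / 2 + m + k / 2) : ℕ) / (B * μ)) := by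
      have e₁ : k / 2 + m + (k - k / 2) = k + m + 0 := by omega
      have e₂ : k - k / 2 + m + k / 2 = k + m + 0 := by omega
      have e₃ : (k : ℝ) = (k / 2 : ℕ) + (k - k / 2 : ℕ) := by
        exact_mod_cast (by omega : k = k / 2 + (k - k / 2))
      rw [e₁, e₂, e₃]
      simp only [← e₃]
      rw [← mul_add, ← add_div, ← add_mul, ← e₃]
    rw [e]
    simp only [Trace.weight, testTrace, lineTrace, layerSplit, List.length_cons, List.length_nil]
    push_cast
    linarith
  · intro d base s t ht hμm
    omega

/-- Computations on a block that fits into the cache. -/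
theorem misses_block (h : TallCache M B μ) {T : Trace} {E base k d e : ℕ}
    (hb : IsBlock E base k) (hT : T.Within (region base (Finset.range k)) d e)
    (he : e ≤ d + 7 * k + 1) (hk : k ≤ μ) (hμ : μ ≤ 2 * k + 2) :
    T.Misses (M / B) B (80000 * (k * (2 ^ k : ℕ) / (B * μ)) - 70) := by
  obtain ⟨G, hc, hG⟩ := exists_cover_range h.one_le hb.dvd
  have hlarge := h.large
  refine (h.misses_of_within (N := 2 ^ k) hT G hG ?_ hc
    (Nat.pow_le_pow_right (by norm_num) hk)).mono (h.phase_le hμ (by omega) le_rfl)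
  have e1 := h.block_le hμ
  have e2 := Nat.div_mul_le_self (2 ^ k) B
  have e5 := k.lt_two_pow_self
  rw [add_mul]
  have e6 : B ≤ 256 * 2 ^ k := e1
  omega

theorem misses_mergeTrace (h : TallCache M B μ) {E : ℕ} (up : Bool) {d base k p : ℕ}
    (hk : 0 < k) (hb : IsBlock E base (k + p)) (hμ : μ ≤ 2 * k + 2) :
    (mergeTrace d base k p up).Misses (M / B) B
      (80000 * (k * (2 ^ (k + p) : ℕ) / (B * μ)) - 70) := by
  have hL := h.lines
  have hlarge := h.large
  refine merge_induction (motive := fun d base k p => IsBlock E base (k + p) → μ ≤ 2 * k + 2 →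
    (mergeTrace d base k p up).Misses (M / B) B
      (80000 * (k * (2 ^ (k + p) : ℕ) / (B * μ)) - 70)) ?_ ?_ ?_ d base k p hk hb hμ
  · intro d base k p hk ih₁ ih₂ hb hμ
    rw [mergeTrace_row]
    refine ((Trace.Misses.of_weight hL _).seq ((Trace.Misses.of_weight hL _).seq
      (.fork hL (ih₁ (hb.mono (by omega)) hμ) (ih₂ (IsBlock.right hb) hμ)))).mono ?_
    have e : (80000 : ℝ) * (k * (2 ^ (k + (p + 1)) : ℕ) / (B * μ)) =
        2 * (80000 * (k * (2 ^ (k + p) : ℕ) / (B * μ))) := by push_cast; ring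
    rw [e]
    simp only [Trace.weight, testTrace, lineTrace, mergeRowSplit, List.length_cons,
      List.length_nil]
    push_cast
    linarith
  · intro d base k hk ih hb hμ
    replace hb : IsBlock E base k := hb
    by_cases hf : k ≤ μ
    · exact h.misses_block hb (within_mergeTrace (p := 0) up (by omega) hb) (by omega) hf hμ
    rw [mergeTrace_layer _ _ _ _ hk]
    refine ((Trace.Misses.of_weight hL _).seq ((Trace.Misses.of_weight hL _).seq
      ((Trace.Misses.of_weight hL _).seq ((Trace.Misses.of_weight hL _).seq
      (.seq (.call hL (h.misses_tileTrace up (by omega) (by omega) hb.tile (by omega) (by omega)))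
        (.call hL (ih (hb.mono (by omega)) (by omega)))))))).mono ?_
    have e : (80000 : ℝ) * (k * (2 ^ (k + 0) : ℕ) / (B * μ)) =
        80000 * ((k - k / 2 : ℕ) * (2 ^ (k - k / 2 + k / 2 + 0) : ℕ) / (B * μ)) +
        80000 * ((k / 2 : ℕ) * (2 ^ (k / 2 + (k - k / 2)) : ℕ) / (B * μ)) := by
      have e₁ : k / 2 + (k - k / 2) = k + 0 := by omega
      have e₂ : k - k / 2 + k / 2 + 0 = k + 0 := by omega
      have e₃ : (k : ℝ) = (k - k / 2 : ℕ) + (k / 2 : ℕ) := by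
        exact_mod_cast (by omega : k = k - k / 2 + k / 2)
      rw [e₁, e₂, ← mul_add, ← add_div, ← add_mul, ← e₃]
    rw [e]
    simp only [Trace.weight, testTrace, lineTrace, mergeLayerSplit, List.length_cons,
      List.length_nil]
    push_cast
    linarith
  · intro d base hb hμ
    omega

/-- Blocks of `2 ^ μ` cells are sorted inside the cache. Only the `j` merge levels above them cost
more, each at most `(μ + j) / μ` scans up to a constant. -/
theorem misses_sortTrace (h : TallCache M B μ) {E : ℕ} (up : Bool) {d base j : ℕ}
    (hb : IsBlock E base (μ + j)) :
    (sortTrace d base (μ + j) up).Misses (M / B) B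
      (80000 * ((μ + j : ℕ) * (j + 1) * (2 ^ (μ + j) : ℕ) / (B * μ)) - 70) := by
  have hL := h.lines
  induction j generalizing d base up with
  | zero =>
    refine (h.misses_block hb (within_sortTrace up hb) le_rfl le_rfl (by omega)).mono ?_
    simp
  | succ j ih =>
    have hb' : IsBlock E base (μ + j + 1) := hb
    refine ((Trace.Misses.of_weight hL _).seq ((Trace.Misses.of_weight hL _).seq
      (.seq (.fork hL (ih up (hb.mono (by omega))) (ih (!up) hb'.right))
        (.call hL (h.misses_mergeTrace (k := μ + j + 1) (p := 0) up (Nat.succ_pos _) hb'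
          (by omega)))))).mono ?_
    have e : 2 * ((80000 : ℝ) * ((μ + j : ℕ) * (j + 1) * (2 ^ (μ + j) : ℕ) / (B * μ))) +
        80000 * ((μ + j + 1 : ℕ) * (2 ^ (μ + j + 1) : ℕ) / (B * μ)) ≤
        80000 * ((μ + (j + 1) : ℕ) * ((j + 1 : ℕ) + 1) * (2 ^ (μ + (j + 1)) : ℕ) / (B * μ)) := by
      have e₁ : ((μ + (j + 1) : ℕ) * ((j + 1 : ℕ) + 1) * (2 ^ (μ + (j + 1)) : ℕ) / (B * μ) : ℝ) =
          2 * ((μ + j : ℕ) * (j + 1) * (2 ^ (μ + j) : ℕ) / (B * μ)) +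
          (μ + j + 1 : ℕ) * (2 ^ (μ + j + 1) : ℕ) / (B * μ) +
          (j + 1) * (2 ^ (μ + j + 1) : ℕ) / (B * μ) := by
        push_cast; ring
      have e₂ : (0 : ℝ) ≤ (j + 1) * (2 ^ (μ + j + 1) : ℕ) / (B * μ) := by positivity
      rw [e₁]
      linarith
    simp only [add_zero, Trace.weight, testTrace, lineTrace, sortSplit,
      List.length_cons, List.length_nil] at e ⊢
    push_cast at e ⊢
    linarith

theorem misses_startTrace (h : TallCache M B μ) {d k r j : ℕ} (hj : k + r = μ + j) :
    (startTrace d k r).Misses (M / B) B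
      (80000 * ((μ + j : ℕ) * (j + 1) * (2 ^ (μ + j) : ℕ) / (B * μ)) + 29 * r) := by
  have hL := h.lines
  induction r generalizing d k with
  | zero =>
    obtain rfl : k = μ + j := hj
    refine ((Trace.Misses.of_weight hL _).seq ((Trace.Misses.of_weight hL _).seq
      (.call hL (h.misses_sortTrace (E := μ + j) true
        ⟨fun _ _ => Nat.zero_testBit _, le_rfl, Nat.two_pow_pos _⟩)))).mono ?_
    simp only [Trace.weight, testTrace, lineTrace, List.length_cons, List.length_nil]
    push_cast
    linarith
  | succ r ih =>
    refine ((Trace.Misses.of_weight hL _).seq ((Trace.Misses.of_weight hL _).seq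
      (.call hL (ih (k := k + 1) (by omega))))).mono ?_
    simp only [Trace.weight, testTrace, lineTrace, doubling, List.length_cons, List.length_nil]
    push_cast
    linarith

theorem misses_sortView (h : TallCache M B μ) {n j : ℕ} (hj : Nat.clog 2 n = μ + j) :
    (sortView n).Misses (M / B) B
      (80000 * ((μ + j : ℕ) * (j + 1) * (2 ^ (μ + j) : ℕ) / (B * μ)) + 29 * (μ + j : ℕ) + 18) := by
  have hL := h.lines
  refine ((Trace.Misses.of_weight hL _).seq (.call hL (h.misses_startTrace (k := 0) (j := j)
    (r := Nat.clog 2 n) (by omega)))).mono ?_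
  rw [hj]
  simp only [Trace.weight, lineTrace, List.length_cons, List.length_nil]
  push_cast
  linarith

end TallCache

/-! ### Asymptotic bounds -/

theorem two_pow_clog_le {n : ℕ} (hn : 2 ≤ n) : 2 ^ Nat.clog 2 n ≤ 2 * n := by
  have h1 := Nat.pow_pred_clog_lt_self (b := 2) (by norm_num) hn
  obtain ⟨c, hc⟩ := Nat.exists_eq_succ_of_ne_zero (Nat.clog_pos (b := 2) (by norm_num) hn).ne'
  rw [hc, Nat.pred_succ] at h1
  rw [hc, Nat.succ_eq_add_one, pow_succ]
  omega

theorem clog_le_logb_add_one {n : ℕ} (hn : 2 ≤ n) :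
    (Nat.clog 2 n : ℝ) ≤ Real.logb 2 n + 1 := by
  have h1 := Nat.pow_pred_clog_lt_self (b := 2) (by norm_num) hn
  obtain ⟨c, hc⟩ := Nat.exists_eq_succ_of_ne_zero (Nat.clog_pos (b := 2) (by norm_num) hn).ne'
  rw [hc, Nat.pred_succ] at h1
  rw [hc]
  have h2 : (c : ℝ) ≤ Real.logb 2 n := by
    rw [Real.le_logb_iff_rpow_le (by norm_num) (by exact_mod_cast (by omega : 0 < n)),
      Real.rpow_natCast]
    exact_mod_cast h1.le
  push_cast
  linarith

theorem one_le_logb {n : ℕ} (hn : 2 ≤ n) : 1 ≤ Real.logb 2 n := by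
  rw [Real.le_logb_iff_rpow_le (by norm_num) (by exact_mod_cast (by omega : 0 < n)), Real.rpow_one]
  exact_mod_cast hn

theorem weight_sortView_le {n : ℕ} (hn : 2 ≤ n) :
    ((sortView n).weight : ℝ) ≤ 876 * (n * Real.logb 2 n ^ 2) := by
  have h1 : ((sortView n).weight : ℝ) ≤ 80 * (2 ^ Nat.clog 2 n * ((Nat.clog 2 n : ℝ) ^ 2 + 1)) +
      29 * Nat.clog 2 n + 18 := by exact_mod_cast weight_sortView n
  have h2 : (2 : ℝ) ^ Nat.clog 2 n ≤ 2 * n := by exact_mod_cast two_pow_clog_le hn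
  have h3 := clog_le_logb_add_one hn
  have h4 := one_le_logb hn
  have hn' : (1 : ℝ) ≤ n := by exact_mod_cast (by omega : 1 ≤ n)
  have h0 : (0 : ℝ) ≤ Nat.clog 2 n := by positivity
  generalize Real.logb 2 n = l at *
  generalize (Nat.clog 2 n : ℝ) = c at *
  have h5 : c ^ 2 + 1 ≤ 5 * l ^ 2 := by nlinarith
  have h6 : (2 : ℝ) ^ Nat.clog 2 n * (c ^ 2 + 1) ≤ 2 * n * (5 * l ^ 2) :=
    mul_le_mul h2 h5 (by positivity) (by positivity)
  have h7 : l ≤ l ^ 2 := by nlinarith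
  have h8 : l ^ 2 ≤ n * l ^ 2 := by nlinarith [sq_nonneg l]
  nlinarith

/-- Keeps `log log n` away from `0`, so that it absorbs additive constants: `2 ^ 3 ≤ 3 ^ 2` and `2 ≤
(3 / 2) ^ 2`. -/
theorem half_le_logb_logb {n : ℕ} (hn : 3 ≤ n) : 1 / 2 ≤ Real.logb 2 (Real.logb 2 n) := by
  have key : ∀ x y : ℝ, 0 < x → (2 : ℝ) ^ (2 * y) ≤ x ^ 2 → y ≤ Real.logb 2 x := by
    intro x y hx h
    have h1 := Real.logb_le_logb_of_le (b := 2) (by norm_num) (by positivity) h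
    rw [Real.logb_rpow (by norm_num) (by norm_num), Real.logb_pow] at h1
    push_cast at h1
    linarith
  have h3 : (3 : ℝ) ≤ n := by exact_mod_cast hn
  have h1 : 3 / 2 ≤ Real.logb 2 n := by
    refine key _ _ (by linarith) ?_
    rw [show (2 : ℝ) * (3 / 2) = (3 : ℕ) by norm_num, Real.rpow_natCast]
    nlinarith
  refine key _ _ (by linarith) ?_
  rw [show (2 : ℝ) * (1 / 2) = 1 by norm_num, Real.rpow_one]
  nlinarith

theorem span_sortView_le {n : ℕ} (hn : 3 ≤ n) :
    ((sortView n).span : ℝ) ≤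
      908 * (Real.logb 2 n ^ 2 * Real.logb 2 (Real.logb 2 n)) := by
  have h1 : ((sortView n).span : ℝ) ≤ 5 * Nat.clog 2 n + 6 + Nat.clog 2 n *
      (9 + 10 * (Nat.clog 2 n * (3 * Nat.clog 2 (Nat.clog 2 n) + 3))) := by
    exact_mod_cast span_sortView n
  have h3 := clog_le_logb_add_one (n := n) (by omega)
  have h4 := one_le_logb (n := n) (by omega)
  have h5 := half_le_logb_logb hn
  have hc : 2 ≤ Nat.clog 2 n := by
    have := (Nat.lt_clog_iff_pow_lt (b := 2) (x := n) (y := 1) (by norm_num)).2 (by omega)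
    omega
  have h6 := clog_le_logb_add_one hc
  have h7 : Real.logb 2 (Nat.clog 2 n) ≤ 1 + Real.logb 2 (Real.logb 2 n) := by
    have : Real.logb 2 (Nat.clog 2 n) ≤ Real.logb 2 (2 * Real.logb 2 n) :=
      Real.logb_le_logb_of_le (by norm_num) (by exact_mod_cast (by omega : 0 < Nat.clog 2 n))
        (by linarith)
    rwa [Real.logb_mul (by norm_num) (by positivity), Real.logb_self_eq_one (by norm_num)] at this
  have h0 : (0 : ℝ) ≤ Nat.clog 2 n := by positivity
  have h0' : (0 : ℝ) ≤ Nat.clog 2 (Nat.clog 2 n) := by positivity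
  generalize Real.logb 2 (Nat.clog 2 n) = c₃ at *
  generalize (Nat.clog 2 (Nat.clog 2 n) : ℝ) = c₂ at *
  generalize Real.logb 2 (Real.logb 2 n) = l₂ at *
  generalize Real.logb 2 n = l at *
  generalize (Nat.clog 2 n : ℝ) = c at *
  -- `c₂ ≤ l₂ + 2` and `9 ≤ 18 * l₂`.
  have e1 : 3 * c₂ + 3 ≤ 21 * l₂ := by linarith
  have e2 : c ≤ 2 * l := by linarith
  have e3 : c * (3 * c₂ + 3) ≤ 2 * l * (21 * l₂) := mul_le_mul e2 e1 (by positivity) (by positivity)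
  have e4 : c * (9 + 10 * (c * (3 * c₂ + 3))) ≤ 2 * l * (9 + 10 * (2 * l * (21 * l₂))) :=
    mul_le_mul e2 (by linarith) (by positivity) (by positivity)
  have e5 : l ≤ 2 * (l ^ 2 * l₂) := by nlinarith [mul_le_mul h4 h5 (by norm_num) (by linarith)]
  nlinarith

theorem exists_tallCache {M B : ℕ} (hB : 1 ≤ B) (hM : B ^ 2 ≤ M) (h : 2 ^ 24 ≤ M) :
    ∃ μ, TallCache M B μ := by
  have h0 : M ≠ 0 := by omega
  have h1 : 24 ≤ Nat.log 2 M := (Nat.le_log_iff_pow_le (by norm_num) h0).2 h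
  refine ⟨Nat.log 2 M - 12, hB, hM, ?_, ?_, by omega⟩
  · rw [Nat.sub_add_cancel (by omega)]
    exact Nat.pow_log_le_self 2 h0
  · rw [show Nat.log 2 M - 12 + 13 = Nat.log 2 M + 1 by omega]
    exact Nat.lt_pow_succ_log_self (by norm_num) M

/-- Makes the search for the power of two affordable: its `O(log n)` misses are `O(n / B)`, since
`B` and `log n` are both `O(√n)`. -/
theorem clog_mul_le {n B : ℕ} (hn : 2 ≤ n) (hB : B ^ 2 ≤ n) : Nat.clog 2 n * B ≤ 3 * n := by
  have h1 : ∀ E : ℕ, E ^ 2 ≤ 4 * 2 ^ E := by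
    intro E
    induction E with
    | zero => norm_num
    | succ E ih =>
      rcases Nat.lt_or_ge E 3 with h | h
      · interval_cases E <;> norm_num
      · rw [pow_succ 2]; nlinarith
  have h2 := h1 (Nat.clog 2 n)
  have h3 := two_pow_clog_le hn
  have h4 : (Nat.clog 2 n * B) ^ 2 ≤ (3 * n) ^ 2 := by
    rw [mul_pow]
    calc _ ≤ (8 * n) * n := Nat.mul_le_mul (by omega) hB
      _ ≤ _ := by nlinarith
  exact (Nat.pow_le_pow_iff_left (by norm_num)).1 h4

theorem cacheMissesLE_sortView {n M B : ℕ} (hB : 1 ≤ B) (hM : 2 ≤ M) (hBM : B ^ 2 ≤ M)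
    (hn : M < n) :
    (sortView n).CacheMissesLE M B
      (3000000000 * ((n / B : ℝ) * Real.logb M n * max 1 (Real.logb 2 (n / M)))) := by
  have hB' : (1 : ℝ) ≤ B := by exact_mod_cast hB
  have hM' : (2 : ℝ) ≤ M := by exact_mod_cast hM
  have hn' : (M : ℝ) < n := by exact_mod_cast hn
  have hl := one_le_logb (n := n) (by omega)
  have hL := one_le_logb hM
  have hlL : Real.logb 2 M ≤ Real.logb 2 n :=
    Real.logb_le_logb_of_le (by norm_num) (by linarith) hn'.le
  have e1 : Real.logb M n = Real.logb 2 n / Real.logb 2 M := by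
    have h2 : Real.log 2 ≠ 0 := (Real.log_pos (by norm_num)).ne'
    have hM0 : Real.log M ≠ 0 := (Real.log_pos (by linarith)).ne'
    simp only [Real.logb]
    field_simp
  have e2 : Real.logb 2 (n / M) = Real.logb 2 n - Real.logb 2 M :=
    Real.logb_div (by linarith) (by linarith)
  rw [e1, e2]
  have hX : 1 ≤ max 1 (Real.logb 2 n - Real.logb 2 M) := le_max_left _ _
  have hX' : Real.logb 2 n - Real.logb 2 M ≤ max 1 (Real.logb 2 n - Real.logb 2 M) :=
    le_max_right _ _
  have hclog := clog_le_logb_add_one (n := n) (by omega)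
  generalize max 1 (Real.logb 2 n - Real.logb 2 M) = X at hX hX' ⊢
  have hnB : 1 ≤ (n : ℝ) / B := by
    rw [le_div_iff₀ (by linarith), one_mul]
    exact_mod_cast (show B ≤ n by nlinarith)
  have hq : 1 ≤ Real.logb 2 n / Real.logb 2 M := by
    rw [le_div_iff₀ (by linarith), one_mul]; exact hlL
  -- For small caches `B ≤ 4096` and `log M ≤ 24`, so one miss per access is affordable; `876 * 4096
  -- * 24 * 25` determines the size of the final constant.
  rcases Nat.lt_or_ge M (2 ^ 24) with hsmall | hlarge
  · have h1 : Real.logb 2 M ≤ 24 := by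
      rw [Real.logb_le_iff_le_rpow (by norm_num) (by linarith),
        show (24 : ℝ) = (24 : ℕ) by norm_num, Real.rpow_natCast]
      exact_mod_cast hsmall.le
    have h2 : (B : ℝ) ≤ 4096 := by
      have : B ^ 2 < 4096 ^ 2 := by omega
      exact_mod_cast (lt_of_pow_lt_pow_left₀ 2 (by norm_num) this).le
    have hlines : 1 ≤ M / B := by
      rw [Nat.le_div_iff_mul_le hB]; nlinarith
    refine ((Trace.Misses.of_weight hlines _).mono ?_).cacheMissesLE
    refine (weight_sortView_le (by omega)).trans ?_
    have h3 : (n : ℝ) ≤ 4096 * (n / B) := by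
      rw [← mul_div_assoc, le_div_iff₀ (by linarith)]
      nlinarith
    have h4 : Real.logb 2 n ≤ 24 * (Real.logb 2 n / Real.logb 2 M) := by
      rw [← mul_div_assoc, le_div_iff₀ (by linarith)]
      nlinarith
    have h5 : Real.logb 2 n ≤ 25 * X := by linarith
    calc 876 * (n * Real.logb 2 n ^ 2) = 876 * (n * Real.logb 2 n * Real.logb 2 n) := by ring
      _ ≤ 876 * (4096 * (n / B) * (24 * (Real.logb 2 n / Real.logb 2 M)) * (25 * X)) := by
        gcongr
      _ ≤ _ := by
        have : 0 ≤ (n / B : ℝ) * (Real.logb 2 n / Real.logb 2 M) * X := by positivity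
        nlinarith
  · obtain ⟨μ, hμ⟩ := exists_tallCache hB hBM hlarge
    have hle : n ≤ 2 ^ Nat.clog 2 n := Nat.le_pow_clog (by norm_num) n
    obtain ⟨j, hj⟩ : ∃ j, Nat.clog 2 n = μ + j := by
      have h1 : 2 ^ (μ + 12) < 2 ^ Nat.clog 2 n := hμ.le.trans_lt (hn.trans_le hle)
      have h2 := (Nat.pow_lt_pow_iff_right (by norm_num)).1 h1
      exact ⟨Nat.clog 2 n - μ, by omega⟩
    refine ((hμ.misses_sortView hj).mono ?_).cacheMissesLE
    have hL' : Real.logb 2 M ≤ μ + 13 := by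
      rw [Real.logb_le_iff_le_rpow (by norm_num) (by linarith),
        show (μ : ℝ) + 13 = (μ + 13 : ℕ) by push_cast; ring, Real.rpow_natCast]
      exact_mod_cast hμ.lt.le
    have hμ12 : (12 : ℝ) ≤ μ := by exact_mod_cast hμ.large
    have h1 : ((μ + j : ℕ) : ℝ) ≤ 2 * Real.logb 2 n := by rw [← hj]; linarith
    -- From `log M ≤ μ + 13`: `j + 1 ≤ log n - log M + 15`.
    have h2 : (j : ℝ) + 1 ≤ 16 * X := by
      have : (Nat.clog 2 n : ℝ) = μ + j := by exact_mod_cast hj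
      linarith
    have h3 : ((2 ^ (μ + j) : ℕ) : ℝ) ≤ 2 * n := by
      rw [← hj]; exact_mod_cast two_pow_clog_le (by omega)
    -- `log M ≤ μ + 13 ≤ 3 * μ`.
    have h4 : (B : ℝ) * (Real.logb 2 M / 3) ≤ B * μ := by gcongr; linarith
    have h5 : (μ + j : ℕ) * ((j : ℝ) + 1) * (2 ^ (μ + j) : ℕ) / (B * μ) ≤
        192 * ((n / B : ℝ) * (Real.logb 2 n / Real.logb 2 M) * X) := by
      calc (μ + j : ℕ) * ((j : ℝ) + 1) * (2 ^ (μ + j) : ℕ) / (B * μ) ≤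
          2 * Real.logb 2 n * (16 * X) * (2 * n) / (B * (Real.logb 2 M / 3)) := by
            gcongr
        _ = _ := by
          field_simp
          ring
    have h6 : ((μ + j : ℕ) : ℝ) ≤ 3 * (n / B) := by
      rw [← hj, ← mul_div_assoc, le_div_iff₀ (by linarith)]
      exact_mod_cast clog_mul_le (by omega) (hBM.trans hn.le)
    have h7 : (n : ℝ) / B ≤ (n / B : ℝ) * (Real.logb 2 n / Real.logb 2 M) * X := by
      rw [mul_assoc]
      exact le_mul_of_one_le_right (by linarith) (by nlinarith)
    linarith

end ForkJoin
theorem theorem3 :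
    ∃ (P : ForkJoin.Program) (c : ℕ) (C : ℝ) (view : ℕ → ForkJoin.Trace),
      -- the program obliviously sorts the keys of every linear order
      (∀ (α : Type u) [LinearOrder α],
        P.ObliviouslyRealizes (ForkJoin.KeyOps.ofLinearOrder α) (fun n => (n + 2) ^ c)
          (fun x => (x.insertionSort (· ≤ ·)).map ForkJoin.Word.key) view) ∧
      -- it is an implementation of bitonic sort: its outputs are those of the bitonic sorting
      -- network, for every interpretation of the comparator gates
      (∀ (α : Type u) (K : ForkJoin.KeyOps α),
        P.ObliviouslyRealizes K (fun n => (n + 2) ^ c) (ForkJoin.bitonicSort K) view) ∧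
      -- work and span
      (∀ n : ℕ, 3 ≤ n →
        ((view n).work : ℝ) ≤ C * (n * Real.logb 2 n ^ 2) ∧
        ((view n).span : ℝ) ≤ C * (Real.logb 2 n ^ 2 * Real.logb 2 (Real.logb 2 n))) ∧
      -- cache complexity
      (∀ n M B : ℕ, 1 ≤ B → 2 ≤ M → B ^ 2 ≤ M → M < n →
        (view n).CacheMissesLE M B
          (C * ((n / B : ℝ) * Real.logb M n * max 1 (Real.logb 2 (n / M))))) := by

  have bitonic : ∀ (α : Type u) (K : ForkJoin.KeyOps α),
      ForkJoin.sortProgram.ObliviouslyRealizes K (fun n => (n + 2) ^ 2) (ForkJoin.bitonicSort K)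
        ForkJoin.sortView :=
    fun α K => ForkJoin.obliviouslyRealizes_bitonicSort K
  refine ⟨ForkJoin.sortProgram, 2, 3000000000, ForkJoin.sortView, ?_, bitonic, ?_, ?_⟩
  · intro α _ x
    have h := bitonic α (ForkJoin.KeyOps.ofLinearOrder α) x
    rwa [ForkJoin.bitonicSort_ofLinearOrder] at h
  · intro n hn
    have h1 := Real.logb_nonneg (b := 2) (by norm_num) (x := n)
      (by exact_mod_cast (by omega : 1 ≤ n))
    have h2 := ForkJoin.half_le_logb_logb hn
    refine ⟨?_, (ForkJoin.span_sortView_le hn).trans ?_⟩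
    · have h3 : ((ForkJoin.sortView n).work : ℝ) ≤ (ForkJoin.sortView n).weight := by
        exact_mod_cast ForkJoin.Trace.work_le_weight _
      refine (h3.trans (ForkJoin.weight_sortView_le (by omega))).trans ?_
      gcongr
      norm_num
    · gcongr
      norm_num
  · intro n M B hB hM hBM hn
    exact ForkJoin.cacheMissesLE_sortView hB hM hBM hn
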